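/- For $y_0\in(0,1)$ and $\beta_0>0$ put $h=\sqrt{1-y_0^2}/y_0$, $V_0=-1/\sqrt{1-y_0^2}$. A *self-similar dust-like solution* with parameters $(y_0,\beta_0)$ consists of functions $V_1,V_2,U,\Lambda,\sigma_1,\sigma_2$ such that: (i) $U=\Lambda=0$ on $[0,y_0]$; $V_1,V_2$ are analytic on $(y_0,\infty)$, $V_1<V_2$ there, and for $y>y_0$ $$V_{1,2}(y)=\frac{-ye^{\Lambda}h\mp\sqrt{(ye^{\Lambda}h)^2-(e^{2U}-y^2e^{2\Lambda})(e^{2U}/y^2-h^2)}}{e^{2U}-y^2e^{2\Lambda}},$$ which are the two roots $V$ of $H(y,V)=h$, where $H(y,V)=\frac{e^{U}}{y}\sqrt{V^2y^2+1}+yVe^{\Lambda}$; (ii) as $y\to y_0^+$: $V_i\to V_0$, $(V_i-V_0)/\sqrt{y-y_0}\to K_i$ with $K_1<K_2$ real, and $\Lambda/\sqrt{y-y_0}$ and $U/\sqrt{y-y_0}$ have finite limits; (iii) for $y>y_0$, $\dfrac{d\sigma_i}{dy}=\Big(y+e^{U-\Lambda}\dfrac{V_iy}{\sqrt{V_i^2y^2+1}}\Big)^{-1}$,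 and $\sigma_i$ is continuous at $y_0$ with $\sigma_i(y_0)=0$; (iv) for $y>y_0$, $e^{-2\Lambda}(2y\Lambda_y-1)+1=8\pi y^2\tilde\rho$ and $e^{-2\Lambda}(2yU_y+1)-1=8\pi y^2\tilde p$, where $$\tilde\rho=\frac{\pi\beta_0}{y^3}\sum_{i=1}^2\frac{e^{2\sigma_i}\sqrt{V_i^2y^2+1}}{|\partial_VH(y,V_i)|},\qquad \tilde p=\frac{\pi\beta_0}{y}\sum_{i=1}^2\frac{e^{2\sigma_i}V_i^2}{|\partial_VH(y,V_i)|\sqrt{V_i^2y^2+1}}.$$ **Theorem.** There is $\varepsilon_0>0$ such that for every $y_0\in(0,\varepsilon_0)$, every $\beta_0>0$ and every self-similar dust-like solution with parameters $(y_0,\beta_0)$, as $y\to\infty$, $$U=\log\frac{y}{y_0}+\log\sqrt{1-y_0^2}+o(1),\qquad \Lambda\to\log\sqrt3,$$ $$V_1=-\frac{2y_0\sqrt{3(1-y_0^2)}}{(1-4y_0^2)\,y}\,(1+o(1)),$$ and, for some constant $C_1\in\mathbb R$ (possibly zero), $$V_2=-\frac{\sqrt{1-y_0^2}}{\sqrt3\,y_0}\,\frac1y\Big(\frac{y_0}{y}\Big)^2\,(C_1+o(1)).$$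 In particular $V_1\to0$ and $V_2\to0$ as $y\to\infty$. -/

import Mathlib

open Filter Topology Asymptotics Set

noncomputable section

namespace SelfSimilarDust

/-- The Hamiltonian `H(y,V) = (e^U / y) √(V² y² + 1) + y V e^Λ` whose level sets contain the
characteristic curves of the self-similar Vlasov equation. -/
def H (U Λ : ℝ → ℝ) (y V : ℝ) : ℝ :=
  Real.exp (U y) / y * √(V ^ 2 * y ^ 2 + 1) + y * V * Real.exp (Λ y)

/-- The partial derivative `∂H/∂V`. -/
def dHdV (U Λ : ℝ → ℝ) (y V : ℝ) : ℝ :=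
  Real.exp (U y) * (V * y / √(V ^ 2 * y ^ 2 + 1)) + y * Real.exp (Λ y)

theorem hasDerivAt_H (U Λ : ℝ → ℝ) {y : ℝ} (hy : y ≠ 0) (V : ℝ) :
    HasDerivAt (fun W => H U Λ y W) (dHdV U Λ y V) V := by
  have hpos : V ^ 2 * y ^ 2 + 1 ≠ 0 := by positivity
  have h1 : HasDerivAt (fun W : ℝ => W ^ 2 * y ^ 2 + 1) (2 * V * y ^ 2) V := by
    have h0 := (((hasDerivAt_id V).pow 2).mul_const (y ^ 2)).add_const 1
    simpa using h0
  have h2 := (h1.sqrt hpos).const_mul (Real.exp (U y) / y)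
  have h3 : HasDerivAt (fun W : ℝ => y * W * Real.exp (Λ y)) (y * Real.exp (Λ y)) V := by
    simpa using ((hasDerivAt_id V).const_mul y).mul_const (Real.exp (Λ y))
  refine (h2.add h3).congr_deriv ?_
  have hs : √(V ^ 2 * y ^ 2 + 1) ≠ 0 := by positivity
  unfold dHdV
  field_simp

/-- The energy `h = √(1 - y₀²) / y₀` of the level set carrying the particles. -/
def energy (y₀ : ℝ) : ℝ := √(1 - y₀ ^ 2) / y₀

/-- The quantity under the square root in the roots of `H(y,V) = h`. -/
def discr (y₀ : ℝ) (U Λ : ℝ → ℝ) (y : ℝ) : ℝ :=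
  (y * Real.exp (Λ y) * energy y₀) ^ 2
    - (Real.exp (2 * U y) - y ^ 2 * Real.exp (2 * Λ y))
      * (Real.exp (2 * U y) / y ^ 2 - energy y₀ ^ 2)

/-- The smaller root of `H(y,V) = h`. -/
def root₁ (y₀ : ℝ) (U Λ : ℝ → ℝ) (y : ℝ) : ℝ :=
  1 / (Real.exp (2 * U y) - y ^ 2 * Real.exp (2 * Λ y))
    * (-(y * Real.exp (Λ y) * energy y₀) - √(discr y₀ U Λ y))

/-- The larger root of `H(y,V) = h`. -/
def root₂ (y₀ : ℝ) (U Λ : ℝ → ℝ) (y : ℝ) : ℝ :=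
  1 / (Real.exp (2 * U y) - y ^ 2 * Real.exp (2 * Λ y))
    * (-(y * Real.exp (Λ y) * energy y₀) + √(discr y₀ U Λ y))

/-- The speed `dy/dσ = y + e^{U-Λ} V y / √(V² y² + 1)` along a characteristic. -/
def speed (U Λ : ℝ → ℝ) (y V : ℝ) : ℝ :=
  y + Real.exp (U y - Λ y) * (V * y / √(V ^ 2 * y ^ 2 + 1))

/-- The energy density of the measure
`Θ = β₀ χ_{y > y₀} ∑ᵢ e^{2σᵢ(y)} / |∂H/∂V (y, Vᵢ(y))| δ(V - Vᵢ(y))`. -/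
def density (y₀ β₀ : ℝ) (V₁ V₂ U Λ σ₁ σ₂ : ℝ → ℝ) (y : ℝ) : ℝ :=
  if y₀ < y then
    Real.pi * β₀ / y ^ 3 *
      (Real.exp (2 * σ₁ y) / |dHdV U Λ y (V₁ y)| * √(V₁ y ^ 2 * y ^ 2 + 1)
        + Real.exp (2 * σ₂ y) / |dHdV U Λ y (V₂ y)| * √(V₂ y ^ 2 * y ^ 2 + 1))
  else 0

/-- The radial pressure of the same measure. -/
def pressure (y₀ β₀ : ℝ) (V₁ V₂ U Λ σ₁ σ₂ : ℝ → ℝ) (y : ℝ) : ℝ :=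
  if y₀ < y then
    Real.pi * β₀ / y *
      (Real.exp (2 * σ₁ y) / |dHdV U Λ y (V₁ y)| * (V₁ y ^ 2 / √(V₁ y ^ 2 * y ^ 2 + 1))
        + Real.exp (2 * σ₂ y) / |dHdV U Λ y (V₂ y)| * (V₂ y ^ 2 / √(V₂ y ^ 2 * y ^ 2 + 1)))
  else 0

/-- The self-similar dust-like solutions of the massless Einstein-Vlasov system: the particles
lie on the two curves `V = V₁(y)` and `V = V₂(y)`, `y > y₀`, with parameters `σ₁`, `σ₂` along
them, and `U`, `Λ` are the metric functions, which vanish in the empty region `y ≤ y₀`. -/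
structure IsSolution (y₀ β₀ : ℝ) (V₁ V₂ U Λ σ₁ σ₂ : ℝ → ℝ) : Prop where
  analytic₁ : AnalyticOnNhd ℝ V₁ (Ioi y₀)
  analytic₂ : AnalyticOnNhd ℝ V₂ (Ioi y₀)
  V₁_eq : ∀ y, y₀ < y → V₁ y = root₁ y₀ U Λ y
  V₂_eq : ∀ y, y₀ < y → V₂ y = root₂ y₀ U Λ y
  lim_V₁ : Tendsto V₁ (𝓝[>] y₀) (𝓝 (-(1 / √(1 - y₀ ^ 2))))
  lim_V₂ : Tendsto V₂ (𝓝[>] y₀) (𝓝 (-(1 / √(1 - y₀ ^ 2))))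
  V₁_lt_V₂ : ∀ y, y₀ < y → V₁ y < V₂ y
  sqrt_V : ∃ K₁ K₂ : ℝ, K₁ < K₂ ∧
    Tendsto (fun y => (V₁ y - -(1 / √(1 - y₀ ^ 2))) / √(y - y₀)) (𝓝[>] y₀) (𝓝 K₁) ∧
    Tendsto (fun y => (V₂ y - -(1 / √(1 - y₀ ^ 2))) / √(y - y₀)) (𝓝[>] y₀) (𝓝 K₂)
  sqrt_Λ : ∃ θ₁ : ℝ, Tendsto (fun y => Λ y / √(y - y₀)) (𝓝[>] y₀) (𝓝 θ₁)
  sqrt_U : ∃ θ₂ : ℝ, Tendsto (fun y => U y / √(y - y₀)) (𝓝[>] y₀) (𝓝 θ₂)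
  vacuum : ∀ y ∈ Icc 0 y₀, U y = 0 ∧ Λ y = 0
  diff_Λ : ∀ y, y₀ < y → DifferentiableAt ℝ Λ y
  diff_U : ∀ y, y₀ < y → DifferentiableAt ℝ U y
  field_Λ : ∀ y, y₀ < y →
    Real.exp (-2 * Λ y) * (2 * y * deriv Λ y - 1) + 1
      = 8 * Real.pi * y ^ 2 * density y₀ β₀ V₁ V₂ U Λ σ₁ σ₂ y
  field_U : ∀ y, y₀ < y →
    Real.exp (-2 * Λ y) * (2 * y * deriv U y + 1) - 1
      = 8 * Real.pi * y ^ 2 * pressure y₀ β₀ V₁ V₂ U Λ σ₁ σ₂ y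
  deriv_σ₁ : ∀ y, y₀ < y → HasDerivAt σ₁ (1 / speed U Λ y (V₁ y)) y
  deriv_σ₂ : ∀ y, y₀ < y → HasDerivAt σ₂ (1 / speed U Λ y (V₂ y)) y
  cont_σ₁ : ContinuousWithinAt σ₁ (Ici y₀) y₀
  cont_σ₂ : ContinuousWithinAt σ₂ (Ici y₀) y₀
  σ₁_init : σ₁ y₀ = 0
  σ₂_init : σ₂ y₀ = 0

end SelfSimilarDust

end

/-!
In the variable `s = log y` the field equations and the characteristic equations become an
autonomous system for `A = e^U / y`, `B = e^Λ` and the rescaled particle densities `q₁`, `q₂`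
(`Orbit`), with the energy `h` as a parameter that is large when `y₀` is small. Put `N = B⁻²` and
`D = h² - A²`. Then `N' = 1 - N - E` and `A' / A = (1 + P - 3 N) / (2 N)`, where `E` and `P` are the
dimensionless energy density and radial pressure. The theorem says that every orbit tends to the
fixed point `A = h`, `B = √3`, at a rate `O(e^{-2s})` for `D`; since `V₁ y = -t₁` and `V₂ y = t₂` with
`t₂ (A S + B h) = D`, this is the claimed asymptotics of the roots. From the behaviour at `y₀` only
the limits of `D` and `B` are used, and the inequality `V₁ < V₂` gives `B < A` and `S > 0` for all `y`.

The fixed point is a saddle, so convergence cannot hold for arbitrary data; what excludes the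
unstable direction is that the solution exists for all `y`. The global part of the argument shows
that the orbit enters a fixed bounded range of `D`.

* `A² ≤ h² + 3`, since above this value `A` would blow up in finite time (`A_sq_le`); and an orbit
  with `N ≥ 9/10` from some time on would run into `A = B` (`not_forall_N_ge`).
* If `A ≤ h` decreases while `N` increases, both continue forever, the matter is diluted, `N` tends
  to `1`, and the orbit terminates (`not_expanding`). So `N` decreases whenever `A ≤ h` decreases.
* Phases far below `A = h` with `N > 1/3` and `N' < 0` have a bounded duration (`phase_short`), and
  at other times `A` increases there (`ψ_nonneg_of_le`). This gives `A ≥ c₀ h` (`A_ge`) and a lower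
  bound for `N` (`N_ge`).
* The combination `φ = q₂ - q₁ + 4 / B` satisfies `φ' ≈ -2 φ + 6 / B + 2 B` without singular terms,
  so the amount of matter is bounded for late times (`eventually_q_le`). At a maximum of `D` the
  density is at least `1/2`, which bounds `D` (`eventually_D_le`).

In the bounded range `A` reacts to `N - 1/3` on the fast time scale `1 / h`. As `D` is bounded,
`N - 1/3 = O(1/h)`, hence `φ - 2√3 = O(1/h²)`, and `E` is essentially a decreasing function of `D`
alone with the value `2/3` at `D = 0`. If `D` left a small interval around `0`, then `N - 1/3` would
grow at a definite rate, forwards or backwards in time, beyond this bound (`abs_lt_of_saddle`). So `D`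
becomes small and the linearisation applies. Its eigenvalues are `h`, `-h` and `-2`; a bounded orbit
avoids an unstable cone (`avoids_cone`), the other variables then decay (`saddle_decay`), and only
the eigenvalue `-2` contributes to the order `e^{-2s}` (`saddle_limits`).
-/

noncomputable section

namespace SelfSimilarDust

/-! ### Calculus on half-lines -/

/-- Induction along a half-line: a property that holds at `a`, propagates a little to the right,
and passes to left limits, holds on `[a, ∞)`. -/
theorem forall_ge_of_step {p : ℝ → Prop} {a : ℝ} (h0 : p a)
    (hr : ∀ s ≥ a, (∀ r ∈ Icc a s, p r) → ∀ᶠ r in 𝓝[>] s, p r)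
    (hl : ∀ s > a, (∀ r ∈ Ico a s, p r) → p s) : ∀ s ≥ a, p s := by
  by_contra! hne
  obtain ⟨b, hab, hb⟩ := hne
  set T : Set ℝ := {t | a ≤ t ∧ ¬ p t} with hT
  have hTne : T.Nonempty := ⟨b, hab, hb⟩
  have hTbdd : BddBelow T := ⟨a, fun t ht => ht.1⟩
  set m := sInf T with hm
  have ham : a ≤ m := le_csInf hTne fun t ht => ht.1
  have hlt : ∀ r ∈ Ico a m, p r := by
    intro r hr'
    by_contra hpr
    exact absurd (csInf_le hTbdd (show r ∈ T from ⟨hr'.1, hpr⟩)) (not_le.2 hr'.2)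
  have hpm : p m := by
    rcases ham.eq_or_lt with h | h
    · rw [← h]; exact h0
    · exact hl m h hlt
  have hle : ∀ r ∈ Icc a m, p r := by
    intro r hr'
    rcases hr'.2.eq_or_lt with h | h
    · rw [h]; exact hpm
    · exact hlt r ⟨hr'.1, h⟩
  have hev := hr m ham hle
  obtain ⟨u, hu, hsub⟩ := mem_nhdsGT_iff_exists_Ioo_subset.1 hev
  obtain ⟨t, ht, htu⟩ := exists_lt_of_csInf_lt hTne (show sInf T < u from hu)
  have hmt : m ≤ t := csInf_le hTbdd ht
  rcases hmt.eq_or_lt with h | h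
  · exact ht.2 (h ▸ hpm)
  · exact ht.2 (hsub ⟨h, htu⟩)

theorem le_of_hasDerivAt_nonneg {f f' : ℝ → ℝ} {a b : ℝ} (hab : a ≤ b)
    (hf : ∀ x ∈ Icc a b, HasDerivAt f (f' x) x) (h : ∀ x ∈ Ioo a b, 0 ≤ f' x) : f a ≤ f b := by
  have hm : MonotoneOn f (Icc a b) := by
    apply monotoneOn_of_deriv_nonneg (convex_Icc a b)
    · exact fun x hx => (hf x hx).continuousAt.continuousWithinAt
    · intro x hx
      rw [interior_Icc] at hx
      exact (hf x (Ioo_subset_Icc_self hx)).differentiableAt.differentiableWithinAt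
    · intro x hx
      rw [interior_Icc] at hx
      rw [(hf x (Ioo_subset_Icc_self hx)).deriv]
      exact h x hx
  exact hm ⟨le_rfl, hab⟩ ⟨hab, le_rfl⟩ hab

theorem le_of_hasDerivAt_nonpos {f f' : ℝ → ℝ} {a b : ℝ} (hab : a ≤ b)
    (hf : ∀ x ∈ Icc a b, HasDerivAt f (f' x) x) (h : ∀ x ∈ Ioo a b, f' x ≤ 0) : f b ≤ f a := by
  have := le_of_hasDerivAt_nonneg (f := fun x => -f x) (f' := fun x => -f' x) hab
    (fun x hx => (hf x hx).neg) (fun x hx => by have := h x hx; linarith)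
  linarith

theorem add_mul_le_of_hasDerivAt {f f' : ℝ → ℝ} {a b c : ℝ} (hab : a ≤ b)
    (hf : ∀ x ∈ Icc a b, HasDerivAt f (f' x) x) (h : ∀ x ∈ Ioo a b, c ≤ f' x) :
    f a + c * (b - a) ≤ f b := by
  have := le_of_hasDerivAt_nonneg (f := fun x => f x - c * x) (f' := fun x => f' x - c * 1) hab
    (fun x hx => (hf x hx).sub ((hasDerivAt_id x).const_mul c))
    (fun x hx => by have := h x hx; linarith)
  linarith

theorem le_add_mul_of_hasDerivAt {f f' : ℝ → ℝ} {a b c : ℝ} (hab : a ≤ b)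
    (hf : ∀ x ∈ Icc a b, HasDerivAt f (f' x) x) (h : ∀ x ∈ Ioo a b, f' x ≤ c) :
    f b ≤ f a + c * (b - a) := by
  have := add_mul_le_of_hasDerivAt (f := fun x => -f x) (f' := fun x => -f' x) (c := -c) hab
    (fun x hx => (hf x hx).neg) (fun x hx => by have := h x hx; linarith)
  linarith

theorem le_mul_exp_of_hasDerivAt {f f' : ℝ → ℝ} {a b k : ℝ} (hab : a ≤ b)
    (hf : ∀ x ∈ Icc a b, HasDerivAt f (f' x) x) (h : ∀ x ∈ Ioo a b, f' x ≤ -k * f x) :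
    f b ≤ f a * Real.exp (-k * (b - a)) := by
  have hd : ∀ x ∈ Icc a b, HasDerivAt (fun x => f x * Real.exp (k * x))
      ((f' x + k * f x) * Real.exp (k * x)) x := by
    intro x hx
    have h1 : HasDerivAt (fun x => Real.exp (k * x)) (Real.exp (k * x) * (k * 1)) x :=
      ((hasDerivAt_id x).const_mul k).exp
    exact ((hf x hx).mul h1).congr_deriv (by ring)
  have := le_of_hasDerivAt_nonpos hab hd (fun x hx => by
    have := h x hx
    exact mul_nonpos_of_nonpos_of_nonneg (by linarith) (Real.exp_pos _).le)
  have h2 : Real.exp (-k * (b - a)) = Real.exp (k * a) * Real.exp (-(k * b)) := by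
    rw [← Real.exp_add]; congr 1; ring
  rw [h2, ← mul_assoc]
  calc f b = f b * Real.exp (k * b) * Real.exp (-(k * b)) := by
        rw [mul_assoc, ← Real.exp_add]; simp
    _ ≤ _ := mul_le_mul_of_nonneg_right this (Real.exp_pos _).le

theorem mul_exp_le_of_hasDerivAt {f f' : ℝ → ℝ} {a b k : ℝ} (hab : a ≤ b)
    (hf : ∀ x ∈ Icc a b, HasDerivAt f (f' x) x) (h : ∀ x ∈ Ioo a b, k * f x ≤ f' x) :
    f a * Real.exp (k * (b - a)) ≤ f b := by
  have := le_mul_exp_of_hasDerivAt (f := fun x => -f x) (f' := fun x => -f' x) (k := -k) hab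
    (fun x hx => (hf x hx).neg) (fun x hx => by have := h x hx; linarith)
  simp only [neg_neg] at this
  linarith

theorem eventually_pos_nhdsGT {f : ℝ → ℝ} {f' s : ℝ} (hf : HasDerivAt f f' s)
    (h0 : 0 ≤ f s) (h1 : f s = 0 → 0 < f') : ∀ᶠ r in 𝓝[>] s, 0 < f r := by
  rcases h0.eq_or_lt with h | h
  · have hs := hasDerivAt_iff_tendsto_slope.1 hf
    have hs' : Tendsto (slope f s) (𝓝[>] s) (𝓝 f') :=
      hs.mono_left (nhdsWithin_mono _ fun x (hx : s < x) => ne_of_gt hx)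
    filter_upwards [hs'.eventually (lt_mem_nhds (h1 h.symm)), self_mem_nhdsWithin] with r hr hsr
    have hsr' : 0 < r - s := sub_pos.2 hsr
    rw [slope_def_field, ← h, sub_zero] at hr
    have := mul_pos hr hsr'
    rwa [div_mul_cancel₀ _ hsr'.ne'] at this
  · exact (hf.continuousAt.eventually (lt_mem_nhds h)).filter_mono nhdsWithin_le_nhds

theorem le_of_forall_Ico {f : ℝ → ℝ} {a s c : ℝ} (has : a < s) (hf : ContinuousAt f s)
    (h : ∀ r ∈ Ico a s, f r ≤ c) : f s ≤ c := by
  refine le_of_tendsto (hf.tendsto.mono_left (nhdsWithin_le_nhds (s := Iio s))) ?_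
  filter_upwards [Ioo_mem_nhdsLT has] with r hr using h r ⟨hr.1.le, hr.2⟩

theorem ge_of_forall_Ico {f : ℝ → ℝ} {a s c : ℝ} (has : a < s) (hf : ContinuousAt f s)
    (h : ∀ r ∈ Ico a s, c ≤ f r) : c ≤ f s := by
  refine ge_of_tendsto (hf.tendsto.mono_left (nhdsWithin_le_nhds (s := Iio s))) ?_
  filter_upwards [Ioo_mem_nhdsLT has] with r hr using h r ⟨hr.1.le, hr.2⟩

/-- A quadrant in which the flow points strictly inwards along both edges is forward invariant. -/
theorem quadrant_invariant {f g f' g' : ℝ → ℝ} {a : ℝ}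
    (hf : ∀ s ≥ a, HasDerivAt f (f' s) s) (hg : ∀ s ≥ a, HasDerivAt g (g' s) s)
    (hfa : 0 ≤ f a) (hga : 0 ≤ g a)
    (hfs : ∀ s ≥ a, (∀ r ∈ Icc a s, 0 ≤ f r ∧ 0 ≤ g r) → f s = 0 → 0 < f' s)
    (hgs : ∀ s ≥ a, (∀ r ∈ Icc a s, 0 ≤ f r ∧ 0 ≤ g r) → g s = 0 → 0 < g' s) :
    ∀ s ≥ a, 0 ≤ f s ∧ 0 ≤ g s := by
  apply forall_ge_of_step (p := fun s => 0 ≤ f s ∧ 0 ≤ g s) ⟨hfa, hga⟩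
  · intro s hs hp
    have hps := hp s ⟨hs, le_rfl⟩
    filter_upwards [eventually_pos_nhdsGT (hf s hs) hps.1 (hfs s hs hp),
      eventually_pos_nhdsGT (hg s hs) hps.2 (hgs s hs hp)] with r h1 h2
    exact ⟨h1.le, h2.le⟩
  · intro s hs hp
    exact ⟨ge_of_forall_Ico hs (hf s hs.le).continuousAt fun r hr => (hp r hr).1,
      ge_of_forall_Ico hs (hg s hs.le).continuousAt fun r hr => (hp r hr).2⟩

theorem exists_first_eq {f : ℝ → ℝ} {a b c : ℝ} (hab : a ≤ b) (hf : ContinuousOn f (Icc a b))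
    (ha : f a < c) (hb : c ≤ f b) : ∃ t ∈ Ioc a b, f t = c ∧ ∀ x ∈ Ico a t, f x < c := by
  set T : Set ℝ := Icc a b ∩ f ⁻¹' Ici c with hT
  have hTc : IsClosed T := hf.preimage_isClosed_of_isClosed isClosed_Icc isClosed_Ici
  have hTne : T.Nonempty := ⟨b, ⟨hab, le_rfl⟩, hb⟩
  have hTb : BddBelow T := ⟨a, fun t ht => ht.1.1⟩
  have hm := hTc.csInf_mem hTne hTb
  set m := sInf T
  have hlt : ∀ x ∈ Ico a m, f x < c := by
    intro x hx
    by_contra! hc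
    exact absurd (csInf_le hTb (show x ∈ T from ⟨⟨hx.1, hx.2.le.trans hm.1.2⟩, hc⟩))
      (not_le.2 hx.2)
  have ham : a < m := by
    rcases hm.1.1.eq_or_lt with h | h
    · exact absurd hm.2 (by rw [← h]; exact not_le.2 ha)
    · exact h
  refine ⟨m, ⟨ham, hm.1.2⟩, le_antisymm ?_ hm.2, hlt⟩
  have hcm : Tendsto f (𝓝[<] m) (𝓝 (f m)) := by
    have := (hf m hm.1).mono_left (nhdsWithin_mono m (show Ico a m ⊆ Icc a b from
      fun x hx => ⟨hx.1, hx.2.le.trans hm.1.2⟩))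
    rwa [nhdsWithin_Ico_eq_nhdsLT ham] at this
  refine le_of_tendsto hcm ?_
  filter_upwards [Ioo_mem_nhdsLT ham] with x hx
  exact (hlt x ⟨hx.1.le, hx.2⟩).le

theorem exists_last_eq {f : ℝ → ℝ} {a b c : ℝ} (hab : a ≤ b) (hf : ContinuousOn f (Icc a b))
    (ha : f a ≤ c) (hb : c < f b) : ∃ t ∈ Ico a b, f t = c ∧ ∀ x ∈ Ioc t b, c < f x := by
  have hg : ContinuousOn (fun x => -f (-x)) (Icc (-b) (-a)) := by
    refine (hf.comp continuousOn_neg ?_).neg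
    intro x hx
    exact ⟨by linarith [hx.2], by linarith [hx.1]⟩
  obtain ⟨t, ht, h1, h2⟩ := exists_first_eq (c := -c) (neg_le_neg hab) hg (by simpa using hb)
    (by simpa using ha)
  refine ⟨-t, ⟨by linarith [ht.2], by linarith [ht.1]⟩, by linarith, ?_⟩
  intro x hx
  have := h2 (-x) ⟨by linarith [hx.2], by linarith [hx.1]⟩
  simp only [neg_neg] at this
  linarith

/-! ### The autonomous system -/

/-- A self-similar dust-like solution with energy `h`, written in the logarithmic variable
`s = log y > s₀` as an orbit of an autonomous system. Here `A = e^U / y` and `B = e^Λ`, while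
`S` is `√(h² + B² - A²)` and `qᵢ` is `8 π² β₀ e^{2σᵢ} / y²`. The functions `tᵢ = |Vᵢ| y` and
`cᵢ = √(Vᵢ² y² + 1)` are determined by the roots of `H(y,V) = h`; the conditions `B < A` and
`0 < S` say that these roots exist and are distinct. The two limits at `s₀` are all that is
needed from the behaviour at `y₀`. -/
structure Orbit (h s₀ : ℝ) where
  A : ℝ → ℝ
  B : ℝ → ℝ
  S : ℝ → ℝ
  c₁ : ℝ → ℝ
  c₂ : ℝ → ℝ
  t₁ : ℝ → ℝ
  t₂ : ℝ → ℝ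
  q₁ : ℝ → ℝ
  q₂ : ℝ → ℝ
  h_pos : 0 < h
  A_pos : ∀ s > s₀, 0 < A s
  B_pos : ∀ s > s₀, 0 < B s
  S_pos : ∀ s > s₀, 0 < S s
  q₁_pos : ∀ s > s₀, 0 < q₁ s
  q₂_pos : ∀ s > s₀, 0 < q₂ s
  B_lt_A : ∀ s > s₀, B s < A s
  S_sq : ∀ s > s₀, S s ^ 2 = h ^ 2 + B s ^ 2 - A s ^ 2
  c₁_eq : ∀ s > s₀, c₁ s = (A s * h + B s * S s) / (A s ^ 2 - B s ^ 2)
  c₂_eq : ∀ s > s₀, c₂ s = (A s * h - B s * S s) / (A s ^ 2 - B s ^ 2)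
  t₁_eq : ∀ s > s₀, t₁ s = (B s * h + A s * S s) / (A s ^ 2 - B s ^ 2)
  t₂_eq : ∀ s > s₀, t₂ s = (A s * S s - B s * h) / (A s ^ 2 - B s ^ 2)
  dA : ∀ s > s₀, HasDerivAt A
    (A s * ((B s ^ 2 * (1 + (q₁ s * t₁ s ^ 2 + q₂ s * t₂ s ^ 2) / S s) - 3) / 2)) s
  dB : ∀ s > s₀, HasDerivAt B
    (B s * ((1 - B s ^ 2 + B s ^ 2 * ((q₁ s * c₁ s ^ 2 + q₂ s * c₂ s ^ 2) / S s)) / 2)) s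
  dq₁ : ∀ s > s₀, HasDerivAt q₁ (-2 * q₁ s * (1 + B s * c₁ s / S s)) s
  dq₂ : ∀ s > s₀, HasDerivAt q₂ (-2 * q₂ s * (1 - B s * c₂ s / S s)) s
  A_lim : Tendsto (fun s => h ^ 2 - A s ^ 2) (𝓝[>] s₀) (𝓝 (-1))
  B_lim : Tendsto B (𝓝[>] s₀) (𝓝 1)

namespace Orbit

variable {h s₀ : ℝ} (o : Orbit h s₀)

/-- The dimensionless energy density. -/
def E (s : ℝ) : ℝ := (o.q₁ s * o.c₁ s ^ 2 + o.q₂ s * o.c₂ s ^ 2) / o.S s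

/-- The dimensionless radial pressure. -/
def P (s : ℝ) : ℝ := (o.q₁ s * o.t₁ s ^ 2 + o.q₂ s * o.t₂ s ^ 2) / o.S s

/-- The trace `E - P`. -/
def μ (s : ℝ) : ℝ := (o.q₁ s + o.q₂ s) / o.S s

/-- The metric coefficient `e^{-2Λ}`. -/
def N (s : ℝ) : ℝ := (o.B s ^ 2)⁻¹

/-- The deviation of `A²` from its limit `h²`. -/
def D (s : ℝ) : ℝ := h ^ 2 - o.A s ^ 2

/-- The right-hand side of `N' = J`. -/
def J (s : ℝ) : ℝ := 1 - o.N s - o.E s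

/-- The quantity whose sign is that of `A'`. -/
def ψ (s : ℝ) : ℝ := 1 + o.P s - 3 * o.N s

/-- The logarithmic derivative of `A`. -/
def a (s : ℝ) : ℝ := (o.B s ^ 2 * (1 + o.P s) - 3) / 2

/-- The logarithmic derivative of `B`. -/
def l (s : ℝ) : ℝ := (1 - o.B s ^ 2 + o.B s ^ 2 * o.E s) / 2

/-- The deviation of the dilution rate of the first stream, `q₁' = -2 q₁ (1 + b₁)`, from `2`. -/
def b₁ (s : ℝ) : ℝ := o.B s * o.c₁ s / o.S s

/-- The deviation of the dilution rate of the second stream, `q₂' = -2 q₂ (1 - b₂)`, from `2`. -/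
def b₂ (s : ℝ) : ℝ := o.B s * o.c₂ s / o.S s

/-- The contribution of the first stream to the energy density. -/
def E₁ (s : ℝ) : ℝ := o.q₁ s * o.c₁ s ^ 2 / o.S s

/-- The contribution of the second stream to the energy density. -/
def E₂ (s : ℝ) : ℝ := o.q₂ s * o.c₂ s ^ 2 / o.S s

/-- The contribution of the first stream to the radial pressure. -/
def P₁ (s : ℝ) : ℝ := o.q₁ s * o.t₁ s ^ 2 / o.S s

/-- The contribution of the second stream to the radial pressure. -/
def P₂ (s : ℝ) : ℝ := o.q₂ s * o.t₂ s ^ 2 / o.S s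

/-- The dilution of the energy density: the sum over the streams of `Eᵢ` times the rate of decay
of `qᵢ`. -/
def X (s : ℝ) : ℝ := 2 * (o.E₁ s * (1 + o.b₁ s) + o.E₂ s * (1 - o.b₂ s))

variable {s : ℝ}

theorem E_eq_add : o.E s = o.E₁ s + o.E₂ s := by simp only [E, E₁, E₂]; ring

theorem P_eq_add : o.P s = o.P₁ s + o.P₂ s := by simp only [P, P₁, P₂]; ring

section pointwise

variable (hs : s₀ < s)
include hs

theorem R_pos : 0 < o.A s ^ 2 - o.B s ^ 2 := by
  have := o.B_lt_A s hs
  have := o.B_pos s hs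
  nlinarith

theorem A_mul_t₁ : o.A s * o.t₁ s = o.S s + o.B s * o.c₁ s := by
  have := o.R_pos hs
  rw [o.t₁_eq s hs, o.c₁_eq s hs]; field_simp; ring

theorem A_mul_t₂ : o.A s * o.t₂ s = o.S s - o.B s * o.c₂ s := by
  have := o.R_pos hs
  rw [o.t₂_eq s hs, o.c₂_eq s hs]; field_simp; ring

theorem c₁_sq : o.c₁ s ^ 2 = o.t₁ s ^ 2 + 1 := by
  have := o.R_pos hs
  rw [o.t₁_eq s hs, o.c₁_eq s hs]; field_simp
  linear_combination (-o.A s ^ 2 + o.B s ^ 2) * o.S_sq s hs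

theorem c₂_sq : o.c₂ s ^ 2 = o.t₂ s ^ 2 + 1 := by
  have := o.R_pos hs
  rw [o.t₂_eq s hs, o.c₂_eq s hs]; field_simp
  linear_combination (-o.A s ^ 2 + o.B s ^ 2) * o.S_sq s hs

theorem t₁_pos : 0 < o.t₁ s := by
  rw [o.t₁_eq s hs]
  have := o.R_pos hs; have := o.A_pos s hs; have := o.B_pos s hs; have := o.S_pos s hs
  have := o.h_pos
  positivity

theorem c₁_pos : 0 < o.c₁ s := by
  rw [o.c₁_eq s hs]
  have := o.R_pos hs; have := o.A_pos s hs; have := o.B_pos s hs; have := o.S_pos s hs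
  have := o.h_pos
  positivity

theorem S_lt : o.S s < h := by
  have := o.R_pos hs
  have := o.S_sq s hs
  have := o.h_pos
  nlinarith

theorem c₂_pos : 0 < o.c₂ s := by
  rw [o.c₂_eq s hs]
  have := o.R_pos hs; have := o.A_pos s hs; have := o.B_pos s hs; have := o.S_pos s hs
  have := o.S_lt hs; have := o.B_lt_A s hs
  apply div_pos _ (o.R_pos hs)
  nlinarith

theorem one_le_c₁ : 1 ≤ o.c₁ s := by
  have := o.c₁_sq hs; have := o.c₁_pos hs
  nlinarith [sq_nonneg (o.t₁ s)]

theorem one_le_c₂ : 1 ≤ o.c₂ s := by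
  have := o.c₂_sq hs; have := o.c₂_pos hs
  nlinarith [sq_nonneg (o.t₂ s)]

theorem t₂_mul : o.t₂ s * (o.A s * o.S s + o.B s * h) = o.D s := by
  have := o.R_pos hs
  rw [o.t₂_eq s hs, D]; field_simp
  linear_combination o.A s ^ 2 * o.S_sq s hs

theorem S_sq_eq : o.S s ^ 2 = o.D s + o.B s ^ 2 := by
  rw [o.S_sq s hs, D]; ring

theorem N_pos : 0 < o.N s := by
  have := o.B_pos s hs
  unfold N; positivity

theorem B_sq_mul_N : o.B s ^ 2 * o.N s = 1 := by
  have := o.B_pos s hs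
  unfold N; field_simp

omit hs in
theorem B_sq_eq : o.B s ^ 2 = 1 / o.N s := by
  simp [N]

theorem μ_pos : 0 < o.μ s := by
  have := o.q₁_pos s hs; have := o.q₂_pos s hs; have := o.S_pos s hs
  unfold μ; positivity

theorem E_eq : o.E s = o.P s + o.μ s := by
  simp only [E, P, μ, o.c₁_sq hs, o.c₂_sq hs]; ring

theorem P₁_pos : 0 < o.P₁ s := by
  have := o.q₁_pos s hs; have := o.t₁_pos hs; have := o.S_pos s hs
  unfold P₁; positivity

theorem P₂_nonneg : 0 ≤ o.P₂ s := by
  have := o.q₂_pos s hs; have := o.S_pos s hs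
  unfold P₂; positivity

theorem E₁_pos : 0 < o.E₁ s := by
  have := o.q₁_pos s hs; have := o.c₁_pos hs; have := o.S_pos s hs
  unfold E₁; positivity

theorem E₂_pos : 0 < o.E₂ s := by
  have := o.q₂_pos s hs; have := o.c₂_pos hs; have := o.S_pos s hs
  unfold E₂; positivity

theorem P_pos : 0 < o.P s := by
  have := o.P₁_pos hs; have := o.P₂_nonneg hs
  rw [o.P_eq_add]; positivity

theorem E_pos : 0 < o.E s := by
  have := o.P_pos hs; have := o.μ_pos hs
  rw [o.E_eq hs]; positivity

theorem P₁_le : o.P₁ s ≤ o.E₁ s := by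
  have := o.q₁_pos s hs; have := o.S_pos s hs
  unfold P₁ E₁; rw [o.c₁_sq hs]; gcongr; linarith

theorem P₂_le : o.P₂ s ≤ o.E₂ s := by
  have := o.q₂_pos s hs; have := o.S_pos s hs
  unfold P₂ E₂; rw [o.c₂_sq hs]; gcongr; linarith

theorem a_eq : o.a s = o.ψ s / (2 * o.N s) := by
  have := o.N_pos hs
  unfold a ψ; rw [o.B_sq_eq]; field_simp

theorem l_eq : o.l s = -o.J s / (2 * o.N s) := by
  have := o.N_pos hs
  unfold l J; rw [o.B_sq_eq]; field_simp; ring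

theorem one_add_a : 1 + o.a s = (1 + o.P s - o.N s) / (2 * o.N s) := by
  have := o.N_pos hs
  unfold a; rw [o.B_sq_eq]; field_simp; ring

theorem b₁_pos : 0 < o.b₁ s := by
  have := o.B_pos s hs; have := o.c₁_pos hs; have := o.S_pos s hs
  unfold b₁; positivity

theorem b₂_pos : 0 < o.b₂ s := by
  have := o.B_pos s hs; have := o.c₂_pos hs; have := o.S_pos s hs
  unfold b₂; positivity

theorem one_sub_b₂ : 1 - o.b₂ s = o.A s * o.t₂ s / o.S s := by
  have := o.S_pos s hs
  rw [o.A_mul_t₂ hs, b₂]; field_simp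

theorem one_add_b₁ : 1 + o.b₁ s = o.A s * o.t₁ s / o.S s := by
  have := o.S_pos s hs
  rw [o.A_mul_t₁ hs, b₁]; field_simp

theorem one_sub_b₂_eq :
    1 - o.b₂ s = o.A s * o.D s / (o.S s * (o.A s * o.S s + o.B s * h)) := by
  have := o.S_pos s hs; have := o.A_pos s hs; have := o.B_pos s hs; have := o.h_pos
  rw [o.one_sub_b₂ hs, ← o.t₂_mul hs]; field_simp

theorem c₂_le_c₁ : o.c₂ s ≤ o.c₁ s := by
  have := o.S_pos s hs; have := o.B_pos s hs; have := o.R_pos hs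
  rw [o.c₁_eq s hs, o.c₂_eq s hs]
  gcongr
  nlinarith [mul_pos (o.B_pos s hs) (o.S_pos s hs)]

theorem b₂_le_b₁ : o.b₂ s ≤ o.b₁ s := by
  have := o.S_pos s hs; have := o.B_pos s hs; have := o.c₂_le_c₁ hs
  unfold b₁ b₂; gcongr

theorem neg_one_lt_a (hN : o.N s < 1) : -1 < o.a s := by
  have h1 := o.one_add_a hs
  have := o.N_pos hs; have := o.P_pos hs
  have : 0 < (1 + o.P s - o.N s) / (2 * o.N s) := by apply div_pos <;> linarith
  linarith

/-- The pressure, expressed through the dilution rates of the two streams. -/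
theorem A_sq_mul_P : o.A s ^ 2 * o.P s / o.S s ^ 2
    = (1 + o.b₁ s) ^ 2 * (o.q₁ s / o.S s) + (1 - o.b₂ s) ^ 2 * (o.q₂ s / o.S s) := by
  have := o.S_pos s hs
  rw [o.one_add_b₁ hs, o.one_sub_b₂ hs, P]; field_simp

end pointwise

/-! ### Evolution equations for the derived quantities -/

section evolution

variable (hs : s₀ < s)
include hs

theorem hasDerivAt_A : HasDerivAt o.A (o.A s * o.a s) s := o.dA s hs

theorem hasDerivAt_B : HasDerivAt o.B (o.B s * o.l s) s := o.dB s hs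

theorem hasDerivAt_q₁ : HasDerivAt o.q₁ (-2 * o.q₁ s * (1 + o.b₁ s)) s := o.dq₁ s hs

theorem hasDerivAt_q₂ : HasDerivAt o.q₂ (-2 * o.q₂ s * (1 - o.b₂ s)) s := o.dq₂ s hs

theorem hasDerivAt_D : HasDerivAt o.D (-2 * o.A s ^ 2 * o.a s) s := by
  have := ((o.hasDerivAt_A hs).pow 2).const_sub (h ^ 2)
  exact this.congr_deriv (by norm_num; ring)

theorem hasDerivAt_N : HasDerivAt o.N (o.J s) s := by
  have hB := (o.B_pos s hs).ne'
  have := ((o.hasDerivAt_B hs).pow 2).inv (pow_ne_zero 2 hB)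
  refine this.congr_deriv ?_
  unfold J N l
  simp only [Pi.pow_apply]
  field_simp
  norm_num
  ring

theorem hasDerivAt_S :
    HasDerivAt o.S ((o.B s ^ 2 * o.l s - o.A s ^ 2 * o.a s) / o.S s) s := by
  have hpos := o.S_pos s hs
  have h1 : HasDerivAt (fun s => h ^ 2 + o.B s ^ 2 - o.A s ^ 2)
      (2 * (o.B s ^ 2 * o.l s - o.A s ^ 2 * o.a s)) s := by
    have := (((o.hasDerivAt_B hs).pow 2).const_add (h ^ 2)).sub ((o.hasDerivAt_A hs).pow 2)
    exact this.congr_deriv (by norm_num; ring)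
  have h2 := h1.sqrt (by rw [← o.S_sq s hs]; positivity)
  have heq : o.S =ᶠ[𝓝 s] fun s => √(h ^ 2 + o.B s ^ 2 - o.A s ^ 2) := by
    filter_upwards [lt_mem_nhds hs] with r hr
    rw [← o.S_sq r hr, Real.sqrt_sq (o.S_pos r hr).le]
  refine (h2.congr_of_eventuallyEq heq).congr_deriv ?_
  rw [← o.S_sq s hs, Real.sqrt_sq hpos.le]
  field_simp

theorem hasDerivAt_c₁ : HasDerivAt o.c₁
    (-o.t₁ s * (o.A s * o.a s * o.c₁ s - o.B s * o.l s * o.t₁ s) / o.S s) s := by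
  have hS := o.S_pos s hs
  have hR := o.R_pos hs
  have h1 := (((o.hasDerivAt_A hs).mul_const h).add
    ((o.hasDerivAt_B hs).mul (o.hasDerivAt_S hs))).div
    (((o.hasDerivAt_A hs).pow 2).sub ((o.hasDerivAt_B hs).pow 2)) hR.ne'
  have heq : o.c₁ =ᶠ[𝓝 s] fun s => (o.A s * h + o.B s * o.S s) / (o.A s ^ 2 - o.B s ^ 2) := by
    filter_upwards [lt_mem_nhds hs] with r hr using o.c₁_eq r hr
  refine (h1.congr_of_eventuallyEq heq).congr_deriv ?_
  rw [o.c₁_eq s hs, o.t₁_eq s hs]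
  simp only [Pi.pow_apply, Pi.mul_apply, Pi.add_apply, Pi.sub_apply]
  norm_num
  have hS2 := o.S_sq s hs
  field_simp
  have : h ^ 2 = o.S s ^ 2 - o.B s ^ 2 + o.A s ^ 2 := by linarith
  ring_nf
  simp only [this]
  ring

theorem hasDerivAt_c₂ : HasDerivAt o.c₂
    (-o.t₂ s * (o.A s * o.a s * o.c₂ s + o.B s * o.l s * o.t₂ s) / o.S s) s := by
  have hS := o.S_pos s hs
  have hR := o.R_pos hs
  have h1 := (((o.hasDerivAt_A hs).mul_const h).sub
    ((o.hasDerivAt_B hs).mul (o.hasDerivAt_S hs))).div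
    (((o.hasDerivAt_A hs).pow 2).sub ((o.hasDerivAt_B hs).pow 2)) hR.ne'
  have heq : o.c₂ =ᶠ[𝓝 s] fun s => (o.A s * h - o.B s * o.S s) / (o.A s ^ 2 - o.B s ^ 2) := by
    filter_upwards [lt_mem_nhds hs] with r hr using o.c₂_eq r hr
  refine (h1.congr_of_eventuallyEq heq).congr_deriv ?_
  rw [o.c₂_eq s hs, o.t₂_eq s hs]
  simp only [Pi.pow_apply, Pi.mul_apply, Pi.sub_apply]
  norm_num
  have hS2 := o.S_sq s hs
  field_simp
  have : h ^ 2 = o.S s ^ 2 - o.B s ^ 2 + o.A s ^ 2 := by linarith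
  ring_nf
  simp only [this]
  ring

theorem hasDerivAt_E : HasDerivAt o.E (-(1 + o.a s) * o.X s
    + o.a s * o.E s * o.A s ^ 2 / o.S s ^ 2
    + o.l s * (2 * o.b₁ s * o.P₁ s - 2 * o.b₂ s * o.P₂ s
      - o.E s * o.B s ^ 2 / o.S s ^ 2)) s := by
  have hS := o.S_pos s hs
  have h1 := (((o.hasDerivAt_q₁ hs).mul ((o.hasDerivAt_c₁ hs).pow 2)).add
    ((o.hasDerivAt_q₂ hs).mul ((o.hasDerivAt_c₂ hs).pow 2))).div (o.hasDerivAt_S hs) hS.ne'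
  refine h1.congr_deriv ?_
  simp only [Pi.pow_apply, Pi.mul_apply, Pi.add_apply, X, E, E₁, E₂, P₁, P₂, b₁, b₂]
  have e1 := o.A_mul_t₁ hs
  have e2 := o.A_mul_t₂ hs
  norm_num
  field_simp
  linear_combination (-2 * o.S s * o.q₁ s * o.c₁ s ^ 2 * o.a s) * e1
    + (-2 * o.S s * o.q₂ s * o.c₂ s ^ 2 * o.a s) * e2

theorem hasDerivAt_μ : HasDerivAt o.μ
    (-2 * ((1 + o.b₁ s) * (o.q₁ s / o.S s) + (1 - o.b₂ s) * (o.q₂ s / o.S s))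
      - o.μ s * (o.B s ^ 2 * o.l s - o.A s ^ 2 * o.a s) / o.S s ^ 2) s := by
  have hS := o.S_pos s hs
  have h1 := ((o.hasDerivAt_q₁ hs).add (o.hasDerivAt_q₂ hs)).div (o.hasDerivAt_S hs) hS.ne'
  refine h1.congr_deriv ?_
  simp only [Pi.add_apply, μ]
  field_simp
  ring

end evolution

/-! ### Bounds valid along every orbit -/

theorem E₁_eq (hs : s₀ < s) : o.E₁ s = o.P₁ s + o.q₁ s / o.S s := by
  simp only [E₁, P₁, o.c₁_sq hs]; ring

theorem E₂_eq (hs : s₀ < s) : o.E₂ s = o.P₂ s + o.q₂ s / o.S s := by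
  simp only [E₂, P₂, o.c₂_sq hs]; ring

/-- The function `(1 - N) e^s` increases and vanishes at `s₀`. -/
theorem N_lt_one (hs : s₀ < s) : o.N s < 1 := by
  set f : ℝ → ℝ := fun r => (1 - o.N r) * Real.exp r with hf
  have hd : ∀ r > s₀, HasDerivAt f (o.E r * Real.exp r) r := by
    intro r hr
    refine (((o.hasDerivAt_N hr).const_sub 1).mul (Real.hasDerivAt_exp r)).congr_deriv ?_
    unfold J; ring
  have hmono : StrictMonoOn f (Ioi s₀) := by
    apply strictMonoOn_of_deriv_pos (convex_Ioi s₀)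
    · exact fun r hr => (hd r hr).continuousAt.continuousWithinAt
    · intro r hr
      rw [interior_Ioi] at hr
      rw [(hd r hr).deriv]
      exact mul_pos (o.E_pos hr) (Real.exp_pos r)
  have hlim : Tendsto f (𝓝[>] s₀) (𝓝 0) := by
    have h1 : Tendsto o.N (𝓝[>] s₀) (𝓝 ((1 : ℝ) ^ 2)⁻¹) := (o.B_lim.pow 2).inv₀ (by norm_num)
    have h2 : Tendsto Real.exp (𝓝[>] s₀) (𝓝 (Real.exp s₀)) :=
      Real.continuous_exp.continuousAt.tendsto.mono_left nhdsWithin_le_nhds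
    simpa using (h1.const_sub 1).mul h2
  have hge : ∀ r > s₀, 0 ≤ f r := by
    intro r hr
    refine le_of_tendsto hlim ?_
    filter_upwards [Ioo_mem_nhdsGT hr] with t ht
    exact (hmono ht.1 hr ht.2).le
  have h1 := hge ((s₀ + s) / 2) (by linarith)
  have h2 := hmono (show (s₀ + s) / 2 ∈ Ioi s₀ by rw [mem_Ioi]; linarith) hs
    (by linarith : (s₀ + s) / 2 < s)
  have h3 : 0 < (1 - o.N s) * Real.exp s := h1.trans_lt h2
  have := pos_of_mul_pos_left h3 (Real.exp_pos s).le
  linarith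

/-- Since `S² > 0` bounds `B²` from below by `A² - h²`, the function `A²` would blow up in finite
time if it exceeded `h² + 3`. -/
theorem A_sq_le (hs : s₀ < s) : o.A s ^ 2 ≤ h ^ 2 + 3 := by
  by_contra! hc
  have hd : ∀ r ≥ s, HasDerivAt (fun r => o.A r ^ 2) (2 * o.A r ^ 2 * o.a r) r := by
    intro r hr
    exact ((o.hasDerivAt_A (hs.trans_le hr)).pow 2).congr_deriv (by norm_num; ring)
  have hbd : ∀ r ≥ s, o.A r ^ 2 * (o.A r ^ 2 - h ^ 2 - 3) ≤ 2 * o.A r ^ 2 * o.a r := by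
    intro r hr
    have hr' := hs.trans_le hr
    have h1 := o.S_sq r hr'
    have h2 := o.S_pos r hr'
    have h3 := o.P_pos hr'
    have h4 : o.A r ^ 2 - h ^ 2 - 3 ≤ 2 * o.a r := by
      unfold a
      have : 0 ≤ o.B r ^ 2 * o.P r := by positivity
      nlinarith
    nlinarith [sq_nonneg (o.A r)]
  have hinv : ∀ r ≥ s, 0 ≤ o.A r ^ 2 - o.A s ^ 2 ∧ 0 ≤ o.A r ^ 2 - o.A s ^ 2 := by
    have hk : ∀ r ≥ s, o.A r ^ 2 - o.A s ^ 2 = 0 → 0 < 2 * o.A r ^ 2 * o.a r := by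
      intro r hr he
      refine lt_of_lt_of_le ?_ (hbd r hr)
      have hA := o.A_pos r (hs.trans_le hr)
      have : 0 < o.A r ^ 2 - h ^ 2 - 3 := by linarith
      positivity
    exact quadrant_invariant (fun r hr => (hd r hr).sub_const _) (fun r hr => (hd r hr).sub_const _)
      (by simp) (by simp) (fun r hr _ => hk r hr) (fun r hr _ => hk r hr)
  have hAs := o.A_pos s hs
  set c : ℝ := 1 - (h ^ 2 + 3) / o.A s ^ 2 with hc'
  have hc0 : 0 < c := by
    rw [hc', sub_pos, div_lt_one (by positivity)]; exact hc
  have hd' : ∀ r ≥ s, HasDerivAt (fun r => (o.A r ^ 2)⁻¹)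
      (-(2 * o.A r ^ 2 * o.a r) / (o.A r ^ 2) ^ 2) r := by
    intro r hr
    exact (hd r hr).inv (pow_ne_zero 2 (o.A_pos r (hs.trans_le hr)).ne')
  have hup : ∀ r ≥ s, -(2 * o.A r ^ 2 * o.a r) / (o.A r ^ 2) ^ 2 ≤ -c := by
    intro r hr
    have hA := o.A_pos r (hs.trans_le hr)
    have h1 := hbd r hr
    have h2 := (hinv r hr).1
    rw [div_le_iff₀ (by positivity)]
    have h3 : c ≤ 1 - (h ^ 2 + 3) / o.A r ^ 2 := by
      rw [hc']
      have : (h ^ 2 + 3) / o.A r ^ 2 ≤ (h ^ 2 + 3) / o.A s ^ 2 :=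
        div_le_div_of_nonneg_left (by positivity) (by positivity) (by linarith)
      linarith
    have h4 : c * o.A r ^ 2 ≤ o.A r ^ 2 - (h ^ 2 + 3) := by
      have := mul_le_mul_of_nonneg_right h3 (sq_nonneg (o.A r))
      have e : (1 - (h ^ 2 + 3) / o.A r ^ 2) * o.A r ^ 2 = o.A r ^ 2 - (h ^ 2 + 3) := by
        field_simp
      linarith
    nlinarith [sq_nonneg (o.A r)]
  set b : ℝ := s + (o.A s ^ 2)⁻¹ / c with hb
  have hsb : s ≤ b := by rw [hb]; have : 0 < (o.A s ^ 2)⁻¹ / c := by positivity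
                         linarith
  have := le_add_mul_of_hasDerivAt hsb (fun r hr => hd' r hr.1) (fun r hr => hup r hr.1.le)
  have hpos : 0 < (o.A b ^ 2)⁻¹ := by have := o.A_pos b (hs.trans_le hsb); positivity
  have he : -c * (b - s) = -(o.A s ^ 2)⁻¹ := by rw [hb]; field_simp; ring
  rw [he] at this
  linarith

theorem one_lt_A_sq_mul_N (hs : s₀ < s) : 1 < o.A s ^ 2 * o.N s := by
  have h1 := o.R_pos hs
  have h2 := o.B_sq_mul_N hs
  have h3 := o.N_pos hs
  nlinarith

theorem one_lt_A_sq (hs : s₀ < s) : 1 < o.A s ^ 2 := by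
  have h1 := o.one_lt_A_sq_mul_N hs
  have h2 := o.N_lt_one hs
  have h3 := o.N_pos hs
  nlinarith [sq_nonneg (o.A s)]

/-- An orbit cannot stay in an almost flat region: `A` would reach `B` in finite time. -/
theorem not_forall_N_ge {s₁ : ℝ} (h₁ : s₀ < s₁) (hN : ∀ s ≥ s₁, 9 / 10 ≤ o.N s) : False := by
  have hd : ∀ r ≥ s₁, HasDerivAt (fun r => o.A r ^ 2 * o.N r)
      (o.A r ^ 2 * (2 - o.μ r - 4 * o.N r)) r := by
    intro r hr
    have hr' := h₁.trans_le hr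
    refine (((o.hasDerivAt_A hr').pow 2).mul (o.hasDerivAt_N hr')).congr_deriv ?_
    have := o.N_pos hr'
    rw [o.a_eq hr', ψ, J, o.E_eq hr']
    norm_num
    field_simp
    ring
  set W := o.A s₁ ^ 2 * o.N s₁
  have hW : 0 < W := by have := o.one_lt_A_sq_mul_N h₁; positivity
  have := le_add_mul_of_hasDerivAt (c := -1) (show s₁ ≤ s₁ + W by linarith)
    (fun r hr => hd r hr.1) (fun r hr => by
      have hr' := h₁.trans hr.1
      have h1 := hN r hr.1.le
      have h2 := o.one_lt_A_sq hr'
      have h3 := o.μ_pos hr'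
      nlinarith)
  have h4 := o.one_lt_A_sq_mul_N (s := s₁ + W) (by linarith)
  linarith

theorem B_le_S (hs : s₀ < s) (hD : 0 ≤ o.D s) : o.B s ≤ o.S s := by
  have := o.S_sq_eq hs; have := o.S_pos s hs
  nlinarith

theorem b₂_le_one (hs : s₀ < s) (hD : 0 ≤ o.D s) : o.b₂ s ≤ 1 := by
  have h1 := o.one_sub_b₂_eq hs
  have := o.S_pos s hs; have := o.A_pos s hs; have := o.B_pos s hs; have := o.h_pos
  have h2 : 0 ≤ o.A s * o.D s / (o.S s * (o.A s * o.S s + o.B s * h)) := by positivity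
  linarith

/-- For `A ≤ h` the pressure is controlled by the dilution of the energy density. -/
theorem X_ge (hs : s₀ < s) (hD : 0 ≤ o.D s) :
    o.A s ^ 2 * o.P s / o.S s ^ 2 ≤ o.X s := by
  have hS := o.S_pos s hs
  have hq1 := div_pos (o.q₁_pos s hs) hS
  have hq2 := div_pos (o.q₂_pos s hs) hS
  have hb1 := o.b₁_pos hs
  have hb2 := o.b₂_le_one hs hD
  have hb2' := o.b₂_pos hs
  have hc1 := o.one_le_c₁ hs
  have hc2 := o.one_le_c₂ hs
  have hbc : o.b₁ s ≤ o.c₁ s := by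
    have := o.B_le_S hs hD
    unfold b₁; rw [div_le_iff₀ hS]; nlinarith
  rw [o.A_sq_mul_P hs]
  have e1 : o.E₁ s = o.c₁ s ^ 2 * (o.q₁ s / o.S s) := by unfold E₁; ring
  have e2 : o.E₂ s = o.c₂ s ^ 2 * (o.q₂ s / o.S s) := by unfold E₂; ring
  rw [X, e1, e2]
  have k1 : (1 + o.b₁ s) ^ 2 ≤ 2 * (o.c₁ s ^ 2 * (1 + o.b₁ s)) := by
    have : 1 + o.b₁ s ≤ 2 * o.c₁ s ^ 2 := by nlinarith
    nlinarith
  have k2 : (1 - o.b₂ s) ^ 2 ≤ 2 * (o.c₂ s ^ 2 * (1 - o.b₂ s)) := by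
    have : 1 - o.b₂ s ≤ 2 * o.c₂ s ^ 2 := by nlinarith
    nlinarith
  nlinarith [mul_le_mul_of_nonneg_right k1 hq1.le, mul_le_mul_of_nonneg_right k2 hq2.le]

theorem X_pos (hs : s₀ < s) (hD : 0 ≤ o.D s) : 0 < o.X s := by
  have := o.X_ge hs hD
  have h1 := o.A_pos s hs; have h2 := o.P_pos hs; have h3 := o.S_pos s hs
  have : 0 < o.A s ^ 2 * o.P s / o.S s ^ 2 := by positivity
  linarith

/-- The time derivative of `E`, see `hasDerivAt_E`. -/
def E' (s : ℝ) : ℝ := -(1 + o.a s) * o.X s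
    + o.a s * o.E s * o.A s ^ 2 / o.S s ^ 2
    + o.l s * (2 * o.b₁ s * o.P₁ s - 2 * o.b₂ s * o.P₂ s - o.E s * o.B s ^ 2 / o.S s ^ 2)

/-- The time derivative of `ψ`. -/
def ψ' (s : ℝ) : ℝ := o.E' s - (-2 * ((1 + o.b₁ s) * (o.q₁ s / o.S s)
      + (1 - o.b₂ s) * (o.q₂ s / o.S s))
      - o.μ s * (o.B s ^ 2 * o.l s - o.A s ^ 2 * o.a s) / o.S s ^ 2) - 3 * o.J s

theorem hasDerivAt_J (hs : s₀ < s) : HasDerivAt o.J (-o.J s - o.E' s) s :=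
  (((o.hasDerivAt_N hs).const_sub 1).sub (o.hasDerivAt_E hs))

theorem hasDerivAt_ψ (hs : s₀ < s) : HasDerivAt o.ψ (o.ψ' s) s := by
  have h1 := ((o.hasDerivAt_E hs).sub (o.hasDerivAt_μ hs)).const_add 1
  have h2 := h1.sub ((o.hasDerivAt_N hs).const_mul 3)
  refine HasDerivAt.congr_of_eventuallyEq h2 ?_
  filter_upwards [lt_mem_nhds hs] with r hr
  simp only [ψ, Pi.sub_apply, o.E_eq hr]; ring

/-- `N` has a strict local minimum wherever it is stationary above `1/3` with `A ≤ h`. -/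
theorem E'_neg (hs : s₀ < s) (hD : 0 ≤ o.D s) (hN : 1 / 3 ≤ o.N s) (hJ : o.J s = 0) :
    o.E' s < 0 := by
  have hl : o.l s = 0 := by rw [o.l_eq hs, hJ]; simp
  have hE : o.E s = 1 - o.N s := by unfold J at hJ; linarith
  have hX := o.X_pos hs hD
  have hN1 := o.N_lt_one hs
  have hN0 := o.N_pos hs
  have hP := o.P_pos hs
  have h1 := o.one_add_a hs
  have h1p := o.neg_one_lt_a hs hN1
  have hEp := o.E_pos hs
  have hA := o.A_pos s hs
  have hS := o.S_pos s hs
  rw [E', hl]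
  rcases le_or_gt (o.a s) 0 with ha | ha
  · have : o.a s * o.E s * o.A s ^ 2 / o.S s ^ 2 ≤ 0 := by
      apply div_nonpos_of_nonpos_of_nonneg _ (by positivity)
      apply mul_nonpos_of_nonpos_of_nonneg _ (by positivity)
      exact mul_nonpos_of_nonpos_of_nonneg ha hEp.le
    nlinarith
  · have hXg := o.X_ge hs hD
    have h2 : o.a s = (1 + o.P s - 3 * o.N s) / (2 * o.N s) := by rw [o.a_eq hs, ψ]
    have key : o.a s * o.E s < (1 + o.a s) * o.P s := by
      rw [h1, h2, hE, div_mul_eq_mul_div, div_mul_eq_mul_div]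
      apply div_lt_div_of_pos_right _ (by linarith)
      nlinarith [mul_nonneg (sub_nonneg.2 hN1.le) (sub_nonneg.2 hN), sq_pos_of_pos hP]
    have h3 : (1 + o.a s) * (o.A s ^ 2 * o.P s / o.S s ^ 2) ≤ (1 + o.a s) * o.X s :=
      mul_le_mul_of_nonneg_left hXg (by linarith)
    have h4 : o.a s * o.E s * o.A s ^ 2 / o.S s ^ 2
        < (1 + o.a s) * (o.A s ^ 2 * o.P s / o.S s ^ 2) := by
      have h5 : 0 < o.A s ^ 2 / o.S s ^ 2 := by positivity
      have h6 := mul_lt_mul_of_pos_right key h5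
      calc _ = o.a s * o.E s * (o.A s ^ 2 / o.S s ^ 2) := by ring
        _ < _ := h6
        _ = _ := by ring
    linarith

/-- While `N` increases and `A ≤ h`, the function `A` can only turn from increasing to
decreasing. -/
theorem ψ'_neg (hs : s₀ < s) (hD : 0 ≤ o.D s) (hψ : o.ψ s = 0) (hJ : 0 ≤ o.J s) :
    o.ψ' s < 0 := by
  have ha : o.a s = 0 := by rw [o.a_eq hs, hψ]; simp
  have hN1 := o.N_lt_one hs
  have hN0 := o.N_pos hs
  have hP1 := o.P₁_pos hs
  have hP2 := o.P₂_nonneg hs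
  have hPE := o.P_eq_add (s := s)
  have hμ := o.μ_pos hs
  have hEP := o.E_eq hs
  have hb1 := o.b₁_pos hs
  have hb2 := o.b₂_le_one hs hD
  have hb2' := o.b₂_pos hs
  have hBS := o.B_le_S hs hD
  have hS := o.S_pos s hs
  have hB := o.B_pos s hs
  have hP : o.P s ≤ 1 := by unfold J at hJ; linarith
  have hr : o.B s ^ 2 / o.S s ^ 2 ≤ 1 := by
    rw [div_le_one (by positivity)]; gcongr
  have hr0 : 0 < o.B s ^ 2 / o.S s ^ 2 := by positivity
  set r := o.B s ^ 2 / o.S s ^ 2 with hr'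
  set k := -o.l s with hk
  have hJk : o.J s = 2 * o.N s * k := by
    rw [hk, o.l_eq hs]; field_simp
  have hk0 : 0 ≤ k := by
    by_contra! hneg
    nlinarith
  have hN3 : 3 * o.N s = 1 + o.P s := by unfold ψ at hψ; linarith
  have e : o.ψ' s = -2 * (o.P₁ s * (1 + o.b₁ s) + o.P₂ s * (1 - o.b₂ s))
      + k * (o.P s * r + 2 * o.b₂ s * o.P₂ s - 2 * o.b₁ s * o.P₁ s) - 6 * o.N s * k := by
    rw [ψ', E', ha, hJk, X, o.E₁_eq hs, o.E₂_eq hs, hEP, μ, hr', hk]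
    ring
  rw [e]
  have k1 : o.P s * r + 2 * o.b₂ s * o.P₂ s - 2 * o.b₁ s * o.P₁ s ≤ o.P s + 2 * o.P₂ s := by
    nlinarith [mul_pos hb1 hP1]
  have k2 : o.P s + 2 * o.P₂ s ≤ 6 * o.N s := by linarith
  nlinarith [mul_nonneg hk0 (sub_nonneg.2 (k1.trans k2)), mul_pos hb1 hP1,
    mul_nonneg hP2 (sub_nonneg.2 hb2)]

/-! ### Expanding orbits reach the light cone -/

theorem X_ge_mul (hs : s₀ < s) : 2 * (1 - o.b₂ s) * o.E s ≤ o.X s := by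
  have h1 := o.E₁_pos hs
  have h2 := o.b₁_pos hs
  have h3 := o.b₂_pos hs
  rw [X, o.E_eq_add]
  nlinarith [mul_pos h1 h2, mul_pos h1 h3]

theorem one_sub_b₂_ge (hs : s₀ < s) (hD : 0 ≤ o.D s) :
    o.D s / (2 * h ^ 2) ≤ 1 - o.b₂ s := by
  have hS := o.S_pos s hs; have hA := o.A_pos s hs; have hB := o.B_pos s hs; have := o.h_pos
  have hSh := o.S_lt hs
  have hBA := o.B_lt_A s hs
  rw [o.one_sub_b₂_eq hs, div_le_div_iff₀ (by positivity) (by positivity)]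
  have : o.S s * (o.A s * o.S s + o.B s * h) ≤ o.A s * (2 * h ^ 2) := by
    have h1 : o.A s * o.S s + o.B s * h ≤ o.A s * (2 * h) := by nlinarith
    calc _ ≤ h * (o.A s * (2 * h)) := by gcongr
      _ = _ := by ring
  calc _ ≤ o.D s * (o.A s * (2 * h ^ 2)) := by gcongr
    _ = _ := by ring

theorem D_mono {r : ℝ} (hs : s₀ < s) (hsr : s ≤ r) (hψ : ∀ t ∈ Ioo s r, o.ψ t ≤ 0) :
    o.D s ≤ o.D r := by
  apply le_of_hasDerivAt_nonneg hsr (fun t ht => o.hasDerivAt_D (hs.trans_le ht.1))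
  intro t ht
  have ht' := hs.trans ht.1
  have hN := o.N_pos ht'
  have : o.a t ≤ 0 := by
    rw [o.a_eq ht']; exact div_nonpos_of_nonpos_of_nonneg (hψ t ht) (by linarith)
  nlinarith [sq_nonneg (o.A t)]

theorem D_anti {r : ℝ} (hs : s₀ < s) (hsr : s ≤ r) (hψ : ∀ t ∈ Ioo s r, 0 ≤ o.ψ t) :
    o.D r ≤ o.D s := by
  apply le_of_hasDerivAt_nonpos hsr (fun t ht => o.hasDerivAt_D (hs.trans_le ht.1))
  intro t ht
  have ht' := hs.trans ht.1
  have hN := o.N_pos ht'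
  have : 0 ≤ o.a t := by
    rw [o.a_eq ht']; exact div_nonneg (hψ t ht) (by linarith)
  nlinarith [sq_nonneg (o.A t)]

/-- The source terms of `E'` while `N` increases are controlled by `N' = J`. -/
theorem E'_le_of_J_nonneg (hs : s₀ < s) (hD : 0 ≤ o.D s) (hψ : o.ψ s ≤ 0) (hJ : 0 ≤ o.J s)
    (hN : o.N s ≤ 9 / 10) :
    o.E' s ≤ -(o.D s / (20 * h ^ 2)) * o.E s + 9 / 2 * o.J s * o.E s := by
  have hN0 := o.N_pos hs
  have hP := o.P_pos hs
  have hE := o.E_pos hs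
  have hS := o.S_pos s hs
  have hh := o.h_pos
  have hP1 := o.P₁_pos hs
  have hP2 := o.P₂_nonneg hs
  have hb1 := o.b₁_pos hs
  have hb2 := o.b₂_le_one hs hD
  have hb2' := o.b₂_pos hs
  have hBS := o.B_le_S hs hD
  have hB := o.B_pos s hs
  have hN3 : 1 + o.P s ≤ 3 * o.N s := by unfold ψ at hψ; linarith
  have h1 : 1 / 20 ≤ 1 + o.a s := by
    rw [o.one_add_a hs, le_div_iff₀ (by linarith)]; linarith
  have ha : o.a s ≤ 0 := by
    rw [o.a_eq hs]; exact div_nonpos_of_nonpos_of_nonneg hψ (by linarith)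
  have h2 : o.a s * o.E s * o.A s ^ 2 / o.S s ^ 2 ≤ 0 := by
    apply div_nonpos_of_nonpos_of_nonneg _ (by positivity)
    apply mul_nonpos_of_nonpos_of_nonneg _ (by positivity)
    exact mul_nonpos_of_nonpos_of_nonneg ha hE.le
  have h3 : o.D s / (h ^ 2) * o.E s ≤ o.X s := by
    refine le_trans ?_ (o.X_ge_mul hs)
    have := mul_le_mul_of_nonneg_right (o.one_sub_b₂_ge hs hD) hE.le
    have e : o.D s / (h ^ 2) * o.E s = 2 * (o.D s / (2 * h ^ 2) * o.E s) := by field_simp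
    rw [e]; linarith
  have h4 : 1 / 20 * (o.D s / (h ^ 2) * o.E s) ≤ (1 + o.a s) * o.X s := by
    apply mul_le_mul h1 h3 (by positivity) (by linarith)
  have hr : o.B s ^ 2 / o.S s ^ 2 ≤ 1 := by
    rw [div_le_one (by positivity)]; gcongr
  have hr0 : 0 < o.B s ^ 2 / o.S s ^ 2 := by positivity
  have hPE : o.P₂ s ≤ o.E s := by have := o.P₂_le hs; have := o.E₁_pos hs; rw [o.E_eq_add]; linarith
  have h5 : o.l s * (2 * o.b₁ s * o.P₁ s - 2 * o.b₂ s * o.P₂ s - o.E s * o.B s ^ 2 / o.S s ^ 2)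
      ≤ 9 / 2 * o.J s * o.E s := by
    have hl : -o.l s ≤ 3 / 2 * o.J s := by
      rw [o.l_eq hs, neg_div, neg_neg, div_le_iff₀ (by linarith)]; nlinarith
    have hl0 : 0 ≤ -o.l s := by
      rw [o.l_eq hs, neg_div, neg_neg]; exact div_nonneg hJ (by linarith)
    have h6 : 2 * o.b₂ s * o.P₂ s + o.E s * o.B s ^ 2 / o.S s ^ 2 - 2 * o.b₁ s * o.P₁ s
        ≤ 3 * o.E s := by
      have : o.E s * o.B s ^ 2 / o.S s ^ 2 = o.E s * (o.B s ^ 2 / o.S s ^ 2) := by ring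
      rw [this]
      nlinarith [mul_pos hb1 hP1]
    calc _ = -o.l s * (2 * o.b₂ s * o.P₂ s + o.E s * o.B s ^ 2 / o.S s ^ 2
          - 2 * o.b₁ s * o.P₁ s) := by ring
      _ ≤ -o.l s * (3 * o.E s) := mul_le_mul_of_nonneg_left h6 hl0
      _ ≤ (3 / 2 * o.J s) * (3 * o.E s) := mul_le_mul_of_nonneg_right hl (by linarith)
      _ = _ := by ring
  have h7 : 1 / 20 * (o.D s / (h ^ 2) * o.E s) = o.D s / (20 * h ^ 2) * o.E s := by
    field_simp
  rw [E']
  linarith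

/-- Once `N` increases and `A` decreases below `h`, this goes on forever; the matter is diluted,
`N` tends to `1`, and the orbit runs into the light cone `A = B`. -/
theorem not_expanding {s₁ : ℝ} (h₁ : s₀ < s₁) (hD : 0 ≤ o.D s₁) (hψ : o.ψ s₁ ≤ 0)
    (hJ : 0 ≤ o.J s₁) : False := by
  have hh := o.h_pos
  have hDr : ∀ s ≥ s₁, (∀ r ∈ Icc s₁ s, 0 ≤ -o.ψ r ∧ 0 ≤ o.J r) → 0 ≤ o.D s := by
    intro s hs hr
    exact hD.trans (o.D_mono h₁ hs fun t ht => by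
      have := (hr t ⟨ht.1.le, ht.2.le⟩).1; linarith)
  have hN3 : ∀ s > s₀, o.ψ s ≤ 0 → 1 / 3 ≤ o.N s := by
    intro s hs h1
    have := o.P_pos hs
    unfold ψ at h1; linarith
  have hinv : ∀ s ≥ s₁, 0 ≤ -o.ψ s ∧ 0 ≤ o.J s := by
    apply quadrant_invariant (f := fun s => -o.ψ s) (f' := fun s => -o.ψ' s) (g' := fun s => -o.J s - o.E' s)
      (fun s hs => (o.hasDerivAt_ψ (h₁.trans_le hs)).neg)
      (fun s hs => o.hasDerivAt_J (h₁.trans_le hs)) (by linarith) hJ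
    · intro s hs hr h0
      have := o.ψ'_neg (h₁.trans_le hs) (hDr s hs hr) (by linarith) (hr s ⟨hs, le_rfl⟩).2
      linarith
    · intro s hs hr h0
      have hψs := (hr s ⟨hs, le_rfl⟩).1
      have := o.E'_neg (h₁.trans_le hs) (hDr s hs hr)
        (hN3 s (h₁.trans_le hs) (by linarith)) h0
      rw [h0]; linarith
  have hD0 : ∀ s ≥ s₁, 0 ≤ o.D s := fun s hs => hDr s hs fun r hr => hinv r hr.1
  have hNle : ∀ s ≥ s₁, o.N s ≤ 9 / 10 := by
    intro s hs
    by_contra! hc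
    refine o.not_forall_N_ge (h₁.trans_le hs) fun r hr => ?_
    have := le_of_hasDerivAt_nonneg hr
      (fun t ht => o.hasDerivAt_N ((h₁.trans_le hs).trans_le ht.1))
      (fun t ht => (hinv t (hs.trans ht.1.le)).2)
    linarith
  -- the strict inequalities hold at every later time
  set s₂ := s₁ + 1 with hs₂
  have h₂ : s₀ < s₂ := by linarith
  have hmem : ∀ᶠ r in 𝓝 s₂, s₁ ≤ r := by
    filter_upwards [lt_mem_nhds (show s₁ < s₂ by linarith)] with r hr using hr.le
  have hψ2 : o.ψ s₂ < 0 := by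
    by_contra! hc
    have h0 : o.ψ s₂ = 0 := by have := (hinv s₂ (by linarith)).1; linarith
    have hmax : IsLocalMax o.ψ s₂ := by
      filter_upwards [hmem] with r hr
      have := (hinv r hr).1; linarith
    have := hmax.hasDerivAt_eq_zero (o.hasDerivAt_ψ h₂)
    have := o.ψ'_neg h₂ (hD0 s₂ (by linarith)) h0 (hinv s₂ (by linarith)).2
    linarith
  have hD2 : 0 < o.D s₂ := by
    by_contra! hc
    have h0 : o.D s₂ = 0 := le_antisymm hc (hD0 s₂ (by linarith))
    have hmin : IsLocalMin o.D s₂ := by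
      filter_upwards [hmem] with r hr
      rw [h0]; exact hD0 r hr
    have h1 := hmin.hasDerivAt_eq_zero (o.hasDerivAt_D h₂)
    have hA := o.A_pos s₂ h₂
    have hN := o.N_pos h₂
    have h2 : o.a s₂ < 0 := by rw [o.a_eq h₂]; exact div_neg_of_neg_of_pos hψ2 (by linarith)
    nlinarith [sq_pos_of_pos hA]
  have hDge : ∀ s ≥ s₂, o.D s₂ ≤ o.D s := fun s hs => o.D_mono h₂ hs fun t ht => by
    have := (hinv t (by linarith [ht.1])).1; linarith
  set k := o.D s₂ / (20 * h ^ 2) with hk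
  have hk0 : 0 < k := by positivity
  -- exponential decay of `E`
  have hdec : ∀ s ≥ s₂, o.E s * Real.exp (-(9 / 2) * o.N s)
      ≤ o.E s₂ * Real.exp (-(9 / 2) * o.N s₂) * Real.exp (-k * (s - s₂)) := by
    intro s hs
    refine le_mul_exp_of_hasDerivAt hs (f := fun s => o.E s * Real.exp (-(9 / 2) * o.N s))
      (f' := fun s => (o.E' s - 9 / 2 * o.J s * o.E s) * Real.exp (-(9 / 2) * o.N s)) ?_ ?_
    · intro r hr
      have hr' := h₂.trans_le hr.1
      refine ((o.hasDerivAt_E hr').mul (((o.hasDerivAt_N hr').const_mul (-(9 / 2))).exp)).congr_deriv ?_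
      unfold E'; ring
    · intro r hr
      have hr' := h₂.trans hr.1
      have hr1 : s₁ ≤ r := by linarith [hr.1]
      have h1 := o.E'_le_of_J_nonneg hr' (hD0 r hr1) (by linarith [(hinv r hr1).1])
        (hinv r hr1).2 (hNle r hr1)
      have h2 : k ≤ o.D r / (20 * h ^ 2) := by rw [hk]; gcongr; exact hDge r hr.1.le
      have h3 := mul_le_mul_of_nonneg_right h2 (o.E_pos hr').le
      rw [← mul_assoc]
      apply mul_le_mul_of_nonneg_right _ (Real.exp_pos _).le
      linarith
  have hlim : Tendsto (fun s => o.E s₂ * Real.exp (9 / 2) * Real.exp (-k * (s - s₂))) atTop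
      (𝓝 0) := by
    have h1 : Tendsto (fun s : ℝ => -k * (s - s₂)) atTop atBot := by
      apply Tendsto.const_mul_atTop_of_neg (by linarith)
      exact tendsto_atTop_add_const_right _ _ tendsto_id
    simpa using (Real.tendsto_exp_atBot.comp h1).const_mul (o.E s₂ * Real.exp (9 / 2))
  obtain ⟨s₃, hs₃⟩ := eventually_atTop.1 (hlim.eventually (gt_mem_nhds (show (0 : ℝ) < 1 / 20 by norm_num)))
  set b := max s₂ s₃ with hb
  have hEle : ∀ s ≥ b, o.E s ≤ 1 / 20 := by
    intro s hs
    have hs2 : s₂ ≤ s := (le_max_left _ _).trans hs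
    have h1 := hdec s hs2
    have h2 := hs₃ s ((le_max_right _ _).trans hs)
    have hs' := h₂.trans_le hs2
    have hE2 := o.E_pos h₂
    have hN1 := o.N_lt_one hs'
    have h3 : Real.exp (-(9 / 2) * o.N s₂) ≤ 1 := by
      rw [Real.exp_le_one_iff]; have := o.N_pos h₂; linarith
    have h4 : Real.exp (-(9 / 2)) ≤ Real.exp (-(9 / 2) * o.N s) := by
      rw [Real.exp_le_exp]; linarith
    have h5 : o.E s * Real.exp (-(9 / 2)) ≤ o.E s₂ * Real.exp (-k * (s - s₂)) :=
      calc _ ≤ o.E s * Real.exp (-(9 / 2) * o.N s) :=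
            mul_le_mul_of_nonneg_left h4 (o.E_pos hs').le
        _ ≤ _ := h1
        _ ≤ o.E s₂ * 1 * Real.exp (-k * (s - s₂)) := by gcongr
        _ = _ := by ring
    have h6 : o.E s = o.E s * Real.exp (-(9 / 2)) * Real.exp (9 / 2) := by
      rw [mul_assoc, ← Real.exp_add]; simp
    rw [h6]
    refine le_trans (mul_le_mul_of_nonneg_right h5 (Real.exp_pos _).le) ?_
    linarith
  have hb0 : s₀ < b := h₂.trans_le (le_max_left _ _)
  have h1 := add_mul_le_of_hasDerivAt (c := 1 / 20) (show b ≤ b + 20 by linarith)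
    (fun t ht => o.hasDerivAt_N (hb0.trans_le ht.1)) (fun t ht => by
      have h1 := hEle t ht.1.le
      have h2 := hNle t (by linarith [le_max_left s₂ s₃, ht.1])
      unfold J; linarith)
  have h2 := o.N_lt_one (show s₀ < b + 20 by linarith)
  have h3 := o.N_pos hb0
  linarith

theorem J_neg (hs : s₀ < s) (hD : 0 ≤ o.D s) (hψ : o.ψ s ≤ 0) : o.J s < 0 := by
  by_contra! hc
  exact o.not_expanding hs hD hψ hc

/-! ### Phases in which the orbit expands above `N = 1/3` are short -/

theorem A_ge_exp (hs : s₀ < s) {r : ℝ} (hsr : s ≤ r) :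
    o.A s * Real.exp (-(r - s)) ≤ o.A r := by
  have := mul_exp_le_of_hasDerivAt (k := -1) hsr
    (fun t ht => o.hasDerivAt_A (hs.trans_le ht.1)) (fun t ht => by
      have ht' := hs.trans ht.1
      have h1 := o.neg_one_lt_a ht' (o.N_lt_one ht')
      have h2 := o.A_pos t ht'
      nlinarith)
  rwa [neg_one_mul] at this

theorem B_sq_le_three (hN : 1 / 3 ≤ o.N s) : o.B s ^ 2 ≤ 3 := by
  rw [o.B_sq_eq, div_le_iff₀ (by linarith)]; linarith

theorem c₁_le (hs : s₀ < s) (hAB : 2 * o.B s ^ 2 ≤ o.A s ^ 2) : o.c₁ s ≤ 4 * h / o.A s := by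
  have hA := o.A_pos s hs
  have hB := o.B_pos s hs
  have hS := o.S_pos s hs
  have hSh := o.S_lt hs
  have hBA := o.B_lt_A s hs
  have hh := o.h_pos
  rw [o.c₁_eq s hs, div_le_div_iff₀ (o.R_pos hs) hA]
  have h1 : o.B s * o.S s ≤ o.A s * h := by gcongr
  nlinarith

/-- In the region `D ≥ 10¹⁰`, `A² ≥ 10¹⁰`, `N ≥ 1/3` both streams are diluted at almost the
rate `2`. -/
theorem b₁_le (hs : s₀ < s) (hN : 1 / 3 ≤ o.N s) (hD : 10 ^ 10 ≤ o.D s)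
    (hA2 : 10 ^ 10 ≤ o.A s ^ 2) : o.b₁ s ≤ 1 / 1000 := by
  have hA := o.A_pos s hs
  have hB := o.B_pos s hs
  have hS := o.S_pos s hs
  have hh := o.h_pos
  have hB2 := o.B_sq_le_three hN
  have hB' : o.B s ≤ 2 := by nlinarith
  have hc := o.c₁_le hs (by linarith)
  have hD' : o.D s = h ^ 2 - o.A s ^ 2 := rfl
  have hSS := o.S_sq_eq hs
  have h1 : (8000 * h) ^ 2 ≤ (o.A s * o.S s) ^ 2 := by
    rw [mul_pow, mul_pow, hSS]
    nlinarith [mul_nonneg (sub_nonneg.2 hD) (sub_nonneg.2 hA2), sq_nonneg (o.A s), sq_nonneg (o.B s)]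
  have h2 : 8000 * h ≤ o.A s * o.S s := (sq_le_sq₀ (by positivity) (by positivity)).1 h1
  have hc0 := o.c₁_pos hs
  have h3 : o.b₁ s ≤ 2 * (4 * h / o.A s) / o.S s := by unfold b₁; gcongr
  refine h3.trans ?_
  rw [mul_div_assoc', div_div, div_le_iff₀ (by positivity)]
  linarith

/-- Far below `A = h` the density decays at a rate proportional to `1 - N`, up to a term that is
controlled by `N' = J`. -/
theorem E'_le_of_phase (hs : s₀ < s) (hN : 1 / 3 ≤ o.N s) (hD : 10 ^ 10 ≤ o.D s)
    (hA2 : 10 ^ 10 ≤ o.A s ^ 2) (hJ : o.J s ≤ 0) (hE : o.E s ≤ 6 / 5) :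
    o.E' s ≤ -(1 / 10) * (1 - o.N s) * o.E s - 3 / 1000 * o.J s * o.E s := by
  have hb := o.b₁_le hs hN hD hA2
  have hb1 := o.b₁_pos hs
  have hb2 := o.b₂_pos hs
  have hbb := o.b₂_le_b₁ hs
  have hN1 := o.N_lt_one hs
  have hP := o.P_pos hs
  have hP1 := o.P₁_pos hs
  have hP2 := o.P₂_nonneg hs
  have hE1 := o.E₁_pos hs
  have hE2 := o.E₂_pos hs
  have hPE1 := o.P₁_le hs
  have hEE := o.E_eq_add (s := s)
  have hEp := o.E_pos hs
  have hS := o.S_pos s hs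
  have hXg := o.X_ge_mul hs
  have hX : 2 * (999 / 1000) * o.E s ≤ o.X s := by nlinarith
  have h1a : (1 - o.N s) / 2 ≤ 1 + o.a s := by
    rw [o.one_add_a hs, div_le_div_iff₀ (by norm_num) (by linarith)]
    nlinarith
  have hl0 : 0 ≤ o.l s := by
    rw [o.l_eq hs]; exact div_nonneg (by linarith) (by linarith)
  have hl : o.l s ≤ 3 / 2 * -o.J s := by
    rw [o.l_eq hs, div_le_iff₀ (by linarith)]; nlinarith
  have hlt : o.l s * (2 * o.b₁ s * o.P₁ s - 2 * o.b₂ s * o.P₂ s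
      - o.E s * o.B s ^ 2 / o.S s ^ 2) ≤ - (3 / 1000 * o.J s * o.E s) := by
    have h1 : 2 * o.b₁ s * o.P₁ s - 2 * o.b₂ s * o.P₂ s - o.E s * o.B s ^ 2 / o.S s ^ 2
        ≤ 2 / 1000 * o.E s := by
      have : 0 ≤ o.E s * o.B s ^ 2 / o.S s ^ 2 := by positivity
      have : 0 ≤ 2 * o.b₂ s * o.P₂ s := by positivity
      nlinarith
    calc _ ≤ o.l s * (2 / 1000 * o.E s) := mul_le_mul_of_nonneg_left h1 hl0
      _ ≤ (3 / 2 * -o.J s) * (2 / 1000 * o.E s) := by gcongr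
      _ = _ := by ring
  have hg := mul_pos (sub_pos.2 hN1) hEp
  have hg' : (1 - o.N s) * o.E s ≤ o.E s := by nlinarith
  rw [E']
  rcases le_or_gt (o.a s) 0 with ha | ha
  · have h2 : o.a s * o.E s * o.A s ^ 2 / o.S s ^ 2 ≤ 0 := by
      apply div_nonpos_of_nonpos_of_nonneg _ (by positivity)
      apply mul_nonpos_of_nonpos_of_nonneg _ (by positivity)
      exact mul_nonpos_of_nonpos_of_nonneg ha hEp.le
    have h3 : (1 - o.N s) / 2 * (2 * (999 / 1000) * o.E s) ≤ (1 + o.a s) * o.X s :=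
      mul_le_mul h1a hX (by positivity) (by linarith)
    linarith
  · have hμ1 : 0 < o.q₁ s / o.S s := div_pos (o.q₁_pos s hs) hS
    have hμ2 : 0 < o.q₂ s / o.S s := div_pos (o.q₂_pos s hs) hS
    have hY : o.A s ^ 2 * o.P s / o.S s ^ 2 ≤ 1001 / 2000 * o.X s := by
      rw [o.A_sq_mul_P hs, X, o.E₁_eq hs, o.E₂_eq hs]
      have k1 : (1 + o.b₁ s) ^ 2 * (o.q₁ s / o.S s)
          ≤ 1001 / 1000 * (1 + o.b₁ s) * (o.P₁ s + o.q₁ s / o.S s) := by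
        have h3 : 0 ≤ (1 + o.b₁ s) * (o.q₁ s / o.S s) := by positivity
        have h4 : 0 ≤ (1 + o.b₁ s) * o.P₁ s := by positivity
        have h5 := mul_le_mul_of_nonneg_right hb h3
        linarith
      have k2 : (1 - o.b₂ s) ^ 2 * (o.q₂ s / o.S s)
          ≤ 1001 / 1000 * (1 - o.b₂ s) * (o.P₂ s + o.q₂ s / o.S s) := by
        have h0 : 0 ≤ 1 - o.b₂ s := by linarith
        have h3 : 0 ≤ (1 - o.b₂ s) * (o.q₂ s / o.S s) := by positivity
        have h4 : 0 ≤ (1 - o.b₂ s) * o.P₂ s := by positivity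
        have h5 := mul_nonneg hb2.le h3
        linarith
      linarith
    have ha' : o.a s ≤ 3 / 2 * o.P s := by
      rw [o.a_eq hs, div_le_iff₀ (by linarith), ψ]; nlinarith
    have h2 : o.a s * o.E s * o.A s ^ 2 / o.S s ^ 2
        ≤ 9 / 5 * (o.A s ^ 2 * o.P s / o.S s ^ 2) := by
      have h4 : o.a s * o.E s ≤ 9 / 5 * o.P s := by
        have := mul_le_mul ha' hE hEp.le (by positivity)
        linarith
      have h5 : 0 ≤ o.A s ^ 2 / o.S s ^ 2 := by positivity
      calc _ = o.a s * o.E s * (o.A s ^ 2 / o.S s ^ 2) := by ring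
        _ ≤ 9 / 5 * o.P s * (o.A s ^ 2 / o.S s ^ 2) := mul_le_mul_of_nonneg_right h4 h5
        _ = _ := by ring
    have hX0 : 0 ≤ o.X s := le_trans (by positivity) hX
    have h6 : o.X s ≤ (1 + o.a s) * o.X s := by nlinarith
    linarith

/-- Once `1 - N` is comparable with `μ`, the density does not increase while `A` and `N`
decrease. -/
theorem E'_nonpos (hs : s₀ < s) (hD : 0 ≤ o.D s) (hψ : o.ψ s ≤ 0)
    (hJ : o.J s ≤ 0) (hμ : o.μ s ≤ 2 * (1 - o.N s)) : o.E' s ≤ 0 := by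
  have hN := o.N_pos hs
  have hb1 := o.b₁_pos hs
  have hb2 := o.b₂_pos hs
  have hb2' := o.b₂_le_one hs hD
  have hP2 := o.P₂_nonneg hs
  have hE1 := o.E₁_pos hs
  have hE2 := o.E₂_pos hs
  have hPE1 := o.P₁_le hs
  have hEp := o.E_pos hs
  have hS := o.S_pos s hs
  have ha : o.a s ≤ 0 := by
    rw [o.a_eq hs]; exact div_nonpos_of_nonpos_of_nonneg hψ (by linarith)
  have h1 := o.neg_one_lt_a hs (o.N_lt_one hs)
  have hl0 : 0 ≤ o.l s := by
    rw [o.l_eq hs]; exact div_nonneg (by linarith) (by linarith)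
  have hal : o.l s ≤ 1 + o.a s := by
    rw [o.one_add_a hs, o.l_eq hs]
    apply div_le_div_of_nonneg_right _ (by linarith)
    have := o.E_eq hs
    unfold J; linarith
  have h2 : o.a s * o.E s * o.A s ^ 2 / o.S s ^ 2 ≤ 0 := by
    apply div_nonpos_of_nonpos_of_nonneg _ (by positivity)
    apply mul_nonpos_of_nonpos_of_nonneg _ (by positivity)
    exact mul_nonpos_of_nonpos_of_nonneg ha hEp.le
  have h3 : 2 * (o.b₁ s * o.E₁ s) ≤ o.X s := by
    rw [X]; nlinarith [mul_nonneg hE2.le (sub_nonneg.2 hb2')]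
  have h4 : o.l s * (2 * o.b₁ s * o.P₁ s - 2 * o.b₂ s * o.P₂ s
      - o.E s * o.B s ^ 2 / o.S s ^ 2) ≤ (1 + o.a s) * (2 * (o.b₁ s * o.E₁ s)) := by
    have k1 : 2 * o.b₁ s * o.P₁ s - 2 * o.b₂ s * o.P₂ s - o.E s * o.B s ^ 2 / o.S s ^ 2
        ≤ 2 * (o.b₁ s * o.E₁ s) := by
      have : 0 ≤ o.E s * o.B s ^ 2 / o.S s ^ 2 := by positivity
      have : 0 ≤ 2 * o.b₂ s * o.P₂ s := by positivity
      nlinarith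
    calc _ ≤ o.l s * (2 * (o.b₁ s * o.E₁ s)) := mul_le_mul_of_nonneg_left k1 hl0
      _ ≤ _ := mul_le_mul_of_nonneg_right hal (by positivity)
  have h5 : (1 + o.a s) * (2 * (o.b₁ s * o.E₁ s)) ≤ (1 + o.a s) * o.X s :=
    mul_le_mul_of_nonneg_left h3 (by linarith)
  rw [E']; linarith

/-- An orbit with little matter at a time when `A` decreases stays so, and then runs into the
light cone. -/
theorem not_dilute {t : ℝ} (ht : s₀ < t) (hD : 10 ^ 10 ≤ o.D t)
    (hE : ∀ s ∈ Icc t (t + 1), o.E s ≤ 11 / 1000) (hN : 49 / 50 ≤ o.N t) : False := by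
  have hψ : ∀ s > s₀, o.E s ≤ 1 / 50 → 49 / 50 ≤ o.N s → o.ψ s < 0 := by
    intro s hs h1 h2
    have := o.E_eq hs
    have := o.μ_pos hs
    unfold ψ; linarith
  have key : ∀ s ≥ t, (∀ r ∈ Icc t s, o.E r ≤ 1 / 50 ∧ 10 ^ 10 ≤ o.D r ∧ 49 / 50 ≤ o.N r) →
      o.E s ≤ 11 / 1000 := by
    intro s hs hp
    rcases le_or_gt s (t + 1) with h | hts
    · exact hE s ⟨hs, h⟩
    have hJ : ∀ r ∈ Icc t s, o.J r < 0 := fun r hr => by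
      obtain ⟨h1, h2, h3⟩ := hp r hr
      have hr' := ht.trans_le hr.1
      exact o.J_neg hr' (by linarith) (hψ r hr' h1 h3).le
    refine le_trans ?_ (hE (t + 1) ⟨by linarith, le_rfl⟩)
    refine le_of_hasDerivAt_nonpos hts.le
      (fun r hr => o.hasDerivAt_E (by linarith [hr.1] : s₀ < r)) fun r hr => ?_
    have hrt : t < r := by linarith [hr.1]
    have hr' : s₀ < r := ht.trans hrt
    have hrI : r ∈ Icc t s := ⟨hrt.le, hr.2.le⟩
    obtain ⟨h1, h2, h3⟩ := hp r hrI
    -- `μ` decreases, so that `1 - N` has had the time to become comparable with it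
    have hμ : ∀ x ∈ Icc t r, o.μ r ≤ o.μ x := by
      intro x hx
      refine le_of_hasDerivAt_nonpos hx.2
        (fun y hy => o.hasDerivAt_μ ((ht.trans_le hx.1).trans_le hy.1)) fun y hy => ?_
      have hyt : t ≤ y := hx.1.trans hy.1.le
      have hy' := ht.trans_le hyt
      have hyI : y ∈ Icc t s := ⟨hyt, hy.2.le.trans hrI.2⟩
      obtain ⟨h4, h5, h6⟩ := hp y hyI
      have hNy := o.N_pos hy'
      have ha : o.a y ≤ 0 := by
        rw [o.a_eq hy']
        exact div_nonpos_of_nonpos_of_nonneg (hψ y hy' h4 h6).le (by linarith)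
      have hl : 0 ≤ o.l y := by
        rw [o.l_eq hy']; exact div_nonneg (by linarith [hJ y hyI]) (by linarith)
      have hb2 := o.b₂_le_one hy' (by linarith)
      have hb1 := o.b₁_pos hy'
      have hS := o.S_pos y hy'
      have hq1 := div_pos (o.q₁_pos y hy') hS
      have hq2 := div_pos (o.q₂_pos y hy') hS
      have hμy := o.μ_pos hy'
      have k1 : 0 ≤ o.μ y * (o.B y ^ 2 * o.l y - o.A y ^ 2 * o.a y) / o.S y ^ 2 := by
        have : 0 ≤ o.B y ^ 2 * o.l y := by positivity
        have : o.A y ^ 2 * o.a y ≤ 0 := mul_nonpos_of_nonneg_of_nonpos (by positivity) ha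
        have : 0 ≤ o.B y ^ 2 * o.l y - o.A y ^ 2 * o.a y := by linarith
        positivity
      have k2 : 0 ≤ (1 + o.b₁ y) * (o.q₁ y / o.S y) := by positivity
      have k3 : 0 ≤ (1 - o.b₂ y) * (o.q₂ y / o.S y) := mul_nonneg (by linarith) hq2.le
      linarith
    refine o.E'_nonpos hr' (by linarith) (hψ r hr' h1 h3).le (hJ r hrI).le ?_
    have h4 := mul_exp_le_of_hasDerivAt (k := -1) hrt.le (f := fun x => 1 - o.N x - o.μ r)
      (fun x hx => ((o.hasDerivAt_N (ht.trans_le hx.1)).const_sub 1).sub_const _) (fun x hx => by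
        have hx' := ht.trans hx.1
        have h5 := hμ x ⟨hx.1.le, hx.2.le⟩
        have h6 := o.E_eq hx'
        have h7 := o.P_pos hx'
        unfold J; linarith)
    have h5 : Real.exp (-1 * (r - t)) ≤ 1 / 2 := by
      have h6 : Real.exp (-1 * (r - t)) ≤ Real.exp (-1) := by
        rw [Real.exp_le_exp]; linarith [hr.1]
      have := Real.exp_neg_one_lt_half
      linarith
    have h6 := o.N_lt_one ht
    have h7 := o.μ_pos hr'
    have h8 := Real.exp_pos (-1 * (r - t))
    nlinarith
  have hall : ∀ s ≥ t, o.E s ≤ 1 / 50 ∧ 10 ^ 10 ≤ o.D s ∧ 49 / 50 ≤ o.N s := by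
    apply forall_ge_of_step
    · exact ⟨by linarith [hE t ⟨le_rfl, by linarith⟩], hD, hN⟩
    · intro s hs hp
      have hs' := ht.trans_le hs
      obtain ⟨h1, h2, h3⟩ := hp s ⟨hs, le_rfl⟩
      have h4 := key s hs hp
      have h5 := hψ s hs' h1 h3
      have h6 := o.J_neg hs' (by linarith) h5.le
      have h7 : 49 / 50 < o.N s := by unfold J at h6; linarith
      have hNs := o.N_pos hs'
      have hA := o.A_pos s hs'
      have ha : o.a s < 0 := by
        rw [o.a_eq hs']; exact div_neg_of_neg_of_pos h5 (by linarith)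
      have h8 := eventually_pos_nhdsGT (f := fun s => o.D s - 10 ^ 10)
        ((o.hasDerivAt_D hs').sub_const _) (by linarith) (fun _ => by nlinarith [sq_pos_of_pos hA])
      have h9 := ((o.hasDerivAt_E hs').continuousAt.eventually
        (gt_mem_nhds (show o.E s < 1 / 50 by linarith))).filter_mono
        (nhdsWithin_le_nhds (s := Ioi s))
      have h10 := ((o.hasDerivAt_N hs').continuousAt.eventually
        (lt_mem_nhds h7)).filter_mono (nhdsWithin_le_nhds (s := Ioi s))
      filter_upwards [h8, h9, h10] with r k1 k2 k3
      exact ⟨k2.le, by linarith, k3.le⟩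
    · intro s hs hp
      have hs' := ht.trans hs
      exact ⟨le_of_forall_Ico hs (o.hasDerivAt_E hs').continuousAt fun r hr => (hp r hr).1,
        ge_of_forall_Ico hs (o.hasDerivAt_D hs').continuousAt fun r hr => (hp r hr).2.1,
        ge_of_forall_Ico hs (o.hasDerivAt_N hs').continuousAt fun r hr => (hp r hr).2.2⟩
  exact o.not_forall_N_ge ht fun s hs => by linarith [(hall s hs).2.2]

/-- A bound for the duration of the phases with `N > 1/3` and `N' < 0` far from the
equilibrium. -/
def phaseTime : ℝ := 20010

/-- During a phase with `N ≥ 1/3` and `N' ≤ 0` far below `A = h` the density decays, up to the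
bounded factor `e^{3N/1000}`. If the phase lasted for too long, the density would become so
small that `not_dilute` applies. -/
theorem phase_short {t : ℝ} (ht : s₀ < t)
    (hh : 2 * 10 ^ 5 * Real.exp (phaseTime) ≤ h) (hA : h / 2 ≤ o.A t)
    (hph : ∀ s ∈ Icc t (t + phaseTime), 10 ^ 10 ≤ o.D s ∧ 1 / 3 ≤ o.N s ∧ o.J s ≤ 0) : False := by
  have hA2 : ∀ s ∈ Icc t (t + phaseTime), 10 ^ 10 ≤ o.A s ^ 2 := by
    intro s hs
    have h1 := o.A_ge_exp ht hs.1
    have h2 : Real.exp (-phaseTime) ≤ Real.exp (-(s - t)) := by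
      rw [Real.exp_le_exp]; linarith [hs.2]
    have h3 : 10 ^ 5 ≤ h / 2 * Real.exp (-phaseTime) := by
      rw [Real.exp_neg, ← div_eq_mul_inv, le_div_iff₀ (Real.exp_pos _)]; linarith
    have h4 : (10 : ℝ) ^ 5 ≤ o.A s :=
      h3.trans ((mul_le_mul hA h2 (Real.exp_pos _).le (o.A_pos t ht).le).trans h1)
    nlinarith
  have hT : phaseTime = 20010 := rfl
  set F : ℝ → ℝ := fun s => o.E s * Real.exp (3 / 1000 * o.N s) with hF
  set F' : ℝ → ℝ := fun s => (o.E' s + 3 / 1000 * o.J s * o.E s) * Real.exp (3 / 1000 * o.N s)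
    with hF'
  have hFd : ∀ s > s₀, HasDerivAt F (F' s) s := by
    intro s hs
    refine ((o.hasDerivAt_E hs).mul (((o.hasDerivAt_N hs).const_mul (3 / 1000)).exp)).congr_deriv ?_
    rw [hF']; unfold E'; ring
  have hEF : ∀ s > s₀, o.E s ≤ F s ∧ 99 / 100 * F s ≤ o.E s := by
    intro s hs
    have hE := o.E_pos hs
    have hN := o.N_pos hs
    have hN1 := o.N_lt_one hs
    have h1 : 1 ≤ Real.exp (3 / 1000 * o.N s) := Real.one_le_exp (by linarith)
    have h2 : 99 / 100 * Real.exp (3 / 1000 * o.N s) ≤ 1 := by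
      have := Real.add_one_le_exp (-(3 / 1000 * o.N s))
      have h3 : Real.exp (3 / 1000 * o.N s) * Real.exp (-(3 / 1000 * o.N s)) = 1 := by
        rw [← Real.exp_add]; simp
      nlinarith [Real.exp_pos (3 / 1000 * o.N s)]
    simp only [hF]
    constructor <;> nlinarith
  have hFle : ∀ s ∈ Icc t (t + phaseTime), F s ≤ 6 / 5 → F' s ≤ -(1 / 10) * (1 - o.N s) * F s := by
    intro s hs hFs
    have hs' := ht.trans_le hs.1
    obtain ⟨h1, h2, h3⟩ := hph s hs
    have h4 := o.E'_le_of_phase hs' h2 h1 (hA2 s hs) h3 ((hEF s hs').1.trans hFs)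
    calc F' s ≤ (-(1 / 10) * (1 - o.N s) * o.E s) * Real.exp (3 / 1000 * o.N s) := by
          apply mul_le_mul_of_nonneg_right _ (Real.exp_pos _).le
          linarith
      _ = _ := by rw [hF]; ring
  have hFle0 : ∀ s ∈ Icc t (t + phaseTime), F s ≤ 6 / 5 → F' s ≤ 0 := by
    intro s hs hFs
    have hs' := ht.trans_le hs.1
    have h1 := hFle s hs hFs
    have h2 := o.N_lt_one hs'
    have h3 := (o.E_pos hs').trans_le (hEF s hs').1
    nlinarith
  -- `F` becomes smaller than `1.19` within two units of time
  obtain ⟨t₁, ht₁, hFt₁⟩ : ∃ t₁ ∈ Icc t (t + 2), F t₁ ≤ 119 / 100 := by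
    by_contra! hc
    have h1 := le_add_mul_of_hasDerivAt (c := -2 / 5) (show t ≤ t + 2 by linarith)
      (fun s hs => o.hasDerivAt_N (ht.trans_le hs.1)) (fun s hs => by
        have h2 := hc s ⟨hs.1.le, hs.2.le⟩
        have h3 := (hEF s (ht.trans hs.1)).2
        have h4 := (hph s ⟨hs.1.le, by linarith [hs.2]⟩).2.1
        unfold J; linarith)
    have h2 := o.N_lt_one ht
    have h3 := (hph (t + 2) ⟨by linarith, by linarith⟩).2.1
    linarith
  have ht₁' : s₀ < t₁ := ht.trans_le ht₁.1
  have hFlt : ∀ s ∈ Icc t₁ (t + phaseTime), F s ≤ 6 / 5 := by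
    intro s hs
    by_contra! hc
    obtain ⟨r, hr, h1, h2⟩ := exists_first_eq (c := 6 / 5) hs.1
      (fun x hx => (hFd x (ht₁'.trans_le hx.1)).continuousAt.continuousWithinAt)
      (by linarith) hc.le
    have h3 := le_of_hasDerivAt_nonpos hr.1.le (fun x hx => hFd x (ht₁'.trans_le hx.1))
      (fun x hx => hFle0 x ⟨by linarith [ht₁.1, hx.1], by linarith [hx.2, hr.2, hs.2]⟩
        (h2 x ⟨hx.1.le, hx.2⟩).le)
    linarith
  have hmono : ∀ r s, t₁ ≤ r → r ≤ s → s ≤ t + phaseTime → F s ≤ F r := by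
    intro r s hr hrs hs
    refine le_of_hasDerivAt_nonpos hrs (fun x hx => hFd x (by linarith [hx.1])) fun x hx => ?_
    have hx1 : x ≤ t + phaseTime := by linarith [hx.2]
    exact hFle0 x ⟨by linarith [ht₁.1, hx.1], hx1⟩ (hFlt x ⟨by linarith [hx.1], hx1⟩)
  -- and then decays
  have hsmall : F (t₁ + 20001) ≤ 11 / 1000 := by
    by_contra! hc
    have hlow : ∀ s ∈ Icc t₁ (t₁ + 20001), 1 / 100 ≤ o.E s := by
      intro s hs
      have h1 := hmono s (t₁ + 20001) hs.1 hs.2 (by linarith [ht₁.2])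
      have h2 := (hEF s (by linarith [hs.1])).2
      linarith
    have h1 := mul_exp_le_of_hasDerivAt (k := -1) (show t₁ ≤ t₁ + 1 by linarith)
      (f := fun x => 1 - o.N x - 1 / 100)
      (fun x hx => ((o.hasDerivAt_N (ht₁'.trans_le hx.1)).const_sub 1).sub_const _) (fun x hx => by
        have := hlow x ⟨hx.1.le, by linarith [hx.2]⟩
        unfold J; linarith)
    have h2 : Real.exp (-1 * (t₁ + 1 - t₁)) < 1 / 2 := by
      have := Real.exp_neg_one_lt_half
      rwa [show (-1 : ℝ) * (t₁ + 1 - t₁) = -1 by ring]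
    have h3 : 5 / 1000 ≤ 1 - o.N (t₁ + 1) := by
      have := o.N_lt_one ht₁'
      nlinarith [Real.exp_pos (-1 * (t₁ + 1 - t₁))]
    have h4 : ∀ s ∈ Icc (t₁ + 1) (t₁ + 20001), 5 / 1000 ≤ 1 - o.N s := by
      intro s hs
      have := le_of_hasDerivAt_nonpos hs.1
        (fun x hx => o.hasDerivAt_N (by linarith [hx.1] : s₀ < x))
        (fun x hx => (hph x ⟨by linarith [ht₁.1, hx.1], by linarith [ht₁.2, hx.2, hs.2]⟩).2.2)
      linarith
    have h5 := le_mul_exp_of_hasDerivAt (k := 5 / 10000) (show t₁ + 1 ≤ t₁ + 20001 by linarith)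
      (fun x hx => hFd x (by linarith [hx.1])) (fun x hx => by
        have h6 := hFle x ⟨by linarith [ht₁.1, hx.1], by linarith [ht₁.2, hx.2]⟩
          (hFlt x ⟨by linarith [hx.1], by linarith [ht₁.2, hx.2]⟩)
        have h7 := h4 x ⟨hx.1.le, hx.2.le⟩
        have hx' : s₀ < x := by linarith [hx.1]
        have h8 := (o.E_pos hx').trans_le (hEF x hx').1
        nlinarith)
    have h6 := hFlt (t₁ + 1) ⟨by linarith, by linarith [ht₁.2]⟩
    have h7 : Real.exp (-(5 / 10000) * (t₁ + 20001 - (t₁ + 1))) ≤ 1 / 1000 := by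
      rw [show -(5 / 10000) * (t₁ + 20001 - (t₁ + 1)) = (10 : ℕ) * (-1 : ℝ) by push_cast; ring,
        Real.exp_nat_mul]
      calc Real.exp (-1) ^ 10 ≤ (1 / 2) ^ 10 :=
            pow_le_pow_left₀ (Real.exp_pos _).le Real.exp_neg_one_lt_half.le 10
        _ ≤ _ := by norm_num
    have h8 := Real.exp_pos (-(5 / 10000) * (t₁ + 20001 - (t₁ + 1)))
    nlinarith
  set t₂ := t₁ + 20001 with ht₂
  have ht₂' : s₀ < t₂ := by linarith
  have hE2 : ∀ s ∈ Icc t₂ (t₂ + 1), o.E s ≤ 11 / 1000 := fun s hs =>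
    ((hEF s (ht₂'.trans_le hs.1)).1.trans
      (hmono t₂ s (by linarith) hs.1 (by linarith [hs.2, ht₁.2]))).trans hsmall
  obtain ⟨h1, h2, h3⟩ := hph t₂ ⟨by linarith [ht₁.1], by linarith [ht₁.2]⟩
  refine o.not_dilute ht₂' h1 hE2 ?_
  have := hE2 t₂ ⟨le_rfl, by linarith⟩
  unfold J at h3; linarith

/-! ### Uniform bounds and the entry into a bounded region -/

/-- In the region `A ≤ h`, once `N` has ceased to decrease or has come below `1/3`, the function
`A` does not decrease. -/
theorem ψ_nonneg_of_le {y x : ℝ} (hy : s₀ < y) (hyx : y ≤ x) (hD : ∀ r ∈ Icc y x, 0 ≤ o.D r)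
    (h0 : 0 ≤ o.J y ∨ o.N y ≤ 1 / 3) : 0 ≤ o.ψ x := by
  by_contra! hψ
  have hx : s₀ < x := hy.trans_le hyx
  have hPx := o.P_pos hx
  have hNx : 1 / 3 < o.N x := by unfold ψ at hψ; linarith
  have hJx := o.J_neg hx (hD x ⟨hyx, le_rfl⟩) hψ.le
  obtain ⟨r, hr, hr0, hr1⟩ := exists_last_eq (f := fun r => min (-o.J r) (o.N r - 1 / 3)) (c := 0)
    hyx (fun r hr => by
      have hr' := hy.trans_le hr.1
      have hc : ContinuousAt (fun r => min (-o.J r) (o.N r - 1 / 3)) r :=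
        (o.hasDerivAt_J hr').continuousAt.neg.min
          ((o.hasDerivAt_N hr').continuousAt.sub continuousAt_const)
      exact hc.continuousWithinAt)
    (by rcases h0 with h0 | h0
        · exact (min_le_left _ _).trans (by linarith)
        · exact (min_le_right _ _).trans (by linarith))
    (lt_min (by linarith) (by linarith))
  have hrs : s₀ < r := hy.trans_le hr.1
  have h1 := le_of_hasDerivAt_nonpos hr.2.le (fun t ht => o.hasDerivAt_N (hrs.trans_le ht.1))
    (fun t ht => by
      have := (lt_min_iff.1 (hr1 t ⟨ht.1, ht.2.le⟩)).1; linarith)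
  have hJr : o.J r = 0 := by
    rcases min_choice (-o.J r) (o.N r - 1 / 3) with hm | hm
    · have := hm.symm.trans hr0; linarith
    · have := hm.symm.trans hr0; linarith
  have hE := o.E'_neg hrs (hD r ⟨hr.1, hr.2.le⟩) (by linarith) hJr
  have h2 := eventually_pos_nhdsGT (o.hasDerivAt_J hrs) hJr.ge (fun _ => by linarith)
  obtain ⟨t, ht, ht'⟩ := (h2.and (Ioo_mem_nhdsGT hr.2)).exists
  have := (lt_min_iff.1 (hr1 t ⟨ht'.1, ht'.2.le⟩)).1
  linarith

theorem exists_D_neg (hs : s₀ < s) : ∃ t ∈ Ioo s₀ s, o.D t < 0 := by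
  have h1 := o.A_lim.eventually (gt_mem_nhds (show (-1 : ℝ) < 0 by norm_num))
  obtain ⟨t, ht, ht'⟩ := (h1.and (Ioo_mem_nhdsGT hs)).exists
  exact ⟨t, ht', ht⟩

theorem exists_excursion_start (hs : s₀ < s) (hD : 10 ^ 10 < o.D s) :
    ∃ t ∈ Ioo s₀ s, o.D t = 10 ^ 10 ∧ ∀ x ∈ Icc t s, 10 ^ 10 ≤ o.D x := by
  obtain ⟨t, ht, htD⟩ := o.exists_D_neg hs
  obtain ⟨r, hr, h1, h2⟩ := exists_last_eq (f := o.D) (c := 10 ^ 10) ht.2.le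
    (fun r hr => (o.hasDerivAt_D (ht.1.trans_le hr.1)).continuousAt.continuousWithinAt)
    (by linarith) hD
  refine ⟨r, ⟨ht.1.trans_le hr.1, hr.2⟩, h1, fun x hx => ?_⟩
  rcases hx.1.eq_or_lt with h | h
  · rw [← h, h1]
  · exact (h2 x ⟨h, hx.2⟩).le

theorem half_le_A (hs : s₀ < s) (hh : 2 * 10 ^ 5 * Real.exp phaseTime ≤ h)
    (hD : o.D s ≤ 10 ^ 10) : h / 2 ≤ o.A s := by
  have hA := o.A_pos s hs
  have h1 : (1 : ℝ) ≤ Real.exp phaseTime := Real.one_le_exp (by unfold phaseTime; norm_num)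
  have h2 : 2 * 10 ^ 5 ≤ h := by linarith
  unfold D at hD
  nlinarith

/-- The constant in the lower bound `c₀ h ≤ A`. -/
def c₀ : ℝ := Real.exp (-phaseTime) / 2

theorem c₀_pos : 0 < c₀ := by unfold c₀; positivity

theorem c₀_lt_half : c₀ ≤ 1 / 2 := by
  unfold c₀
  have : Real.exp (-phaseTime) ≤ 1 := Real.exp_le_one_iff.2 (by unfold phaseTime; norm_num)
  linarith

theorem exists_phase_end {t : ℝ} (ht : s₀ < t) (hh : 2 * 10 ^ 5 * Real.exp phaseTime ≤ h)
    (hA : h / 2 ≤ o.A t) (hD : ∀ x ∈ Icc t (t + phaseTime), 10 ^ 10 ≤ o.D x) :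
    ∃ y ∈ Icc t (t + phaseTime), 0 ≤ o.J y ∨ o.N y ≤ 1 / 3 := by
  by_contra! hc
  exact o.phase_short ht hh hA fun s hs => ⟨hD s hs, (hc s hs).2.le, (hc s hs).1.le⟩

/-- During the initial phase of an excursion to large `D`, whose duration is bounded, `A` loses at
most a fixed factor; afterwards it increases. -/
theorem A_ge (hh : 2 * 10 ^ 5 * Real.exp phaseTime ≤ h) (hs : s₀ < s) : c₀ * h ≤ o.A s := by
  have hpos := o.h_pos
  rcases le_or_gt (o.D s) (10 ^ 10) with hD | hD
  · have := o.half_le_A hs hh hD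
    nlinarith [c₀_lt_half]
  obtain ⟨t, ht, htD, hex⟩ := o.exists_excursion_start hs hD
  have hAt := o.half_le_A ht.1 hh htD.le
  have hbd : ∀ x ∈ Icc t (t + phaseTime), c₀ * h ≤ o.A x := by
    intro x hx
    have h1 := o.A_ge_exp ht.1 hx.1
    have h2 : Real.exp (-phaseTime) ≤ Real.exp (-(x - t)) := by
      rw [Real.exp_le_exp]; linarith [hx.2]
    refine le_trans ?_ h1
    calc c₀ * h = h / 2 * Real.exp (-phaseTime) := by unfold c₀; ring
      _ ≤ _ := mul_le_mul hAt h2 (Real.exp_pos _).le (o.A_pos t ht.1).le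
  rcases le_or_gt s (t + phaseTime) with hst | hst
  · exact hbd s ⟨ht.2.le, hst⟩
  obtain ⟨y, hy, hy0⟩ := o.exists_phase_end ht.1 hh hAt
    fun x hx => hex x ⟨hx.1, by linarith [hx.2]⟩
  have hys : y ≤ s := by linarith [hy.2]
  have hy' : s₀ < y := ht.1.trans_le hy.1
  have h1 := o.D_anti hy' hys fun x hx => o.ψ_nonneg_of_le hy' hx.1.le
    (fun r hr => by have := hex r ⟨hy.1.trans hr.1, by linarith [hr.2, hx.2]⟩; linarith) hy0
  have h2 := hbd y hy
  unfold D at h1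
  refine h2.trans ?_
  have := o.A_pos s hs
  nlinarith

/-- The constant in the lower bound `ν₀ ≤ N`. -/
def ν₀ : ℝ := c₀ ^ 2 / (2 * Real.exp 3)

theorem ν₀_pos : 0 < ν₀ := by have := c₀_pos; unfold ν₀; positivity

theorem N_le_add {x : ℝ} (hs : s₀ < s) (hx : s ≤ x) : o.N x ≤ o.N s + (x - s) := by
  have := le_add_mul_of_hasDerivAt (c := 1) hx
    (fun r hr => o.hasDerivAt_N (hs.trans_le hr.1)) (fun r hr => by
      have h1 := o.N_pos (hs.trans hr.1); have h2 := o.E_pos (hs.trans hr.1)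
      unfold J; linarith)
  linarith

/-- If `N` were very small at some time, then `A` would grow beyond its upper bound, because
`N' ≤ 1` prevents `N` from recovering fast. -/
theorem N_ge (hh : 2 * 10 ^ 5 * Real.exp phaseTime ≤ h) (hs : s₀ < s) : ν₀ ≤ o.N s := by
  have hpos := o.h_pos
  have hν := o.N_pos hs
  have hNle : ∀ x ≥ s, o.N x ≤ o.N s + (x - s) := fun x hx => o.N_le_add hs hx
  set g : ℝ → ℝ := fun x => o.A x ^ 2 * Real.exp (3 * (x - s)) / (o.N s + (x - s)) with hg
  have hd : ∀ x ≥ s, HasDerivAt g (((2 * o.a x + 3) * (o.A x ^ 2 * Real.exp (3 * (x - s)))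
      * (o.N s + (x - s)) - o.A x ^ 2 * Real.exp (3 * (x - s))) / (o.N s + (x - s)) ^ 2) x := by
    intro x hx
    have hx' := hs.trans_le hx
    have h1 : HasDerivAt (fun x => Real.exp (3 * (x - s))) (Real.exp (3 * (x - s)) * (3 * 1)) x :=
      (((hasDerivAt_id x).sub_const s).const_mul 3).exp
    have h2 : HasDerivAt (fun x => o.N s + (x - s)) 1 x :=
      ((hasDerivAt_id x).sub_const s).const_add _
    have h3 := (((o.hasDerivAt_A hx').pow 2).mul h1).div h2 (by linarith)
    refine h3.congr_deriv ?_
    simp only [Pi.pow_apply, Pi.mul_apply]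
    norm_num
    ring
  have hmono := le_of_hasDerivAt_nonneg (show s ≤ s + 1 by linarith) (fun x hx => hd x hx.1)
    (fun x hx => by
      have hx' := hs.trans hx.1
      have hP := o.P_pos hx'
      have hN := o.N_pos hx'
      apply div_nonneg _ (by positivity)
      have h1 : 1 ≤ (2 * o.a x + 3) * (o.N s + (x - s)) := by
        have h2 : 1 / o.N x ≤ 2 * o.a x + 3 := by
          unfold a; rw [o.B_sq_eq]
          have : 0 ≤ 1 / o.N x * o.P x := by positivity
          linarith
        have h3 := hNle x hx.1.le
        have h4 : 0 < 1 / o.N x := by positivity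
        calc 1 = 1 / o.N x * o.N x := by field_simp
          _ ≤ _ := mul_le_mul h2 h3 hN.le (by linarith)
      have h5 : 0 ≤ o.A x ^ 2 * Real.exp (3 * (x - s)) := by positivity
      nlinarith)
  simp only [hg, sub_self, mul_zero, Real.exp_zero, mul_one, add_zero, add_sub_cancel_left] at hmono
  have h1 := o.A_ge hh hs
  have h2 := o.A_sq_le (show s₀ < s + 1 by linarith)
  have h3 : (1 : ℝ) ≤ Real.exp phaseTime := Real.one_le_exp (by unfold phaseTime; norm_num)
  rw [div_le_div_iff₀ hν (by linarith)] at hmono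
  have hc := c₀_pos
  have h4 : (c₀ * h) ^ 2 ≤ o.A s ^ 2 := by gcongr
  have h5 : c₀ ^ 2 * h ^ 2 ≤ (2 * h ^ 2) * Real.exp 3 * o.N s := by
    have h6 : o.A (s + 1) ^ 2 ≤ 2 * h ^ 2 := by nlinarith
    calc c₀ ^ 2 * h ^ 2 ≤ o.A s ^ 2 * (o.N s + 1) := by nlinarith [sq_nonneg (o.A s)]
      _ ≤ _ := hmono
      _ ≤ _ := by gcongr
  have h7 : c₀ ^ 2 ≤ 2 * Real.exp 3 * o.N s := by
    have : 0 < h ^ 2 := by positivity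
    nlinarith
  unfold ν₀
  rw [div_le_iff₀ (by positivity)]
  linarith

theorem one_lt_B (hs : s₀ < s) : 1 < o.B s := by
  have h1 := o.B_sq_mul_N hs
  have h2 := o.N_lt_one hs
  have h3 := o.B_pos s hs
  have h4 := o.N_pos hs
  by_contra! hc
  have : o.B s ^ 2 ≤ 1 := by nlinarith
  nlinarith

theorem B_sq_le_of_N_ge {ν : ℝ} (hν : 0 < ν) (hN : ν ≤ o.N s) : o.B s ^ 2 ≤ 1 / ν := by
  rw [o.B_sq_eq]; gcongr

theorem E_le_of_A_ge (hs : s₀ < s) {c : ℝ} (hc : 0 < c) (hAB : 2 * o.B s ^ 2 ≤ o.A s ^ 2)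
    (hA : c * h ≤ o.A s) : o.E s ≤ 16 / c ^ 2 * o.μ s := by
  have h1 := o.c₁_le hs hAB
  have h2 := o.c₂_le_c₁ hs
  have hh := o.h_pos
  have hAp := o.A_pos s hs
  have hS := o.S_pos s hs
  have hq1 := o.q₁_pos s hs; have hq2 := o.q₂_pos s hs
  have hc1 := o.c₁_pos hs; have hc2 := o.c₂_pos hs
  have h3 : o.c₁ s ≤ 4 / c := by
    refine h1.trans ?_
    rw [div_le_div_iff₀ hAp hc]; linarith
  have h4 : o.c₁ s ^ 2 ≤ 16 / c ^ 2 := by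
    calc _ ≤ (4 / c) ^ 2 := by gcongr
      _ = _ := by rw [div_pow]; norm_num
  have h5 : o.c₂ s ^ 2 ≤ 16 / c ^ 2 := le_trans (by gcongr) h4
  unfold E μ
  rw [mul_div_assoc']
  gcongr
  nlinarith

/-- A linear combination of the unknowns that evolves slowly: the singular terms cancel in its
time derivative. -/
def φ (s : ℝ) : ℝ := o.q₂ s - o.q₁ s + 4 / o.B s

theorem hasDerivAt_φ (hs : s₀ < s) : HasDerivAt o.φ (-2 * o.φ s + 6 / o.B s + 2 * o.B s
    - 2 * o.B s * (o.E s - (o.q₁ s * o.c₁ s + o.q₂ s * o.c₂ s) / o.S s)) s := by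
  have hB := (o.B_pos s hs).ne'
  have hS := (o.S_pos s hs).ne'
  have h1 := ((o.hasDerivAt_q₂ hs).sub (o.hasDerivAt_q₁ hs)).add
    ((hasDerivAt_const s (4 : ℝ)).div (o.hasDerivAt_B hs) hB)
  refine h1.congr_deriv ?_
  simp only [φ, b₁, b₂, l]
  field_simp
  ring

theorem q₁_le_exp (hs : s₀ < s) {r : ℝ} (hsr : s ≤ r) :
    o.q₁ r ≤ o.q₁ s * Real.exp (-2 * (r - s)) :=
  le_mul_exp_of_hasDerivAt (k := 2) hsr (fun t ht => o.hasDerivAt_q₁ (hs.trans_le ht.1))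
    fun t ht => by
      have h1 := o.b₁_pos (hs.trans ht.1)
      have h2 := o.q₁_pos t (hs.trans ht.1)
      nlinarith

end Orbit

theorem tendsto_mul_exp_neg (c s : ℝ) {k : ℝ} (hk : 0 < k) :
    Tendsto (fun r => c * Real.exp (-k * (r - s))) atTop (𝓝 0) := by
  have h1 : Tendsto (fun r : ℝ => -k * (r - s)) atTop atBot := by
    apply Tendsto.const_mul_atTop_of_neg (by linarith)
    exact tendsto_atTop_add_const_right _ _ tendsto_id
  simpa using (Real.tendsto_exp_atBot.comp h1).const_mul c

namespace Orbit

variable {h s₀ : ℝ} (o : Orbit h s₀) {s : ℝ}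

theorem tendsto_q₁ : Tendsto o.q₁ atTop (𝓝 0) := by
  refine squeeze_zero' ?_ ?_ (tendsto_mul_exp_neg (o.q₁ (s₀ + 1)) (s₀ + 1) two_pos)
  · filter_upwards [eventually_gt_atTop s₀] with r hr using (o.q₁_pos r hr).le
  · filter_upwards [eventually_ge_atTop (s₀ + 1)] with r hr
      using o.q₁_le_exp (by linarith) hr

theorem eventually_φ_le (hh : 2 * 10 ^ 5 * Real.exp phaseTime ≤ h) :
    ∀ᶠ s in atTop, o.φ s ≤ 4 + 1 / ν₀ := by
  set c := 3 + 1 / ν₀ with hc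
  have key : ∀ r ≥ s₀ + 1, o.φ r - c ≤ (o.φ (s₀ + 1) - c) * Real.exp (-2 * (r - (s₀ + 1))) := by
    intro r hr
    refine le_mul_exp_of_hasDerivAt (f := fun r => o.φ r - c) (k := 2) hr
      (fun t ht => (o.hasDerivAt_φ (by linarith [ht.1] : s₀ < t)).sub_const c) fun t ht => ?_
    have ht' : s₀ < t := by linarith [ht.1]
    have hB1 := o.one_lt_B ht'
    have hB2 := o.B_sq_le_of_N_ge ν₀_pos (o.N_ge hh ht')
    have hB3 : o.B t ≤ 1 / ν₀ := by nlinarith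
    have h6 : 6 / o.B t ≤ 6 := by rw [div_le_iff₀ (by linarith)]; linarith
    have hq1 := o.q₁_pos t ht'; have hq2 := o.q₂_pos t ht'; have hS := o.S_pos t ht'
    have hc1 := o.one_le_c₁ ht'; have hc2 := o.one_le_c₂ ht'
    have h7 : (o.q₁ t * o.c₁ t + o.q₂ t * o.c₂ t) / o.S t ≤ o.E t := by
      unfold E
      gcongr <;> nlinarith
    have h8 : 0 ≤ 2 * o.B t * (o.E t - (o.q₁ t * o.c₁ t + o.q₂ t * o.c₂ t) / o.S t) :=
      mul_nonneg (by linarith) (by linarith)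
    linarith
  have h1 := tendsto_mul_exp_neg (o.φ (s₀ + 1) - c) (s₀ + 1) two_pos
  filter_upwards [eventually_ge_atTop (s₀ + 1), h1.eventually (gt_mem_nhds one_pos)] with r hr h2
  have := key r hr
  linarith

theorem eventually_q_le (hh : 2 * 10 ^ 5 * Real.exp phaseTime ≤ h) :
    ∀ᶠ s in atTop, o.q₁ s + o.q₂ s ≤ 5 + 1 / ν₀ := by
  filter_upwards [o.eventually_φ_le hh, o.tendsto_q₁.eventually (gt_mem_nhds
    (show (0 : ℝ) < 1 / 2 by norm_num)), eventually_gt_atTop s₀] with s h1 h2 h3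
  have := o.B_pos s h3
  have : 0 < 4 / o.B s := by positivity
  unfold φ at h1
  linarith

/-- A lower bound for `h` that makes the uniform bounds effective. -/
def h₀ : ℝ := 2 * 10 ^ 5 * Real.exp phaseTime + 2 / (ν₀ * c₀ ^ 2)

theorem le_h₀ : 2 * 10 ^ 5 * Real.exp phaseTime ≤ h₀ := by
  have := c₀_pos; have := ν₀_pos
  have : 0 < 2 / (ν₀ * c₀ ^ 2) := by positivity
  unfold h₀; linarith

theorem two_mul_B_sq_le (hh : h₀ ≤ h) (hs : s₀ < s) : 2 * o.B s ^ 2 ≤ o.A s ^ 2 := by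
  have hh' := le_h₀.trans hh
  have h1 := o.B_sq_le_of_N_ge ν₀_pos (o.N_ge hh' hs)
  have h2 := o.A_ge hh' hs
  have hc := c₀_pos; have hν := ν₀_pos
  have h3 : (1 : ℝ) ≤ Real.exp phaseTime := Real.one_le_exp (by unfold phaseTime; norm_num)
  have h5 : 2 / (ν₀ * c₀ ^ 2) ≤ h := by unfold h₀ at hh; linarith
  have h6 : 1 ≤ h := by linarith
  have h4 : 2 / (ν₀ * c₀ ^ 2) ≤ h ^ 2 := by nlinarith
  have h7 : (c₀ * h) ^ 2 ≤ o.A s ^ 2 := by gcongr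
  have h8 : 2 * (1 / ν₀) ≤ (c₀ * h) ^ 2 := by
    rw [div_le_iff₀ (by positivity)] at h4
    rw [mul_one_div, div_le_iff₀ hν]; nlinarith
  linarith

theorem E_le_μ (hh : h₀ ≤ h) (hs : s₀ < s) : o.E s ≤ 16 / c₀ ^ 2 * o.μ s :=
  o.E_le_of_A_ge hs c₀_pos (o.two_mul_B_sq_le hh hs) (o.A_ge (le_h₀.trans hh) hs)

/-- Far below `A = h` the matter would be diluted completely, so `D` cannot stay large. -/
theorem exists_D_lt (hh : h₀ ≤ h) (hs : s₀ < s) : ∃ t ≥ s, o.D t < 10 ^ 10 := by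
  by_contra! hc
  have hh' := le_h₀.trans hh
  have hpos := o.h_pos
  obtain ⟨t, ht, hAt, hDt⟩ : ∃ t > s₀, h / 2 ≤ o.A t ∧ ∀ x ≥ t, 10 ^ 10 ≤ o.D x := by
    rcases (hc s le_rfl).eq_or_lt with h1 | h1
    · exact ⟨s, hs, o.half_le_A hs hh' h1.ge, hc⟩
    · obtain ⟨t, ht, h2, h3⟩ := o.exists_excursion_start hs h1
      refine ⟨t, ht.1, o.half_le_A ht.1 hh' h2.le, fun x hx => ?_⟩
      rcases le_or_gt x s with h4 | h4
      · exact h3 x ⟨hx, h4⟩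
      · exact hc x h4.le
  obtain ⟨y, hy, hy0⟩ := o.exists_phase_end ht hh' hAt fun x hx => hDt x hx.1
  have hy' : s₀ < y := ht.trans_le hy.1
  have hψ : ∀ x ≥ y, 0 ≤ o.ψ x := fun x hx => o.ψ_nonneg_of_le hy' hx (fun r hr => by
    have := hDt r (hy.1.trans hr.1); linarith) hy0
  set k : ℝ := 10 ^ 10 / (2 * h ^ 2) with hk
  have hk0 : 0 < k := by positivity
  have hq2 : ∀ x ≥ y, o.q₂ x ≤ o.q₂ y * Real.exp (-(2 * k) * (x - y)) := by
    intro x hx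
    refine le_mul_exp_of_hasDerivAt hx (fun r hr => o.hasDerivAt_q₂ (hy'.trans_le hr.1))
      fun r hr => ?_
    have hr' := hy'.trans hr.1
    have hD := hDt r (hy.1.trans hr.1.le)
    have h1 := o.one_sub_b₂_ge hr' (by linarith)
    have h2 : k ≤ o.D r / (2 * h ^ 2) := by rw [hk]; gcongr
    have h3 := o.q₂_pos r hr'
    nlinarith
  have hlim : Tendsto (fun x => 16 / c₀ ^ 2 * (o.q₁ x + o.q₂ y * Real.exp (-(2 * k) * (x - y))))
      atTop (𝓝 0) := by
    simpa using (o.tendsto_q₁.add (tendsto_mul_exp_neg (o.q₂ y) y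
      (show 0 < 2 * k by positivity))).const_mul (16 / c₀ ^ 2)
  obtain ⟨z, hz⟩ := eventually_atTop.1 (hlim.eventually (gt_mem_nhds
    (show (0 : ℝ) < 1 / 8 by norm_num)))
  have hc0 := c₀_pos
  have hE : ∀ x ≥ max y z, o.E x ≤ 1 / 8 := by
    intro x hx
    have hxy := (le_max_left y z).trans hx
    have hx' := hy'.trans_le hxy
    have h1 := o.E_le_μ hh hx'
    have h2 := hz x ((le_max_right y z).trans hx)
    have h3 := hq2 x hxy
    have hS1 : 1 ≤ o.S x := by
      have := o.S_sq_eq hx'; have := hDt x (hy.1.trans hxy); have := o.S_pos x hx'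
      nlinarith [sq_nonneg (o.B x)]
    have h4 : o.μ x ≤ o.q₁ x + o.q₂ x := by
      unfold μ
      rw [div_le_iff₀ (by linarith)]
      have := o.q₁_pos x hx'; have := o.q₂_pos x hx'
      nlinarith
    have h5 : 0 < 16 / c₀ ^ 2 := by positivity
    nlinarith
  set b := max y z
  have hb : s₀ < b := hy'.trans_le (le_max_left y z)
  have h1 := add_mul_le_of_hasDerivAt (c := 1 / 2) (show b ≤ b + 2 by linarith)
    (fun x hx => o.hasDerivAt_N (hb.trans_le hx.1)) (fun x hx => by
      have hx' := hb.trans hx.1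
      have h2 := hE x hx.1.le
      have h3 := hψ x ((le_max_left y z).trans hx.1.le)
      have h4 := o.E_eq hx'
      have h5 := o.μ_pos hx'
      unfold ψ at h3
      unfold J; linarith)
  have h2 := o.N_lt_one (show s₀ < b + 2 by linarith)
  have h3 := o.N_pos hb
  linarith

/-- The bound for `D` valid for late times; it does not depend on the orbit. -/
def C₁ : ℝ := 10 ^ 10 + (32 * (5 + 1 / ν₀) / c₀ ^ 2) ^ 2

/-- At a maximum of `D` the density is at least `1/2`; since the amount of matter is
bounded for late times this bounds `S` and thus `D`. -/
theorem eventually_D_le (hh : h₀ ≤ h) : ∀ᶠ s in atTop, o.D s ≤ C₁ := by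
  have hh' := le_h₀.trans hh
  have hc0 := c₀_pos
  obtain ⟨sK, hsK⟩ := eventually_atTop.1 ((o.eventually_q_le hh').and (eventually_gt_atTop s₀))
  have step : ∀ s ≥ sK, 10 ^ 10 ≤ o.D s → o.ψ s < 0 → o.D s ≤ C₁ := by
    intro s hs hD hψ
    have hs' := (hsK s hs).2
    obtain ⟨r, hr, hψr⟩ : ∃ r ≥ s, 0 ≤ o.ψ r := by
      by_contra! hc
      obtain ⟨t, ht, h1⟩ := o.exists_D_lt hh hs'
      have := o.D_mono hs' ht fun x hx => (hc x hx.1.le).le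
      linarith
    obtain ⟨t, ht, h1, h2⟩ := exists_first_eq hr
      (fun x hx => (o.hasDerivAt_ψ (hs'.trans_le hx.1)).continuousAt.continuousWithinAt) hψ hψr
    have ht' := hs'.trans ht.1
    have h3 := o.D_mono hs' ht.1.le fun x hx => (h2 x ⟨hx.1.le, hx.2⟩).le
    have h4 := o.J_neg ht' (by linarith) h1.le
    have h5 := o.E_eq ht'
    have h6 := o.μ_pos ht'
    have hE : 1 / 2 ≤ o.E t := by unfold ψ at h1; unfold J at h4; linarith
    have h7 := o.E_le_μ hh ht'
    have h8 := (hsK t (hs.trans ht.1.le)).1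
    have hS := o.S_pos t ht'
    have h9 : o.S t ≤ 32 * (5 + 1 / ν₀) / c₀ ^ 2 := by
      have h10 : 1 / 2 ≤ 16 / c₀ ^ 2 * o.μ t := hE.trans h7
      unfold μ at h10
      rw [div_mul_div_comm, le_div_iff₀ (by positivity)] at h10
      rw [le_div_iff₀ (by positivity)]
      nlinarith
    have h10 := o.S_sq_eq ht'
    have h11 : o.S t ^ 2 ≤ (32 * (5 + 1 / ν₀) / c₀ ^ 2) ^ 2 := by gcongr
    unfold C₁
    nlinarith [sq_nonneg (o.B t)]
  obtain ⟨s₁, hs₁, hD₁⟩ := o.exists_D_lt hh (hsK sK le_rfl).2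
  filter_upwards [eventually_ge_atTop s₁] with s hs
  by_contra! hc
  have hC : 10 ^ 10 ≤ C₁ := by unfold C₁; linarith [sq_nonneg (32 * (5 + 1 / ν₀) / c₀ ^ 2)]
  have hs₁' := (hsK s₁ hs₁).2
  obtain ⟨t, ht, h1, h2⟩ := exists_last_eq hs
    (fun x hx => (o.hasDerivAt_D (hs₁'.trans_le hx.1)).continuousAt.continuousWithinAt)
    (by linarith) hc
  have h3 := o.D_anti (hs₁'.trans_le ht.1) ht.2.le fun x hx => by
    by_contra! hψ
    have h4 := h2 x ⟨hx.1, hx.2.le⟩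
    have := step x (hs₁.trans (ht.1.trans hx.1.le)) (by linarith) hψ
    linarith
  linarith

end Orbit

/-! ### Saddle dynamics -/

/-- In a region where `n` increases at a definite rate and `D` cannot decrease much relative to
the growth of `n`, the variable `n` leaves every bounded interval. -/
theorem not_run_away {n D n' D' : ℝ → ℝ} {ν δ η k : ℝ} (hη : 0 < η) (hδ : 0 < δ) (hν : 2 * ν < η)
    (hk : k * (2 * ν) < δ) (hk0 : 0 ≤ k)
    (hn : ∀ t ∈ Icc (0 : ℝ) 2, HasDerivAt n (n' t) t)
    (hD : ∀ t ∈ Icc (0 : ℝ) 2, HasDerivAt D (D' t) t)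
    (hnν : ∀ t ∈ Icc (0 : ℝ) 2, n t ≤ ν)
    (hdyn : ∀ t ∈ Icc (0 : ℝ) 2, 0 ≤ n t → δ / 2 ≤ D t → η / 2 ≤ n' t ∧ 0 ≤ D' t + k * n' t)
    (hn0 : 0 ≤ n 0) (hD0 : δ ≤ D 0) : False := by
  have hstep : ∀ t ∈ Icc (0 : ℝ) 2, (∀ r ∈ Icc 0 t, 0 ≤ n r ∧ δ / 2 ≤ D r) →
      n 0 + η / 2 * t ≤ n t ∧ δ / 2 < D t := by
    intro t ht hp
    have hsub : ∀ r ∈ Icc 0 t, r ∈ Icc (0 : ℝ) 2 := fun r hr => ⟨hr.1, hr.2.trans ht.2⟩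
    have hd : ∀ r ∈ Ioo 0 t, η / 2 ≤ n' r ∧ 0 ≤ D' r + k * n' r := fun r hr => by
      have hr' : r ∈ Icc 0 t := ⟨hr.1.le, hr.2.le⟩
      exact hdyn r (hsub r hr') (hp r hr').1 (hp r hr').2
    have h1 := add_mul_le_of_hasDerivAt ht.1 (fun r hr => hn r (hsub r hr))
      (fun r hr => (hd r hr).1)
    have h2 := le_of_hasDerivAt_nonneg (f := fun r => D r + k * n r) ht.1
      (fun r hr => (hD r (hsub r hr)).add ((hn r (hsub r hr)).const_mul k))
      (fun r hr => (hd r hr).2)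
    have h3 := hnν t ht
    refine ⟨by linarith, ?_⟩
    have h4 : k * n t ≤ k * ν := mul_le_mul_of_nonneg_left h3 hk0
    have h5 : 0 ≤ k * n 0 := mul_nonneg hk0 hn0
    linarith
  have hall : ∀ t ≥ (0 : ℝ), t ≤ 2 → 0 ≤ n t ∧ δ / 2 ≤ D t := by
    apply forall_ge_of_step (p := fun t => t ≤ 2 → 0 ≤ n t ∧ δ / 2 ≤ D t)
    · exact fun _ => ⟨hn0, by linarith⟩
    · intro t ht hp
      rcases lt_or_ge t 2 with h2 | h2
      · have htI : t ∈ Icc (0 : ℝ) 2 := ⟨ht, h2.le⟩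
        have hp' : ∀ r ∈ Icc 0 t, 0 ≤ n r ∧ δ / 2 ≤ D r := fun r hr => hp r hr (hr.2.trans h2.le)
        have h3 := hstep t htI hp'
        have h4 := hdyn t htI (hp' t ⟨ht, le_rfl⟩).1 (hp' t ⟨ht, le_rfl⟩).2
        filter_upwards [eventually_pos_nhdsGT (hn t htI) (hp' t ⟨ht, le_rfl⟩).1
          (fun _ => by linarith [h4.1]),
          ((hD t htI).continuousAt.eventually (lt_mem_nhds h3.2)).filter_mono
            nhdsWithin_le_nhds] with r h5 h6 _
        exact ⟨h5.le, h6.le⟩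
      · filter_upwards [self_mem_nhdsWithin] with r hr hr2
        exact absurd hr2 (not_le.2 (lt_of_le_of_lt h2 hr))
    · intro t ht hp ht2
      have htI : t ∈ Icc (0 : ℝ) 2 := ⟨ht.le, ht2⟩
      exact ⟨ge_of_forall_Ico ht (hn t htI).continuousAt
          fun r hr => (hp r hr (hr.2.le.trans ht2)).1,
        ge_of_forall_Ico ht (hD t htI).continuousAt
          fun r hr => (hp r hr (hr.2.le.trans ht2)).2⟩
  have h2 : (2 : ℝ) ∈ Icc (0 : ℝ) 2 := by norm_num
  have h3 := (hstep 2 h2 fun r hr => hall r hr.1 hr.2).1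
  have h4 := hnν 2 h2
  linarith

/-- The saddle-type system `n' = 2/3 - n - E`, `D' ≈ n`, in which `2/3 - E` has the sign of `D`:
an orbit along which `n` remains small, for two units of time before and after, has small `D`.
A large value of `D` would make `n` grow, either forwards or backwards in time. -/
theorem abs_lt_of_saddle {n D D' E : ℝ → ℝ} {s ν δ η ρ : ℝ} (hη : 0 < η) (hη1 : η ≤ 1)
    (hδ : 0 < δ) (hν : 2 * ν < η) (hρ : 0 ≤ ρ) (hρν : 4 * ρ * ν < η * δ)
    (hn : ∀ t ∈ Icc (s - 2) (s + 2), HasDerivAt n (2 / 3 - n t - E t) t)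
    (hD : ∀ t ∈ Icc (s - 2) (s + 2), HasDerivAt D (D' t) t)
    (hnν : ∀ t ∈ Icc (s - 2) (s + 2), |n t| ≤ ν)
    (hE : ∀ t ∈ Icc (s - 2) (s + 2), 0 ≤ E t)
    (hneg : ∀ t ∈ Icc (s - 2) (s + 2), n t ≤ 0 → D' t ≤ 0)
    (hpos : ∀ t ∈ Icc (s - 2) (s + 2), 0 ≤ n t → -ρ * E t ≤ D' t)
    (hup : ∀ t ∈ Icc (s - 2) (s + 2), δ / 2 ≤ D t → E t ≤ 2 / 3 - η)
    (hdown : ∀ t ∈ Icc (s - 2) (s + 2), D t ≤ -δ / 2 → 2 / 3 + η ≤ E t) : |D s| < δ := by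
  have hk : 2 * ρ / η * (2 * ν) < δ := by
    rw [div_mul_eq_mul_div, div_lt_iff₀ hη]; linarith
  have hk0 : 0 ≤ 2 * ρ / η := by positivity
  have fwd : ∀ t ∈ Icc (0 : ℝ) 2, s + t ∈ Icc (s - 2) (s + 2) := fun t ht =>
    ⟨by linarith [ht.1], by linarith [ht.2]⟩
  have bwd : ∀ t ∈ Icc (0 : ℝ) 2, s - t ∈ Icc (s - 2) (s + 2) := fun t ht =>
    ⟨by linarith [ht.2], by linarith [ht.1]⟩
  have hadd : ∀ {f : ℝ → ℝ} {f' t : ℝ}, HasDerivAt f f' (s + t) →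
      HasDerivAt (fun t => f (s + t)) f' t := by
    intro f f' t hf
    exact HasDerivAt.comp_const_add s t hf
  have hsub : ∀ {f : ℝ → ℝ} {f' t : ℝ}, HasDerivAt f f' (s - t) →
      HasDerivAt (fun t => f (s - t)) (-f') t := by
    intro f f' t hf
    exact HasDerivAt.comp_const_sub s t hf
  have hkη : ∀ x : ℝ, η / 2 ≤ x → ρ ≤ 2 * ρ / η * x := by
    intro x hx
    calc ρ = 2 * ρ / η * (η / 2) := by field_simp
      _ ≤ _ := mul_le_mul_of_nonneg_left hx hk0
  have hkE : ∀ x e : ℝ, η / 2 * e ≤ x → ρ * e ≤ 2 * ρ / η * x := by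
    intro x e hx
    calc ρ * e = 2 * ρ / η * (η / 2 * e) := by field_simp
      _ ≤ _ := mul_le_mul_of_nonneg_left hx hk0
  rw [abs_lt]
  constructor
  · by_contra! hc
    rcases le_or_gt (n s) 0 with hs | hs
    · refine not_run_away (n := fun t => -n (s + t)) (D := fun t => -D (s + t)) hη hδ hν hk hk0
        (fun t ht => (hadd (hn _ (fwd t ht))).neg) (fun t ht => (hadd (hD _ (fwd t ht))).neg)
        (fun t ht => (neg_le_abs _).trans (hnν _ (fwd t ht))) (fun t ht h1 h2 => ?_)
        (by simpa using hs) (by simpa using by linarith)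
      have h3 := hneg _ (fwd t ht) (by linarith)
      have h4 := hdown _ (fwd t ht) (by linarith)
      have h5 := (abs_le.1 (hnν _ (fwd t ht))).1
      have h6 : η / 2 ≤ -(2 / 3 - n (s + t) - E (s + t)) := by linarith
      have := hkη _ h6
      exact ⟨h6, by linarith⟩
    · refine not_run_away (n := fun t => n (s - t)) (D := fun t => -D (s - t)) hη hδ hν hk hk0
        (fun t ht => hsub (hn _ (bwd t ht))) (fun t ht => (hsub (hD _ (bwd t ht))).neg)
        (fun t ht => (le_abs_self _).trans (hnν _ (bwd t ht))) (fun t ht h1 h2 => ?_)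
        (by simpa using hs.le) (by simpa using by linarith)
      have h3 := hpos _ (bwd t ht) h1
      have h4 := hdown _ (bwd t ht) (by linarith)
      have h6 : η / 2 ≤ -(2 / 3 - n (s - t) - E (s - t)) := by linarith
      have h7 : η / 2 * E (s - t) ≤ -(2 / 3 - n (s - t) - E (s - t)) := by nlinarith
      have := hkE _ _ h7
      exact ⟨h6, by linarith⟩
  · by_contra! hc
    rcases le_or_gt 0 (n s) with hs | hs
    · refine not_run_away (n := fun t => n (s + t)) (D := fun t => D (s + t)) hη hδ hν hk hk0
        (fun t ht => hadd (hn _ (fwd t ht))) (fun t ht => hadd (hD _ (fwd t ht)))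
        (fun t ht => (le_abs_self _).trans (hnν _ (fwd t ht))) (fun t ht h1 h2 => ?_)
        (by simpa using hs) (by simpa using hc)
      have h3 := hpos _ (fwd t ht) h1
      have h4 := hup _ (fwd t ht) h2
      have h5 := (abs_le.1 (hnν _ (fwd t ht))).2
      have h6 : η / 2 ≤ 2 / 3 - n (s + t) - E (s + t) := by linarith
      have h7 := hE _ (fwd t ht)
      have := hkη _ h6
      have h8 : ρ * E (s + t) ≤ ρ := by nlinarith
      exact ⟨h6, by linarith⟩
    · refine not_run_away (n := fun t => -n (s - t)) (D := fun t => D (s - t)) hη hδ hν hk hk0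
        (fun t ht => (hsub (hn _ (bwd t ht))).neg) (fun t ht => hsub (hD _ (bwd t ht)))
        (fun t ht => (neg_le_abs _).trans (hnν _ (bwd t ht))) (fun t ht h1 h2 => ?_)
        (by simpa using hs.le) (by simpa using hc)
      have h3 := hneg _ (bwd t ht) (by linarith)
      have h4 := hup _ (bwd t ht) h2
      have h6 : η / 2 ≤ - -(2 / 3 - n (s - t) - E (s - t)) := by linarith
      have := hkη _ h6
      exact ⟨h6, by linarith⟩

/-- Forced linear decay. -/
theorem tendsto_zero_of_stable {g r : ℝ → ℝ} {k s₁ : ℝ} (hk : 0 < k)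
    (hg : ∀ s ≥ s₁, HasDerivAt g (-k * g s + r s) s) (hr : Tendsto r atTop (𝓝 0)) :
    Tendsto g atTop (𝓝 0) := by
  have key : ∀ (g r : ℝ → ℝ), (∀ s ≥ s₁, HasDerivAt g (-k * g s + r s) s) →
      Tendsto r atTop (𝓝 0) → ∀ ε > 0, ∀ᶠ s in atTop, g s < ε := by
    intro g r hg hr ε hε
    obtain ⟨b, hb⟩ := eventually_atTop.1 ((hr.eventually (gt_mem_nhds
      (show (0 : ℝ) < k * (ε / 2) by positivity))).and (eventually_ge_atTop s₁))
    have h1 := tendsto_mul_exp_neg (g b - ε / 2) b hk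
    filter_upwards [h1.eventually (gt_mem_nhds (show (0 : ℝ) < ε / 2 by positivity)),
      eventually_ge_atTop b] with s h2 h3
    have := le_mul_exp_of_hasDerivAt (f := fun s => g s - ε / 2) (k := k) h3
      (fun x hx => (hg x ((hb b le_rfl).2.trans hx.1)).sub_const _)
      (fun x hx => by have := (hb x hx.1.le).1; linarith)
    linarith
  rw [Metric.tendsto_atTop']
  intro ε hε
  have h1 := key g r hg hr ε hε
  have h2 := key (fun s => -g s) (fun s => -r s)
    (fun s hs => (hg s hs).neg.congr_deriv (by ring)) (by simpa using hr.neg) ε hε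
  obtain ⟨b, hb⟩ := eventually_atTop.1 (h1.and h2)
  refine ⟨b, fun s hs => ?_⟩
  rw [Real.dist_eq, sub_zero, abs_lt]
  have := hb s hs.le
  constructor <;> linarith

/-- A solution of a forced unstable linear equation that grows more slowly than the homogeneous
solutions tends to zero with the forcing. -/
theorem tendsto_zero_of_unstable {g r : ℝ → ℝ} {k s₁ : ℝ} (hk : 0 < k)
    (hg : ∀ s ≥ s₁, HasDerivAt g (k * g s + r s) s) (hr : Tendsto r atTop (𝓝 0))
    (hb : Tendsto (fun s => g s * Real.exp (-k * s)) atTop (𝓝 0)) :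
    Tendsto g atTop (𝓝 0) := by
  have key : ∀ (g r : ℝ → ℝ), (∀ s ≥ s₁, HasDerivAt g (k * g s + r s) s) →
      Tendsto r atTop (𝓝 0) → Tendsto (fun s => g s * Real.exp (-k * s)) atTop (𝓝 0) →
      ∀ ε > 0, ∀ᶠ s in atTop, g s < ε := by
    intro g r hg hr hb ε hε
    obtain ⟨b, hb'⟩ := eventually_atTop.1 ((hr.eventually (lt_mem_nhds
      (show -(k * (ε / 2)) < (0 : ℝ) by rw [neg_lt_zero]; positivity))).and
        (eventually_ge_atTop s₁))
    filter_upwards [eventually_ge_atTop b] with s hs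
    by_contra! hc
    have h1 : ∀ x ≥ s, ε / 2 * Real.exp (-k * s) ≤ g x * Real.exp (-k * x) := by
      intro x hx
      have h2 := mul_exp_le_of_hasDerivAt (f := fun s => g s - ε / 2) (k := k) hx
        (fun y hy => (hg y (((hb' b le_rfl).2.trans hs).trans hy.1)).sub_const _)
        (fun y hy => by have := (hb' y (hs.trans hy.1.le)).1; linarith)
      have h3 : (g s - ε / 2) * Real.exp (k * (x - s)) ≤ g x := by linarith
      have h4 : ε / 2 * Real.exp (k * (x - s)) ≤ g x :=
        le_trans (mul_le_mul_of_nonneg_right (by linarith) (Real.exp_pos _).le) h3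
      calc ε / 2 * Real.exp (-k * s)
          = ε / 2 * Real.exp (k * (x - s)) * Real.exp (-k * x) := by
            rw [mul_assoc, ← Real.exp_add]; congr 2; ring
        _ ≤ _ := mul_le_mul_of_nonneg_right h4 (Real.exp_pos _).le
    have h2 : 0 < ε / 2 * Real.exp (-k * s) := by positivity
    have h3 := ge_of_tendsto hb ((eventually_ge_atTop s).mono h1)
    linarith
  rw [Metric.tendsto_atTop']
  intro ε hε
  have h1 := key g r hg hr hb ε hε
  have h2 := key (fun s => -g s) (fun s => -r s)
    (fun s hs => (hg s hs).neg.congr_deriv (by ring)) (by simpa using hr.neg)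
    (by simpa using hb.neg) ε hε
  obtain ⟨b, hb⟩ := eventually_atTop.1 (h1.and h2)
  refine ⟨b, fun s hs => ?_⟩
  rw [Real.dist_eq, sub_zero, abs_lt]
  have := hb s hs.le
  constructor <;> linarith

/-- A function with exponentially decaying derivative converges. -/
theorem exists_tendsto_of_deriv_exp {g g' : ℝ → ℝ} {k C s₁ : ℝ} (hk : 0 < k)
    (hg : ∀ s ≥ s₁, HasDerivAt g (g' s) s) (hb : ∀ s ≥ s₁, |g' s| ≤ C * Real.exp (-k * s)) :
    ∃ c, Tendsto g atTop (𝓝 c) := by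
  have hexp : ∀ s, HasDerivAt (fun s => C / k * Real.exp (-k * s)) (-(C * Real.exp (-k * s))) s := by
    intro s
    have h1 : HasDerivAt (fun s => Real.exp (-k * s)) (Real.exp (-k * s) * (-k * 1)) s :=
      ((hasDerivAt_id s).const_mul (-k)).exp
    refine (h1.const_mul (C / k)).congr_deriv ?_
    field_simp
  have key : ∀ s ≥ s₁, ∀ t ≥ s, |g t - g s| ≤ C / k * Real.exp (-k * s) := by
    intro s hs t ht
    have hC : 0 ≤ C / k * Real.exp (-k * t) := by
      have h1 := (abs_nonneg _).trans (hb t (hs.le.trans ht))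
      have h2 := Real.exp_pos (-k * t)
      have h3 : 0 ≤ C := nonneg_of_mul_nonneg_left h1 h2
      positivity
    have h1 := le_of_hasDerivAt_nonpos (f := fun s => g s + C / k * Real.exp (-k * s)) ht
      (fun x hx => (hg x (hs.le.trans hx.1)).add (hexp x)) (fun x hx => by
        have := (abs_le.1 (hb x (hs.le.trans hx.1.le))).2; linarith)
    have h2 := le_of_hasDerivAt_nonneg (f := fun s => g s - C / k * Real.exp (-k * s)) ht
      (fun x hx => (hg x (hs.le.trans hx.1)).sub (hexp x)) (fun x hx => by
        have := (abs_le.1 (hb x (hs.le.trans hx.1.le))).1; linarith)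
    rw [abs_le]
    constructor <;> linarith
  have hlim : Tendsto (fun s => C / k * Real.exp (-k * s)) atTop (𝓝 0) := by
    simpa using tendsto_mul_exp_neg (C / k) 0 hk
  refine cauchySeq_tendsto_of_complete (Metric.cauchySeq_iff'.2 fun ε hε => ?_)
  obtain ⟨b, hb1, hb2⟩ := ((hlim.eventually (gt_mem_nhds hε)).and (eventually_ge_atTop s₁)).exists
  refine ⟨b, fun t ht => ?_⟩
  rw [Real.dist_eq]
  exact (key b hb2 t ht).trans_lt hb1

theorem eventually_forall_ge_sub {p : ℝ → Prop} (hp : ∀ᶠ s in atTop, p s) (c : ℝ) :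
    ∀ᶠ s in atTop, ∀ x ≥ s - c, p x := by
  obtain ⟨a, ha⟩ := eventually_atTop.1 hp
  filter_upwards [eventually_ge_atTop (a + c)] with s hs x hx using ha x (by linarith)

namespace Orbit

variable {h s₀ : ℝ} (o : Orbit h s₀) {s : ℝ}

/-! ### The orbit stays close to the fixed point for late times -/

/-- The deviation of `N` from its limit `1/3`. -/
def n (s : ℝ) : ℝ := o.N s - 1 / 3

/-- The lower bound for `h` that the asymptotic analysis requires. -/
def h₁ : ℝ := h₀ + 10 ^ 60 * C₁ ^ 4

theorem C₁_ge : 10 ^ 10 ≤ C₁ := by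
  unfold C₁; linarith [sq_nonneg (32 * (5 + 1 / ν₀) / c₀ ^ 2)]

theorem h₀_pos : 0 < h₀ := by
  have := c₀_pos; have := ν₀_pos
  unfold h₀; positivity

theorem h₀_le (hh : h₁ ≤ h) : h₀ ≤ h := by
  have : 0 ≤ 10 ^ 60 * C₁ ^ 4 := by positivity
  unfold h₁ at hh; linarith

theorem C₁_cube_le (hh : h₁ ≤ h) : 10 ^ 60 * C₁ ^ 3 ≤ h := by
  have hC := C₁_ge
  have := h₀_pos
  have h1 : C₁ ^ 3 * 1 ≤ C₁ ^ 3 * C₁ := by gcongr; linarith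
  unfold h₁ at hh; nlinarith

theorem C₁_le (hh : h₁ ≤ h) : 10 ^ 60 * C₁ ≤ h := by
  have hC := C₁_ge
  have h1 := C₁_cube_le hh
  have h2 : 1 * 1 * C₁ ≤ C₁ * C₁ * C₁ := by gcongr <;> linarith
  nlinarith

theorem h_ge (hh : h₁ ≤ h) : 10 ^ 60 ≤ h := by
  have hC := C₁_ge
  have := C₁_le hh
  nlinarith

theorem A_sq_ge (hh : h₁ ≤ h) (hD : o.D s ≤ C₁) : 9 / 10 * h ^ 2 ≤ o.A s ^ 2 := by
  have h1 := C₁_le hh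
  have h2 := h_ge hh
  have hC := C₁_ge
  unfold D at hD
  nlinarith

theorem A_sq_le_mul (hh : h₁ ≤ h) (hs : s₀ < s) : o.A s ^ 2 ≤ 11 / 10 * h ^ 2 := by
  have h2 := h_ge hh
  have := o.A_sq_le hs
  nlinarith

theorem neg_three_le_D (hs : s₀ < s) : -3 ≤ o.D s := by
  have := o.A_sq_le hs
  unfold D; linarith

theorem hasDerivAt_D' (hs : s₀ < s) :
    HasDerivAt o.D (o.A s ^ 2 * (3 * o.n s - o.P s) / o.N s) s := by
  refine (o.hasDerivAt_D hs).congr_deriv ?_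
  have := o.N_pos hs
  rw [o.a_eq hs, ψ, n]; field_simp; ring

theorem hasDerivAt_n (hs : s₀ < s) : HasDerivAt o.n (2 / 3 - o.n s - o.E s) s := by
  refine ((o.hasDerivAt_N hs).sub_const (1 / 3)).congr_deriv ?_
  unfold J n; ring

/-- If `N` were much below `1/3`, it would stay so for some time, as `N' ≤ 1`, and `D` would
decrease below its lower bound. -/
theorem n_ge (hh : h₁ ≤ h) (hs : s₀ < s) (hD : ∀ x ≥ s, o.D x ≤ C₁) : -(C₁ / h) ≤ o.n s := by
  by_contra! hc
  have hC := C₁_ge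
  have hpos := o.h_pos
  set δ := -o.n s with hδ
  have hδ1 : C₁ < δ * h := by rw [← div_lt_iff₀ hpos]; linarith
  have hN := o.N_pos hs
  have hδ0 : 0 < δ := by
    have : 0 < C₁ / h := by positivity
    linarith
  have h1 := le_add_mul_of_hasDerivAt (c := -(2 * h ^ 2 * δ))
    (show s ≤ s + δ / 2 by linarith) (fun x hx => o.hasDerivAt_D' (hs.trans_le hx.1))
    (fun x hx => by
      have hx' := hs.trans hx.1
      have hNx := o.N_pos hx'
      have hP := o.P_pos hx'
      have h2 := o.N_le_add hs hx.1.le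
      have h3 : o.n x ≤ -(δ / 2) := by unfold n at hδ ⊢; linarith [hx.2]
      have h4 : o.N x ≤ 1 / 3 := by unfold n at h3; linarith
      have h5 := o.A_sq_ge hh (hD x hx.1.le)
      rw [div_le_iff₀ hNx]
      have h6 : o.A x ^ 2 * (3 * o.n x - o.P x) ≤ 9 / 10 * h ^ 2 * -(3 * (δ / 2)) := by
        have : 3 * o.n x - o.P x ≤ -(3 * (δ / 2)) := by linarith
        have h7 : 0 ≤ 3 * (δ / 2) := by linarith
        nlinarith
      have h7 : 0 < h ^ 2 * δ := by positivity
      nlinarith)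
  have h2 := o.neg_three_le_D (show s₀ < s + δ / 2 by linarith)
  have h3 := hD s le_rfl
  have h4 : C₁ * C₁ < δ * h * (δ * h) := by gcongr
  nlinarith

theorem N_ge_quarter (hh : h₁ ≤ h) (hs : s₀ < s) (hD : ∀ x ≥ s, o.D x ≤ C₁) : 1 / 4 ≤ o.N s := by
  have h1 := o.n_ge hh hs hD
  have h2 : C₁ / h ≤ 1 / 12 := by
    rw [div_le_iff₀ o.h_pos]
    have := C₁_le hh; have := C₁_ge
    linarith
  unfold n at h1; linarith

theorem B_le_two (hh : h₁ ≤ h) (hs : s₀ < s) (hD : ∀ x ≥ s, o.D x ≤ C₁) : o.B s ≤ 2 := by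
  have h1 := o.B_sq_le_of_N_ge (by norm_num) (o.N_ge_quarter hh hs hD)
  have := o.B_pos s hs
  nlinarith

theorem t₁_le_div (hh : h₁ ≤ h) (hs : s₀ < s) (hD : o.D s ≤ C₁) (hB : o.B s ≤ 2) {M : ℝ}
    (hM : 2 ≤ M) (hS : o.S s ≤ M) : o.t₁ s ≤ 5 * M / h := by
  have hBp := o.B_pos s hs
  have hAp := o.A_pos s hs
  have hSp := o.S_pos s hs
  have hpos := o.h_pos
  have h1 := o.A_sq_ge hh hD
  have h2 := o.A_sq_le_mul hh hs
  have h3 := h_ge hh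
  have hA : o.A s ≤ 11 / 10 * h := by nlinarith
  rw [o.t₁_eq s hs, div_le_div_iff₀ (o.R_pos hs) hpos]
  have h4 : o.B s * h + o.A s * o.S s ≤ 2 * h + 11 / 10 * h * M := by gcongr
  have h5 : 4 / 5 * h ^ 2 ≤ o.A s ^ 2 - o.B s ^ 2 := by nlinarith
  calc (o.B s * h + o.A s * o.S s) * h ≤ (2 * h + 11 / 10 * h * M) * h := by gcongr
    _ ≤ 5 * M * (4 / 5 * h ^ 2) := by nlinarith [sq_nonneg h, mul_pos hpos hpos]
    _ ≤ _ := by gcongr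

theorem t₂_sq_le (hs : s₀ < s) : o.t₂ s ^ 2 ≤ o.t₁ s ^ 2 := by
  have h1 := o.c₁_sq hs
  have h2 := o.c₂_sq hs
  have h3 := o.c₂_le_c₁ hs
  have h4 := o.c₂_pos hs
  nlinarith

theorem P_le_mul_E (hs : s₀ < s) {r : ℝ} (hr : o.t₁ s ≤ r) : o.P s ≤ r ^ 2 * o.E s := by
  have h1 := o.one_le_c₁ hs
  have h2 := o.one_le_c₂ hs
  have h3 := o.t₂_sq_le hs
  have h4 := o.t₁_pos hs
  have h5 : o.t₁ s ^ 2 ≤ r ^ 2 := by gcongr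
  have hq1 := o.q₁_pos s hs; have hq2 := o.q₂_pos s hs; have hS := o.S_pos s hs
  unfold P E
  rw [mul_div_assoc', div_le_div_iff_of_pos_right hS]
  have h6 : o.q₁ s * o.t₁ s ^ 2 ≤ r ^ 2 * (o.q₁ s * o.c₁ s ^ 2) := by
    calc o.q₁ s * o.t₁ s ^ 2 ≤ o.q₁ s * r ^ 2 := by gcongr
      _ = r ^ 2 * (o.q₁ s * 1) := by ring
      _ ≤ _ := by gcongr; nlinarith
  have h7 : o.q₂ s * o.t₂ s ^ 2 ≤ r ^ 2 * (o.q₂ s * o.c₂ s ^ 2) := by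
    calc o.q₂ s * o.t₂ s ^ 2 ≤ o.q₂ s * r ^ 2 := mul_le_mul_of_nonneg_left (h3.trans h5) hq2.le
      _ = r ^ 2 * (o.q₂ s * 1) := by ring
      _ ≤ _ := by gcongr; nlinarith
  linarith

theorem P_le_C₁ (hh : h₁ ≤ h) (hs : s₀ < s) (hD : ∀ x ≥ s, o.D x ≤ C₁) :
    o.P s ≤ (C₁ / h) ^ 2 * o.E s := by
  have hC := C₁_ge
  have hB := o.B_le_two hh hs hD
  have hBp := o.B_pos s hs
  have hSp := o.S_pos s hs
  have hS : o.S s ≤ C₁ / 5 := by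
    have h1 := o.S_sq_eq hs
    have h2 := hD s le_rfl
    have h3 : o.S s ^ 2 ≤ C₁ + 4 := by nlinarith
    nlinarith
  apply o.P_le_mul_E hs
  have := o.t₁_le_div hh hs (hD s le_rfl) hB (by linarith) hS
  rwa [mul_div_cancel₀ _ (by norm_num : (5 : ℝ) ≠ 0)] at this

theorem A_sq_mul_P_div_le (hh : h₁ ≤ h) (hs : s₀ < s) (hD : ∀ x ≥ s, o.D x ≤ C₁) :
    o.A s ^ 2 * o.P s / o.N s ≤ 8 * C₁ ^ 2 * o.E s := by
  have h1 := o.P_le_C₁ hh hs hD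
  have h2 := o.A_sq_le_mul hh hs
  have h3 := o.N_ge_quarter hh hs hD
  have h4 := o.P_pos hs
  have hE := o.E_pos hs
  have hC := C₁_ge
  have hpos := o.h_pos
  rw [div_le_iff₀ (by linarith)]
  calc o.A s ^ 2 * o.P s ≤ 11 / 10 * h ^ 2 * ((C₁ / h) ^ 2 * o.E s) := by gcongr
    _ = 11 / 10 * C₁ ^ 2 * o.E s := by field_simp
    _ ≤ 8 * C₁ ^ 2 * o.E s * (1 / 4) := by
      have : 0 < C₁ ^ 2 * o.E s := by positivity
      linarith
    _ ≤ _ := by gcongr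

/-- If `N` were much above `1/3`, it would have been so for some time, as `N' ≤ 1`, and `D` would
have increased by too much. -/
theorem n_le (hh : h₁ ≤ h) (hs : s₀ < s - 1) (hD : ∀ x ≥ s - 1, o.D x ≤ C₁) :
    o.n s ≤ 6 * C₁ / h := by
  by_contra! hc
  have hC := C₁_ge
  have hpos := o.h_pos
  set δ := o.n s with hδ
  rw [div_lt_iff₀ hpos] at hc
  have hs' : s₀ < s := by linarith
  have hN := o.N_lt_one hs'
  have hδ0 : 0 < δ := by
    by_contra! h0
    nlinarith
  have hδ1 : δ < 1 := by rw [hδ]; unfold n; linarith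
  have hx1 : ∀ x ∈ Icc (s - δ / 2) s, s₀ < x := fun x hx => by linarith [hx.1]
  have h1 := add_mul_le_of_hasDerivAt (f := fun x => o.D x - 8 * C₁ ^ 2 * o.N x)
    (c := 3 / 4 * h ^ 2 * δ - 8 * C₁ ^ 2)
    (show s - δ / 2 ≤ s by linarith)
    (fun x hx => (o.hasDerivAt_D' (hx1 x hx)).sub ((o.hasDerivAt_N (hx1 x hx)).const_mul _))
    (fun x hx => by
      have hx' := hx1 x ⟨hx.1.le, hx.2.le⟩
      have hNx := o.N_pos hx'
      have hNx1 := o.N_lt_one hx'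
      have h2 := o.N_le_add hx' hx.2.le
      have h3 : δ / 2 ≤ o.n x := by unfold n at hδ ⊢; linarith [hx.1]
      have hDx : ∀ y ≥ x, o.D y ≤ C₁ := fun y hy => hD y (by linarith [hx.1])
      have h5 := o.A_sq_ge hh (hDx x le_rfl)
      have h6 := o.A_sq_mul_P_div_le hh hx' hDx
      have h7 : 3 / 4 * h ^ 2 * δ ≤ o.A x ^ 2 * (3 * o.n x) / o.N x := by
        rw [le_div_iff₀ hNx]
        have h8 : 9 / 10 * h ^ 2 * (3 * (δ / 2)) ≤ o.A x ^ 2 * (3 * o.n x) := by gcongr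
        have h9 : 0 < h ^ 2 * δ := by positivity
        nlinarith
      rw [mul_sub, sub_div]
      have h8 : 8 * C₁ ^ 2 * o.J x = 8 * C₁ ^ 2 - 8 * C₁ ^ 2 * o.N x - 8 * C₁ ^ 2 * o.E x := by
        unfold J; ring
      have h9 : 0 ≤ 8 * C₁ ^ 2 * o.N x := by positivity
      linarith)
  have hx0 : s₀ < s - δ / 2 := by linarith
  have h2 := o.neg_three_le_D hx0
  have h3 := hD s (by linarith)
  have h4 : 6 * C₁ * (6 * C₁) < δ * h * (δ * h) := by gcongr
  have h5 : 8 * C₁ ^ 2 * o.N (s - δ / 2) ≤ 8 * C₁ ^ 2 * 1 := by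
    gcongr; exact (o.N_lt_one hx0).le
  have h6 : 0 ≤ 8 * C₁ ^ 2 * o.N s := by have := o.N_pos hs'; positivity
  nlinarith

/-- The bound `|N - 1/3| = O(1/h)` for late times. -/
theorem eventually_abs_n_le (hh : h₁ ≤ h) :
    ∀ᶠ s in atTop, s₀ < s ∧ (∀ x ≥ s, o.D x ≤ C₁) ∧ |o.n s| ≤ 6 * C₁ / h := by
  filter_upwards [eventually_forall_ge_sub (o.eventually_D_le (h₀_le hh)) 1,
    eventually_gt_atTop (s₀ + 1)] with s h1 h2
  have hpos := o.h_pos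
  have hD : ∀ x ≥ s, o.D x ≤ C₁ := fun x hx => h1 x (by linarith)
  refine ⟨by linarith, hD, abs_le.2 ⟨?_, o.n_le hh (by linarith) h1⟩⟩
  have h3 := o.n_ge hh (by linarith) hD
  have h4 : C₁ / h ≤ 6 * C₁ / h := by
    gcongr; have := C₁_ge; linarith
  linarith

theorem sqrt_three_bounds : 1.732 < √3 ∧ √3 < 1.7321 ∧ √3 ^ 2 = 3 :=
  ⟨Real.lt_sqrt_of_sq_lt (by norm_num), (Real.sqrt_lt' (by norm_num)).2 (by norm_num),
    Real.sq_sqrt (by norm_num)⟩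

theorem abs_B_sub_le (hs : s₀ < s) (hN : 1 / 4 ≤ o.N s) : |o.B s - √3| ≤ 6 * |o.n s| := by
  obtain ⟨h1, h2, h3⟩ := sqrt_three_bounds
  have hB := o.one_lt_B hs
  have h4 : (o.B s - √3) * (o.B s + √3) = -(3 / o.N s) * o.n s := by
    have := o.N_pos hs
    have h5 : (o.B s - √3) * (o.B s + √3) = o.B s ^ 2 - √3 ^ 2 := by ring
    rw [h5, h3, o.B_sq_eq, n]; field_simp; ring
  have h5 := congrArg abs h4
  have hN0 : 3 / o.N s ≤ 12 := by rw [div_le_iff₀ (by linarith)]; linarith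
  have hN1 : 0 < 3 / o.N s := by have := o.N_pos hs; positivity
  rw [abs_mul, abs_mul, abs_neg, abs_of_pos hN1, abs_of_pos (by linarith : 0 < o.B s + √3)] at h5
  have h6 := abs_nonneg (o.B s - √3)
  have h7 := abs_nonneg (o.n s)
  nlinarith

/-- The source term of `φ'` is stationary at `B = √3`. -/
theorem φ_deriv_eq (hs : s₀ < s) : 6 / o.B s + 2 * o.B s
    = 4 * √3 + 2 * (o.B s - √3) ^ 2 / o.B s := by
  have := o.B_pos s hs
  obtain ⟨_, _, h3⟩ := sqrt_three_bounds
  field_simp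
  linear_combination (-2 : ℝ) * h3

theorem φ_error_nonneg (hs : s₀ < s) :
    0 ≤ o.E s - (o.q₁ s * o.c₁ s + o.q₂ s * o.c₂ s) / o.S s := by
  have hq1 := o.q₁_pos s hs; have hq2 := o.q₂_pos s hs; have hS := o.S_pos s hs
  have hc1 := o.one_le_c₁ hs; have hc2 := o.one_le_c₂ hs
  unfold E
  rw [sub_nonneg]
  gcongr <;> nlinarith

theorem φ_error_le (hs : s₀ < s) :
    o.E s - (o.q₁ s * o.c₁ s + o.q₂ s * o.c₂ s) / o.S s ≤ o.P s := by
  have hq1 := o.q₁_pos s hs; have hq2 := o.q₂_pos s hs; have hS := o.S_pos s hs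
  have hc1 := o.one_le_c₁ hs; have hc2 := o.one_le_c₂ hs
  have h1 : o.μ s ≤ (o.q₁ s * o.c₁ s + o.q₂ s * o.c₂ s) / o.S s := by
    unfold μ; gcongr <;> nlinarith
  have := o.E_eq hs
  linarith

theorem sq_div_B_le (hs : s₀ < s) (hN : 1 / 4 ≤ o.N s) :
    2 * (o.B s - √3) ^ 2 / o.B s ≤ 72 * o.n s ^ 2 := by
  have hB := o.one_lt_B hs
  have h1 := o.abs_B_sub_le hs hN
  have h2 : (o.B s - √3) ^ 2 ≤ (6 * |o.n s|) ^ 2 := by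
    rw [← sq_abs]; gcongr
  rw [mul_pow, sq_abs] at h2
  rw [div_le_iff₀ (by linarith)]
  nlinarith [sq_nonneg (o.n s)]

/-- The deviation of `φ` from its limit `2√3`. -/
def ζ (s : ℝ) : ℝ := o.φ s - 2 * √3

theorem hasDerivAt_ζ (hs : s₀ < s) : HasDerivAt o.ζ (-2 * o.ζ s
    + (2 * (o.B s - √3) ^ 2 / o.B s
      - 2 * o.B s * (o.E s - (o.q₁ s * o.c₁ s + o.q₂ s * o.c₂ s) / o.S s))) s := by
  refine ((o.hasDerivAt_φ hs).sub_const (2 * √3)).congr_deriv ?_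
  have := o.φ_deriv_eq hs
  unfold ζ
  linear_combination this

theorem eventually_abs_ζ_le (hh : h₁ ≤ h) : ∀ᶠ s in atTop, |o.ζ s| ≤ 2000 * (C₁ / h) ^ 2 := by
  obtain ⟨a, ha⟩ := eventually_atTop.1 (o.eventually_abs_n_le hh)
  set κ := (C₁ / h) ^ 2 with hκ
  have hκ0 : 0 < κ := by
    have := C₁_ge; have := o.h_pos
    rw [hκ]; positivity
  have hup := fun s (hs : a ≤ s) => le_mul_exp_of_hasDerivAt (f := fun s => o.ζ s - 1296 * κ)
    (k := 2) hs (fun x hx => (o.hasDerivAt_ζ (ha x hx.1).1).sub_const _) (fun x hx => by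
      obtain ⟨h1, h2, h3⟩ := ha x hx.1.le
      have h4 := o.sq_div_B_le h1 (o.N_ge_quarter hh h1 h2)
      have h5 : 0 ≤ 2 * o.B x * (o.E x - (o.q₁ x * o.c₁ x + o.q₂ x * o.c₂ x) / o.S x) :=
        mul_nonneg (by linarith [o.B_pos x h1]) (o.φ_error_nonneg h1)
      have h6 : o.n x ^ 2 ≤ (6 * C₁ / h) ^ 2 := by rw [← sq_abs]; gcongr
      have h7 : (6 * C₁ / h) ^ 2 = 36 * κ := by rw [hκ]; ring
      linarith)
  -- The error term in the lower bound is proportional to `E = 1 - N - N'`, so that part of it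
  -- is absorbed by subtracting a multiple of `N`.
  have hlow := fun s (hs : a ≤ s) => le_mul_exp_of_hasDerivAt
    (f := fun s => -(o.ζ s - 4 * κ * o.N s + 4 * κ))
    (k := 2) hs (fun x hx => (((o.hasDerivAt_ζ (ha x hx.1).1).sub
      ((o.hasDerivAt_N (ha x hx.1).1).const_mul (4 * κ))).add_const (4 * κ)).neg) (fun x hx => by
      obtain ⟨h1, h2, h3⟩ := ha x hx.1.le
      have hB0 := o.B_pos x h1
      have h4 : 0 ≤ 2 * (o.B x - √3) ^ 2 / o.B x := by positivity
      have h5 : 2 * o.B x * (o.E x - (o.q₁ x * o.c₁ x + o.q₂ x * o.c₂ x) / o.S x)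
          ≤ 2 * 2 * (κ * o.E x) :=
        mul_le_mul (by linarith [o.B_le_two hh h1 h2])
          ((o.φ_error_le h1).trans (o.P_le_C₁ hh h1 h2)) (o.φ_error_nonneg h1) (by norm_num)
      have h6 : κ * o.N x ≤ κ * 1 := by gcongr; exact (o.N_lt_one h1).le
      have h7 : 4 * κ * o.J x = 4 * κ - 4 * κ * o.N x - 4 * κ * o.E x := by unfold J; ring
      have h8 : 0 < κ * o.N x := mul_pos hκ0 (o.N_pos h1)
      linarith)
  filter_upwards [eventually_ge_atTop a,
    (tendsto_mul_exp_neg (o.ζ a - 1296 * κ) a two_pos).eventually (gt_mem_nhds hκ0),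
    (tendsto_mul_exp_neg (-(o.ζ a - 4 * κ * o.N a + 4 * κ)) a two_pos).eventually
      (gt_mem_nhds hκ0)] with s hs h1 h2
  have h3 := hup s hs
  have h4 := hlow s hs
  have h5 := o.N_pos (ha s hs).1
  have h6 : 0 < κ * o.N s := by positivity
  have h7 : κ * o.N s ≤ κ * 1 := by gcongr; exact (o.N_lt_one (ha s hs).1).le
  rw [abs_le]
  constructor <;> linarith

theorem q_add_eq (s : ℝ) : o.q₁ s + o.q₂ s = o.ζ s + 2 * √3 - 4 / o.B s + 2 * o.q₁ s := by
  unfold ζ φ; ring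

theorem abs_div_B_sub_le (hs : s₀ < s) (hN : 1 / 4 ≤ o.N s) :
    |4 / o.B s - 4 * √3 / 3| ≤ 24 * |o.n s| := by
  obtain ⟨h1, h2, h3⟩ := sqrt_three_bounds
  have hB := o.one_lt_B hs
  have h4 := o.abs_B_sub_le hs hN
  have h5 : 4 / o.B s - 4 * √3 / 3 = -(4 * √3 / (3 * o.B s)) * (o.B s - √3) := by
    field_simp
    linear_combination (-1 : ℝ) * h3
  have h6 : 4 * √3 / (3 * o.B s) ≤ 4 := by
    rw [div_le_iff₀ (by linarith)]; linarith
  rw [h5, abs_mul, abs_neg, abs_of_pos (by positivity)]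
  calc _ ≤ 4 * (6 * |o.n s|) := by gcongr
    _ = _ := by ring

/-- The radius of the neighbourhood of the fixed point in which the linearisation is used. -/
def δ₀ : ℝ := 1 / 10 ^ 12

/-- What is known about the orbit for late times, before `D` is shown to be small. -/
structure Late (s : ℝ) : Prop where
  lt : s₀ < s
  D_le : ∀ x ≥ s, o.D x ≤ C₁
  n_le : |o.n s| ≤ 6 * C₁ / h
  ζ_le : |o.ζ s| ≤ 2000 * (C₁ / h) ^ 2
  q₁_le : o.q₁ s ≤ 1 / 10 ^ 20

theorem eventually_late (hh : h₁ ≤ h) : ∀ᶠ s in atTop, o.Late s := by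
  filter_upwards [o.eventually_abs_n_le hh, o.eventually_abs_ζ_le hh,
    o.tendsto_q₁.eventually (gt_mem_nhds (show (0 : ℝ) < 1 / 10 ^ 20 by norm_num))]
    with s h1 h2 h3 using ⟨h1.1, h1.2.1, h1.2.2, h2, h3.le⟩

theorem C₁_div_le (hh : h₁ ≤ h) : C₁ / h ≤ 1 / 10 ^ 60 := by
  have h1 := C₁_le hh
  have h2 := h_ge hh
  rw [div_le_div_iff₀ (by linarith) (by norm_num)]; linarith

theorem C₁_div_sq_le (hh : h₁ ≤ h) : (C₁ / h) ^ 2 ≤ 1 / 10 ^ 100 := by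
  have h1 := C₁_div_le hh
  have h2 := h_ge hh
  have h3 : 0 ≤ C₁ / h := by have := C₁_ge; positivity
  calc (C₁ / h) ^ 2 ≤ (1 / 10 ^ 60) ^ 2 := by gcongr
    _ ≤ _ := by norm_num

namespace Late

variable {o}

theorem abs_n_le (hl : o.Late s) (hh : h₁ ≤ h) : |o.n s| ≤ 1 / 10 ^ 50 := by
  have h1 := C₁_div_le hh
  have h2 := hl.n_le
  rw [mul_div_assoc] at h2
  refine h2.trans ?_
  calc 6 * (C₁ / h) ≤ 6 * (1 / 10 ^ 60) := by gcongr
    _ ≤ _ := by norm_num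

theorem abs_ζ_le (hl : o.Late s) (hh : h₁ ≤ h) : |o.ζ s| ≤ 1 / 10 ^ 50 := by
  have h1 := C₁_div_sq_le hh
  refine hl.ζ_le.trans ?_
  calc 2000 * (C₁ / h) ^ 2 ≤ 2000 * (1 / 10 ^ 100) := by gcongr
    _ ≤ _ := by norm_num

theorem N_ge (hl : o.Late s) (hh : h₁ ≤ h) : 1 / 4 ≤ o.N s := o.N_ge_quarter hh hl.lt hl.D_le

theorem abs_q_sub_le (hl : o.Late s) (hh : h₁ ≤ h) :
    |o.q₁ s + o.q₂ s - 2 * √3 / 3| ≤ 1 / 10 ^ 18 := by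
  have h1 := abs_le.1 (hl.abs_ζ_le hh)
  have h2 := hl.abs_n_le hh
  have h3 := abs_le.1 (o.abs_div_B_sub_le hl.lt (hl.N_ge hh))
  have h4 := hl.q₁_le
  have h5 := o.q₁_pos s hl.lt
  rw [o.q_add_eq, abs_le]
  constructor <;> linarith

theorem abs_B_sq_sub_le (hl : o.Late s) (hh : h₁ ≤ h) : |o.B s ^ 2 - 3| ≤ 1 / 10 ^ 40 := by
  have h2 := hl.abs_n_le hh
  have hN := hl.N_ge hh
  have h3 : o.B s ^ 2 - 3 = -(3 / o.N s) * o.n s := by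
    rw [o.B_sq_eq, n]; have := o.N_pos hl.lt; field_simp; ring
  have h4 : 3 / o.N s ≤ 12 := by rw [div_le_iff₀ (by linarith)]; linarith
  rw [h3, abs_mul, abs_neg, abs_of_pos (by have := o.N_pos hl.lt; positivity)]
  calc 3 / o.N s * |o.n s| ≤ 12 * (1 / 10 ^ 50) := by gcongr
    _ ≤ _ := by norm_num

theorem mul_E_le (hl : o.Late s) (hh : h₁ ≤ h) :
    (1 - 1 / 10 ^ 100) * o.E s * o.S s ≤ 2 * √3 / 3 + 1 / 10 ^ 18 := by
  have h1 := (abs_le.1 (hl.abs_q_sub_le hh)).2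
  have h2 := o.P_le_C₁ hh hl.lt hl.D_le
  have h3 := C₁_div_sq_le hh
  have hE := o.E_pos hl.lt
  have hS := o.S_pos s hl.lt
  have h4 := o.E_eq hl.lt
  have h5 : (C₁ / h) ^ 2 * o.E s ≤ 1 / 10 ^ 100 * o.E s := by gcongr
  have h6 : o.μ s * o.S s = o.q₁ s + o.q₂ s := by unfold μ; field_simp
  have h7 : (1 - 1 / 10 ^ 100) * o.E s ≤ o.μ s := by linarith
  nlinarith

theorem le_E_mul (hl : o.Late s) (hh : h₁ ≤ h) :
    2 * √3 / 3 - 1 / 10 ^ 18 ≤ o.E s * o.S s := by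
  have h1 := (abs_le.1 (hl.abs_q_sub_le hh)).1
  have hS := o.S_pos s hl.lt
  have h4 := o.E_eq hl.lt
  have hP := o.P_pos hl.lt
  have h6 : o.μ s * o.S s = o.q₁ s + o.q₂ s := by unfold μ; field_simp
  nlinarith

theorem E_le_of_D_ge (hl : o.Late s) (hh : h₁ ≤ h) (hD : δ₀ / 2 ≤ o.D s) :
    o.E s ≤ 2 / 3 - δ₀ / 100 := by
  obtain ⟨g1, g2, g3⟩ := sqrt_three_bounds
  have h1 := hl.mul_E_le hh
  have h2 := abs_le.1 (hl.abs_B_sq_sub_le hh)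
  have h3 := o.S_sq_eq hl.lt
  have hS := o.S_pos s hl.lt
  have h4 : √3 + δ₀ / 20 ≤ o.S s := by
    unfold δ₀ at *
    nlinarith
  by_contra! hc
  have h5 : (1 - 1 / 10 ^ 100) * (2 / 3 - δ₀ / 100) * (√3 + δ₀ / 20)
      ≤ (1 - 1 / 10 ^ 100) * o.E s * o.S s := by
    have : 0 ≤ 2 / 3 - δ₀ / 100 := by unfold δ₀; norm_num
    have := o.E_pos hl.lt
    have : (0 : ℝ) ≤ δ₀ := by unfold δ₀; norm_num
    gcongr
  unfold δ₀ at h5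
  nlinarith

theorem E_ge_of_D_le (hl : o.Late s) (hh : h₁ ≤ h) (hD : o.D s ≤ -δ₀ / 2) :
    2 / 3 + δ₀ / 100 ≤ o.E s := by
  obtain ⟨g1, g2, g3⟩ := sqrt_three_bounds
  have h1 := hl.le_E_mul hh
  have h2 := abs_le.1 (hl.abs_B_sq_sub_le hh)
  have h3 := o.S_sq_eq hl.lt
  have hS := o.S_pos s hl.lt
  have hE := o.E_pos hl.lt
  have h4 : o.S s ≤ √3 - δ₀ / 20 := by
    unfold δ₀ at *
    nlinarith
  by_contra! hc
  have h5 : o.E s * o.S s ≤ (2 / 3 + δ₀ / 100) * (√3 - δ₀ / 20) := by gcongr; unfold δ₀; norm_num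
  unfold δ₀ at h5
  nlinarith

theorem abs_E_sub_le (hl : o.Late s) (hh : h₁ ≤ h) (hD : |o.D s| < δ₀) :
    |o.E s - 2 / 3| ≤ δ₀ := by
  obtain ⟨g1, g2, g3⟩ := sqrt_three_bounds
  have h0 := hl.le_E_mul hh
  have h1 := hl.mul_E_le hh
  have h2 := abs_le.1 (hl.abs_B_sq_sub_le hh)
  have h3 := o.S_sq_eq hl.lt
  have hS := o.S_pos s hl.lt
  have hE := o.E_pos hl.lt
  have hD' := abs_lt.1 hD
  have h4 : o.S s ≤ √3 + δ₀ / 2 := by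
    unfold δ₀ at *
    nlinarith
  have h5 : √3 - δ₀ / 2 ≤ o.S s := by
    unfold δ₀ at *
    nlinarith
  have h6 : o.E s * o.S s ≤ o.E s * (√3 + δ₀ / 2) := by gcongr
  have h7 : (1 - 1 / 10 ^ 100) * o.E s * (√3 - δ₀ / 2) ≤ (1 - 1 / 10 ^ 100) * o.E s * o.S s := by
    gcongr
  rw [abs_le]
  unfold δ₀ at *
  constructor
  · by_contra! hc
    have : o.E s * (√3 + 1 / 10 ^ 12 / 2) ≤ (2 / 3 - 1 / 10 ^ 12) * (√3 + 1 / 10 ^ 12 / 2) := by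
      gcongr; linarith
    nlinarith
  · by_contra! hc
    have : (1 - 1 / 10 ^ 100) * (2 / 3 + 1 / 10 ^ 12) * (√3 - 1 / 10 ^ 12 / 2)
        ≤ (1 - 1 / 10 ^ 100) * o.E s * (√3 - 1 / 10 ^ 12 / 2) := by
      gcongr
      · linarith
      · linarith
    nlinarith

end Late

/-- Outside of the band `|D| < δ₀` the flow is that of a saddle in `(n, D)`, and an orbit that
stays bounded cannot leave the band. -/
theorem eventually_abs_D_lt (hh : h₁ ≤ h) : ∀ᶠ s in atTop, o.Late s ∧ |o.D s| < δ₀ := by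
  have hC := C₁_ge
  have hpos := o.h_pos
  have hCh := C₁_div_le hh
  have hC3 : C₁ ^ 3 / h ≤ 1 / 10 ^ 60 := by
    rw [div_le_div_iff₀ hpos (by norm_num)]; linarith [C₁_cube_le hh]
  filter_upwards [eventually_forall_ge_sub (o.eventually_late hh) 2] with s hs
  have hw : ∀ t ∈ Icc (s - 2) (s + 2), o.Late t := fun t ht => hs t ht.1
  refine ⟨hs s (by linarith), abs_lt_of_saddle (n := o.n) (E := o.E) (ν := 6 * C₁ / h)
    (η := δ₀ / 100) (ρ := 8 * C₁ ^ 2) ?_ ?_ ?_ ?_ (by positivity) ?_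
    (fun t ht => o.hasDerivAt_n (hw t ht).lt) (fun t ht => o.hasDerivAt_D' (hw t ht).lt)
    (fun t ht => (hw t ht).n_le) (fun t ht => (o.E_pos (hw t ht).lt).le) ?_ ?_
    (fun t ht => (hw t ht).E_le_of_D_ge hh) (fun t ht => (hw t ht).E_ge_of_D_le hh)⟩
  · unfold δ₀; norm_num
  · unfold δ₀; norm_num
  · unfold δ₀; norm_num
  · rw [mul_div_assoc]
    unfold δ₀; nlinarith
  · have h1 : 4 * (8 * C₁ ^ 2) * (6 * C₁ / h) = 192 * (C₁ ^ 3 / h) := by ring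
    rw [h1]
    unfold δ₀; nlinarith
  · intro t ht hn
    have h1 := o.P_pos (hw t ht).lt
    have h2 := o.N_pos (hw t ht).lt
    exact div_nonpos_of_nonpos_of_nonneg
      (mul_nonpos_of_nonneg_of_nonpos (sq_nonneg _) (by linarith)) h2.le
  · intro t ht hn
    have h1 := o.A_sq_mul_P_div_le hh (hw t ht).lt (hw t ht).D_le
    have h2 := o.N_pos (hw t ht).lt
    rw [mul_sub, sub_div]
    have h3 : 0 ≤ o.A t ^ 2 * (3 * o.n t) / o.N t := by positivity
    linarith

/-- While `|D| < δ₀` the variable `n` changes slowly, so a value of `n` that is not small compared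
to `1 / h` would persist long enough to drive `D` out of the interval. -/
theorem eventually_h_mul_abs_n_le (hh : h₁ ≤ h) :
    ∀ᶠ s in atTop, o.Late s ∧ |o.D s| < δ₀ ∧ h * |o.n s| ≤ 4 * δ₀ := by
  have hpos := o.h_pos
  have hδ : 0 < δ₀ := by unfold δ₀; norm_num
  have hge := h_ge hh
  filter_upwards [eventually_forall_ge_sub (o.eventually_abs_D_lt hh) 0] with s hs0
  have hs : ∀ x ≥ s, o.Late x ∧ |o.D x| < δ₀ := fun x hx => hs0 x (by linarith)
  refine ⟨(hs s le_rfl).1, (hs s le_rfl).2, ?_⟩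
  by_contra! hc
  have hn' : ∀ x ≥ s, |2 / 3 - o.n x - o.E x| ≤ 2 * δ₀ := by
    intro x hx
    have h1 := abs_le.1 ((hs x hx).1.abs_E_sub_le hh (hs x hx).2)
    have h2 := abs_le.1 ((hs x hx).1.abs_n_le hh)
    have h3 : (1 : ℝ) / 10 ^ 50 ≤ δ₀ := by unfold δ₀; norm_num
    rw [abs_le]
    constructor <;> linarith
  set τ := |o.n s| / (4 * δ₀) with hτ
  have hn0 : 0 < |o.n s| := by
    by_contra! h0
    nlinarith
  have hτ0 : 0 < τ := by positivity
  have hτδ : 2 * δ₀ * τ = |o.n s| / 2 := by rw [hτ]; field_simp; norm_num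
  have hbig : δ₀ * (2 * 2) < h ^ 2 * |o.n s| * τ := by
    rw [hτ]
    have : h ^ 2 * |o.n s| * (|o.n s| / (4 * δ₀)) = (h * |o.n s|) ^ 2 / (4 * δ₀) := by ring
    rw [this, lt_div_iff₀ (by positivity)]
    nlinarith
  have hA : ∀ x ≥ s, 9 / 10 * h ^ 2 ≤ o.A x ^ 2 := fun x hx =>
    o.A_sq_ge hh ((hs x hx).1.D_le x le_rfl)
  have hP : ∀ x ≥ s, o.A x ^ 2 * o.P x / o.N x ≤ 1 / 10 * h ^ 2 * |o.n s| := by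
    intro x hx
    obtain ⟨hl, hD⟩ := hs x hx
    have h1 := abs_le.1 (hl.abs_E_sub_le hh hD)
    have h2 := abs_le.1 (hl.abs_B_sq_sub_le hh)
    have h3 := o.S_sq_eq hl.lt
    have hS := o.S_pos x hl.lt
    have hD' := abs_lt.1 hD
    have hδ1 : δ₀ ≤ 1 / 10 := by unfold δ₀; norm_num
    have h4 : o.S x ≤ 2 := by nlinarith
    have h5 := o.t₁_le_div hh hl.lt (hl.D_le x le_rfl) (o.B_le_two hh hl.lt hl.D_le) le_rfl h4
    have h6 := o.P_le_mul_E hl.lt h5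
    have h7 := o.A_sq_le_mul hh hl.lt
    have hPx := o.P_pos hl.lt
    have h8 : o.A x ^ 2 * o.P x ≤ 11 / 10 * h ^ 2 * ((5 * 2 / h) ^ 2 * 1) := by
      gcongr
      refine h6.trans ?_
      gcongr; linarith
    have h9 : 11 / 10 * h ^ 2 * ((5 * 2 / h) ^ 2 * 1) = 110 := by field_simp; norm_num
    have h10 := hl.N_ge hh
    have h11 : 440 ≤ 1 / 10 * h ^ 2 * |o.n s| := by
      have : h * (4 * δ₀) ≤ h * (h * |o.n s|) := by gcongr
      unfold δ₀ at this
      nlinarith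
    rw [div_le_iff₀ (by linarith)]
    nlinarith
  rcases le_or_gt 0 (o.n s) with h0 | h0
  · rw [abs_of_nonneg h0] at *
    have h1 : ∀ x ∈ Icc s (s + τ), o.n s / 2 ≤ o.n x := by
      intro x hx
      have := add_mul_le_of_hasDerivAt (c := -(2 * δ₀)) hx.1
        (fun y hy => o.hasDerivAt_n (hs y hy.1).1.lt) fun y hy => (abs_le.1 (hn' y hy.1.le)).1
      have : 2 * δ₀ * (x - s) ≤ 2 * δ₀ * τ := by gcongr; linarith [hx.2]
      linarith
    have h2 := add_mul_le_of_hasDerivAt (c := h ^ 2 * o.n s) (show s ≤ s + τ by linarith)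
      (fun y hy => o.hasDerivAt_D' (hs y hy.1).1.lt) (fun y hy => by
        have h3 := h1 y ⟨hy.1.le, hy.2.le⟩
        have h4 := hP y hy.1.le
        have h5 := o.N_pos (hs y hy.1.le).1.lt
        have h6 := o.N_lt_one (hs y hy.1.le).1.lt
        have h7 : 9 / 10 * h ^ 2 * (3 * (o.n s / 2)) ≤ o.A y ^ 2 * (3 * o.n y) / o.N y := by
          rw [le_div_iff₀ h5]
          calc _ ≤ 9 / 10 * h ^ 2 * (3 * (o.n s / 2)) * 1 := by gcongr
            _ = 9 / 10 * h ^ 2 * (3 * (o.n s / 2)) := by ring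
            _ ≤ _ := by gcongr; exact hA y hy.1.le
        rw [mul_sub, sub_div]
        have h8 : 0 < h ^ 2 * o.n s := by positivity
        linarith)
    have h3 := abs_lt.1 (hs s le_rfl).2
    have h4 := abs_lt.1 (hs (s + τ) (by linarith)).2
    have h5 : s + τ - s = τ := by ring
    rw [h5] at h2
    linarith
  · rw [abs_of_neg h0] at *
    have h1 : ∀ x ∈ Icc s (s + τ), o.n x ≤ o.n s / 2 := by
      intro x hx
      have := le_add_mul_of_hasDerivAt (c := 2 * δ₀) hx.1
        (fun y hy => o.hasDerivAt_n (hs y hy.1).1.lt) fun y hy => (abs_le.1 (hn' y hy.1.le)).2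
      have : 2 * δ₀ * (x - s) ≤ 2 * δ₀ * τ := by gcongr; linarith [hx.2]
      linarith
    have h2 := le_add_mul_of_hasDerivAt (c := -(h ^ 2 * -o.n s)) (show s ≤ s + τ by linarith)
      (fun y hy => o.hasDerivAt_D' (hs y hy.1).1.lt) (fun y hy => by
        have h3 := h1 y ⟨hy.1.le, hy.2.le⟩
        have h5 := o.N_pos (hs y hy.1.le).1.lt
        have h6 := o.N_lt_one (hs y hy.1.le).1.lt
        have h9 := o.P_pos (hs y hy.1.le).1.lt
        have h8 : 0 < h ^ 2 * -o.n s := by positivity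
        have h7 : 9 / 10 * h ^ 2 * (3 * (-o.n s / 2)) ≤ o.A y ^ 2 * (o.P y - 3 * o.n y) / o.N y := by
          rw [le_div_iff₀ h5]
          calc _ ≤ 9 / 10 * h ^ 2 * (3 * (-o.n s / 2)) * 1 := by gcongr
            _ = 9 / 10 * h ^ 2 * (3 * (-o.n s / 2)) := by ring
            _ ≤ _ := by
              gcongr
              · exact hA y hy.1.le
              · linarith
        have h10 : o.A y ^ 2 * (3 * o.n y - o.P y) / o.N y
            = -(o.A y ^ 2 * (o.P y - 3 * o.n y) / o.N y) := by ring
        rw [h10]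
        linarith)
    have h3 := abs_lt.1 (hs s le_rfl).2
    have h4 := abs_lt.1 (hs (s + τ) (by linarith)).2
    have h5 : s + τ - s = τ := by ring
    rw [h5] at h2
    linarith

end Orbit

/-! ### Decay near a saddle with a strong unstable direction -/

theorem abs_mul_le_of_le {x r z : ℝ} (h : |r| ≤ z) : |x * r| ≤ |x| * z := by
  rw [abs_mul]; gcongr

/-- A bounded orbit of a small perturbation of the linear system `u' = h u`, `v' = -h v`,
`η' = -2 η`, `p' = -4 p` avoids the cone `v² + η² + p² ≤ u²`: the cone is invariant, and `u`
grows exponentially there. -/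
theorem avoids_cone {u v η p u' v' η' p' : ℝ → ℝ} {h s₁ : ℝ} (hh : 100 ≤ h)
    (hu : ∀ s ≥ s₁, HasDerivAt u (u' s) s) (hv : ∀ s ≥ s₁, HasDerivAt v (v' s) s)
    (hη : ∀ s ≥ s₁, HasDerivAt η (η' s) s) (hdp : ∀ s ≥ s₁, HasDerivAt p (p' s) s)
    (hu' : ∀ s ≥ s₁, |u' s - h * u s| ≤ h * (1 / 100 * (|u s| + |v s| + |η s| + p s)))
    (hv' : ∀ s ≥ s₁, |v' s + h * v s| ≤ h * (1 / 100 * (|u s| + |v s| + |η s| + p s)))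
    (hη' : ∀ s ≥ s₁, |η' s + 2 * η s| ≤ 1 / 100 * (|u s| + |v s| + |η s| + p s))
    (hpp : ∀ s ≥ s₁, p' s ≤ -(39 / 10) * p s) (hp0 : ∀ s ≥ s₁, 0 < p s)
    (hb : ∀ s ≥ s₁, |u s| ≤ 1) :
    ∀ s ≥ s₁, u s ^ 2 - v s ^ 2 - η s ^ 2 - p s ^ 2 < 0 := by
  set Φ : ℝ → ℝ := fun s => u s ^ 2 - v s ^ 2 - η s ^ 2 - p s ^ 2 with hΦ
  set Φ' : ℝ → ℝ := fun s => 2 * u s * u' s - 2 * v s * v' s - 2 * η s * η' s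
    - 2 * p s * p' s with hΦ'
  have hdΦ : ∀ s ≥ s₁, HasDerivAt Φ (Φ' s) s := by
    intro s hs
    have := ((((hu s hs).pow 2).sub ((hv s hs).pow 2)).sub ((hη s hs).pow 2)).sub ((hdp s hs).pow 2)
    exact this.congr_deriv (by norm_num [hΦ'])
  -- in the cone, all the variables are bounded by `|u|`
  have hcone : ∀ s ≥ s₁, 0 ≤ Φ s → 0 < |u s| ∧ |v s| ≤ |u s| ∧ |η s| ≤ |u s| ∧ p s ≤ |u s| ∧
      |u' s - h * u s| ≤ h * (1 / 25 * |u s|) ∧ |v' s + h * v s| ≤ h * (1 / 25 * |u s|) ∧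
      |η' s + 2 * η s| ≤ 1 / 25 * |u s| := by
    intro s hs h0
    simp only [hΦ] at h0
    have hps := hp0 s hs
    have h1 : |v s| ≤ |u s| := sq_le_sq.1 (by nlinarith [sq_nonneg (η s)])
    have h2 : |η s| ≤ |u s| := sq_le_sq.1 (by nlinarith [sq_nonneg (v s)])
    have h3 : p s ≤ |u s| := by
      rw [← abs_of_pos hps]
      exact sq_le_sq.1 (by nlinarith [sq_nonneg (v s), sq_nonneg (η s)])
    have h5 : 1 / 100 * (|u s| + |v s| + |η s| + p s) ≤ 1 / 25 * |u s| := by linarith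
    refine ⟨by linarith, h1, h2, h3, (hu' s hs).trans ?_, (hv' s hs).trans ?_,
      (hη' s hs).trans h5⟩ <;> gcongr
  have hgrow : ∀ s ≥ s₁, 0 ≤ Φ s → h * u s ^ 2 ≤ 2 * u s * u' s := by
    intro s hs h0
    obtain ⟨-, -, -, -, h1, -, -⟩ := hcone s hs h0
    have h2 := (abs_le.1 (abs_mul_le_of_le (x := u s) h1)).1
    have h3 : |u s| * (h * (1 / 25 * |u s|)) = h / 25 * u s ^ 2 := by
      rw [← sq_abs (u s)]; ring
    have h4 : 0 ≤ h * u s ^ 2 := by positivity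
    rw [h3] at h2
    linarith
  have hΦpos : ∀ s ≥ s₁, 0 ≤ Φ s → 0 < Φ' s := by
    intro s hs h0
    obtain ⟨h1, h2, h3, h4, h5, h6, h7⟩ := hcone s hs h0
    have e1 := (abs_le.1 (abs_mul_le_of_le (x := u s) h5)).1
    have e2 := (abs_le.1 (abs_mul_le_of_le (x := v s) h6)).2
    have e3 := (abs_le.1 (abs_mul_le_of_le (x := η s) h7)).2
    have e4 : p s * p' s ≤ 0 :=
      mul_nonpos_of_nonneg_of_nonpos (hp0 s hs).le (by linarith [hpp s hs, hp0 s hs])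
    have f1 : |u s| * (h * (1 / 25 * |u s|)) = h / 25 * u s ^ 2 := by
      rw [← sq_abs (u s)]; ring
    have f2 : |v s| * (h * (1 / 25 * |u s|)) ≤ |u s| * (h * (1 / 25 * |u s|)) := by gcongr
    have f3 : |η s| * (1 / 25 * |u s|) ≤ |u s| * (h * (1 / 25 * |u s|)) := by
      calc |η s| * (1 / 25 * |u s|) ≤ |u s| * (1 * (1 / 25 * |u s|)) := by rw [one_mul]; gcongr
        _ ≤ _ := by gcongr; linarith
    have f4 : 0 < h * u s ^ 2 := by
      rw [← sq_abs (u s)]; positivity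
    have f5 : 0 ≤ h * v s ^ 2 := by positivity
    have f6 := sq_nonneg (η s)
    simp only [hΦ']
    nlinarith
  intro s hs
  by_contra! h0
  have hinv : ∀ t ≥ s, 0 ≤ Φ t := fun t ht =>
    (quadrant_invariant (g := fun _ => 1) (g' := fun _ => 0) (fun r hr => hdΦ r (hs.trans hr))
      (fun r _ => hasDerivAt_const r 1) h0 zero_le_one
      (fun r hr _ hr0 => hΦpos r (hs.trans hr) hr0.ge) (fun r _ _ h1 => absurd h1 one_ne_zero)
      t ht).1
  have hus : 0 < u s ^ 2 := by
    have := (hcone s hs h0).1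
    rw [← sq_abs]; positivity
  have hmono : ∀ t ≥ s, u s ^ 2 ≤ u t ^ 2 := fun t ht =>
    le_of_hasDerivAt_nonneg (f := fun r => u r ^ 2) (f' := fun r => 2 * u r * u' r) ht
      (fun r hr => ((hu r (hs.trans hr.1)).pow 2).congr_deriv (by norm_num))
      (fun r hr => by
        have := hgrow r (hs.trans hr.1.le) (hinv r hr.1.le)
        have : 0 ≤ h * u r ^ 2 := by positivity
        linarith)
  set t := s + 1 / (h * u s ^ 2) with ht
  have hst : s ≤ t := by
    have : 0 ≤ 1 / (h * u s ^ 2) := by positivity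
    linarith
  have h1 := add_mul_le_of_hasDerivAt (f := fun r => u r ^ 2) (f' := fun r => 2 * u r * u' r)
    (c := h * u s ^ 2) hst
    (fun r hr => ((hu r (hs.trans hr.1)).pow 2).congr_deriv (by norm_num))
    (fun r hr => by
      have h2 := hgrow r (hs.trans hr.1.le) (hinv r hr.1.le)
      have h3 := hmono r hr.1.le
      have h4 : h * u s ^ 2 ≤ h * u r ^ 2 := by gcongr
      linarith)
  have h2 : h * u s ^ 2 * (t - s) = 1 := by
    rw [ht, add_sub_cancel_left]
    exact mul_one_div_cancel (mul_pos (by linarith) hus).ne'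
  have h3 := hb t (hs.trans hst)
  have h4 : u t ^ 2 ≤ 1 := by rw [← sq_abs]; nlinarith [abs_nonneg (u t)]
  linarith

/-- Consider a perturbation, small compared to `W = |u| + |v| + |η|` and `q`, of the linear system
`u' = h u`, `v' = -h v`, `η' = -2 η` with large `h`. With a large multiple `p` of `q` the orbit
avoids the cone `v² + η² + p² ≤ u²`, and outside of the cone `v² / h + η² + p²` decays. -/
theorem saddle_decay {u v η q u' v' η' q' : ℝ → ℝ} {h K s₁ : ℝ} (hh : 100 ≤ h) (hK : 1 ≤ K)
    (hu : ∀ s ≥ s₁, HasDerivAt u (u' s) s) (hv : ∀ s ≥ s₁, HasDerivAt v (v' s) s)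
    (hη : ∀ s ≥ s₁, HasDerivAt η (η' s) s) (hq : ∀ s ≥ s₁, HasDerivAt q (q' s) s)
    (hu' : ∀ s ≥ s₁, |u' s - h * u s| ≤ h * (K * ((|u s| + |v s| + |η s|) ^ 2 + q s)))
    (hv' : ∀ s ≥ s₁, |v' s + h * v s| ≤ h * (K * ((|u s| + |v s| + |η s|) ^ 2 + q s)))
    (hη' : ∀ s ≥ s₁, |η' s + 2 * η s| ≤ K * ((|u s| + |v s| + |η s|) ^ 2 + q s))
    (hq' : ∀ s ≥ s₁, q' s ≤ -(39 / 10) * q s) (hq0 : ∀ s ≥ s₁, 0 < q s)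
    (hW : ∀ s ≥ s₁, K * (|u s| + |v s| + |η s|) ≤ 1 / 100) :
    ∃ c, ∀ s ≥ s₁, (|u s| + |v s| + |η s|) ^ 2 + q s ≤ c * Real.exp (-(7 / 2) * s) := by
  set p : ℝ → ℝ := fun s => 100 * K * q s with hp
  have hp0 : ∀ s ≥ s₁, 0 < p s := fun s hs => by have := hq0 s hs; positivity
  -- the remainders are small compared to the sum of the absolute values
  have hsmall : ∀ s ≥ s₁, K * ((|u s| + |v s| + |η s|) ^ 2 + q s)
      ≤ 1 / 100 * (|u s| + |v s| + |η s| + p s) := by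
    intro s hs
    have h1 := hW s hs
    have h2 : 0 ≤ |u s| + |v s| + |η s| := by positivity
    simp only [hp]
    nlinarith
  have hdp : ∀ s ≥ s₁, HasDerivAt p (100 * K * q' s) s := fun s hs => (hq s hs).const_mul _
  have hpp : ∀ s ≥ s₁, 100 * K * q' s ≤ -(39 / 10) * p s := fun s hs => by
    have := mul_le_mul_of_nonneg_left (hq' s hs) (show 0 ≤ 100 * K by positivity)
    simp only [hp]
    linarith
  have hneg := avoids_cone hh hu hv hη hdp (fun s hs => (hu' s hs).trans (by
      have := hsmall s hs; gcongr)) (fun s hs => (hv' s hs).trans (by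
      have := hsmall s hs; gcongr)) (fun s hs => (hη' s hs).trans (hsmall s hs)) hpp hp0
    (fun s hs => by
      have h4 := hW s hs
      nlinarith [abs_nonneg (u s), abs_nonneg (v s), abs_nonneg (η s)])
  set Ψ : ℝ → ℝ := fun s => v s ^ 2 / h + η s ^ 2 + p s ^ 2 with hΨ
  have hdΨ : ∀ s ≥ s₁, HasDerivAt Ψ (2 * v s * v' s / h + 2 * η s * η' s
      + 2 * p s * (100 * K * q' s)) s := by
    intro s hs
    have := ((((hv s hs).pow 2).div_const h).add ((hη s hs).pow 2)).add ((hdp s hs).pow 2)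
    exact this.congr_deriv (by norm_num)
  have hΨ' : ∀ s ≥ s₁, 2 * v s * v' s / h + 2 * η s * η' s + 2 * p s * (100 * K * q' s)
      ≤ -(7 / 2) * Ψ s := by
    intro s hs
    have h0 := hneg s hs
    have hps := hp0 s hs
    have a1 := abs_nonneg (v s)
    have a2 := abs_nonneg (η s)
    have h1 : |u s| ≤ |v s| + |η s| + p s := by
      apply abs_le_of_sq_le_sq _ (by positivity)
      rw [← sq_abs (v s), ← sq_abs (η s)] at h0
      nlinarith [mul_nonneg a1 a2, mul_nonneg a1 hps.le, mul_nonneg a2 hps.le]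
    have h2 := hsmall s hs
    have h3 : K * ((|u s| + |v s| + |η s|) ^ 2 + q s) ≤ 1 / 50 * (|v s| + |η s| + p s) := by
      linarith
    have h4 : |v' s + h * v s| ≤ h * (1 / 50 * (|v s| + |η s| + p s)) :=
      (hv' s hs).trans (by gcongr)
    have h5 := (hη' s hs).trans h3
    have e2 := (abs_le.1 (abs_mul_le_of_le (x := v s) h4)).2
    have e3 := (abs_le.1 (abs_mul_le_of_le (x := η s) h5)).2
    have e4 := mul_le_mul_of_nonneg_left (hpp s hs) hps.le
    have e5 : v s * v' s / h ≤ -v s ^ 2 + |v s| * (1 / 50 * (|v s| + |η s| + p s)) := by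
      rw [div_le_iff₀ (by linarith)]
      linarith
    have e6 : v s ^ 2 / h ≤ v s ^ 2 / 100 := by gcongr
    have hv2 := sq_abs (v s)
    have hη2 := sq_abs (η s)
    have e7 : 2 * v s * v' s / h = 2 * (v s * v' s / h) := by ring
    simp only [hΨ]
    rw [e7]
    nlinarith [sq_nonneg (|v s| - |η s|), sq_nonneg (|v s| - p s), sq_nonneg (|η s| - p s)]
  set c := Ψ s₁ * Real.exp (7 / 2 * s₁) with hc
  have hexp : ∀ s x : ℝ, x * Real.exp (-(7 / 2) * (s - s₁))
      = x * Real.exp (7 / 2 * s₁) * Real.exp (-(7 / 2) * s) := by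
    intro s x
    rw [mul_assoc, ← Real.exp_add]; ring_nf
  refine ⟨8 * h * c + q s₁ * Real.exp (7 / 2 * s₁), fun s hs => ?_⟩
  have h1 := le_mul_exp_of_hasDerivAt (k := 7 / 2) hs (fun r hr => hdΨ r hr.1)
    (fun r hr => hΨ' r hr.1.le)
  have h2 := le_mul_exp_of_hasDerivAt (k := 7 / 2) hs (fun r hr => hq r hr.1)
    (fun r hr => by linarith [hq' r hr.1.le, hq0 r hr.1.le])
  rw [hexp, ← hc] at h1
  rw [hexp] at h2
  have h0 := hneg s hs
  have h3 : v s ^ 2 + η s ^ 2 + p s ^ 2 ≤ h * Ψ s := by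
    have e1 : h * (v s ^ 2 / h) = v s ^ 2 := by field_simp
    simp only [hΨ]
    rw [mul_add, mul_add, e1]
    nlinarith [sq_nonneg (η s), sq_nonneg (p s)]
  have h4 : (|u s| + |v s| + |η s|) ^ 2 ≤ 3 * (u s ^ 2 + v s ^ 2 + η s ^ 2) := by
    rw [← sq_abs (u s), ← sq_abs (v s), ← sq_abs (η s)]
    nlinarith [sq_nonneg (|u s| - |v s|), sq_nonneg (|u s| - |η s|), sq_nonneg (|v s| - |η s|)]
  have h5 : h * Ψ s ≤ h * (c * Real.exp (-(7 / 2) * s)) := by gcongr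
  have h6 : 0 ≤ c * Real.exp (-(7 / 2) * s) := by
    refine le_trans ?_ h1
    simp only [hΨ]; positivity
  nlinarith [sq_nonneg (p s)]

theorem tendsto_exp_neg_const_mul {k : ℝ} (hk : 0 < k) (c : ℝ) :
    Tendsto (fun s => c * Real.exp (-k * s)) atTop (𝓝 0) := by
  simpa using tendsto_mul_exp_neg c 0 hk

/-- Quadratically small perturbations of `u' = h u`, `v' = -h v`, `η' = -2 η` that decay faster
than `e^{-2s}` do not change the rate of the bounded solutions: only `η` contributes to the order
`e^{-2s}`. -/
theorem saddle_limits {u v η u' v' η' r : ℝ → ℝ} {h c s₁ : ℝ} (hh : 100 ≤ h)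
    (hu : ∀ s ≥ s₁, HasDerivAt u (u' s) s) (hv : ∀ s ≥ s₁, HasDerivAt v (v' s) s)
    (hη : ∀ s ≥ s₁, HasDerivAt η (η' s) s)
    (hu' : ∀ s ≥ s₁, |u' s - h * u s| ≤ r s) (hv' : ∀ s ≥ s₁, |v' s + h * v s| ≤ r s)
    (hη' : ∀ s ≥ s₁, |η' s + 2 * η s| ≤ r s)
    (hr : ∀ s ≥ s₁, r s ≤ c * Real.exp (-(7 / 2) * s)) (hb : ∀ s ≥ s₁, |u s| ≤ 1) :
    Tendsto (fun s => u s * Real.exp (2 * s)) atTop (𝓝 0) ∧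
    Tendsto (fun s => v s * Real.exp (2 * s)) atTop (𝓝 0) ∧
    ∃ b, Tendsto (fun s => η s * Real.exp (2 * s)) atTop (𝓝 b) := by
  have hexp : ∀ s, HasDerivAt (fun s => Real.exp (2 * s)) (Real.exp (2 * s) * (2 * 1)) s :=
    fun s => ((hasDerivAt_id s).const_mul 2).exp
  have hbd : ∀ x : ℝ, ∀ s ≥ s₁, |x| ≤ r s →
      |x * Real.exp (2 * s)| ≤ c * Real.exp (-(3 / 2) * s) := by
    intro x s hs hx
    rw [abs_mul, abs_of_pos (Real.exp_pos _)]
    calc |x| * Real.exp (2 * s) ≤ c * Real.exp (-(7 / 2) * s) * Real.exp (2 * s) := by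
          gcongr; exact hx.trans (hr s hs)
      _ = c * Real.exp (-(3 / 2) * s) := by
          rw [mul_assoc, ← Real.exp_add]; ring_nf
  have hlim := tendsto_exp_neg_const_mul (show (0 : ℝ) < 3 / 2 by norm_num) c
  have hz : ∀ g : ℝ → ℝ, (∀ s ≥ s₁, |g s| ≤ r s) →
      Tendsto (fun s => g s * Real.exp (2 * s)) atTop (𝓝 0) := by
    intro g hg
    refine squeeze_zero_norm' ?_ hlim
    filter_upwards [eventually_ge_atTop s₁] with s hs using hbd _ s hs (hg s hs)
  refine ⟨?_, ?_, ?_⟩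
  · refine tendsto_zero_of_unstable (k := h + 2) (s₁ := s₁) (by linarith) (fun s hs => ?_)
      (hz (fun s => u' s - h * u s) hu') ?_
    · exact ((hu s hs).mul (hexp s)).congr_deriv (by ring)
    · refine squeeze_zero_norm' ?_ (tendsto_exp_neg_const_mul (show 0 < h by linarith) 1)
      filter_upwards [eventually_ge_atTop s₁] with s hs
      rw [Real.norm_eq_abs, mul_assoc, ← Real.exp_add, abs_mul, abs_of_pos (Real.exp_pos _),
        show 2 * s + -(h + 2) * s = -h * s by ring]
      gcongr
      exact hb s hs
  · refine tendsto_zero_of_stable (k := h - 2) (s₁ := s₁) (by linarith) (fun s hs => ?_)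
      (hz (fun s => v' s + h * v s) hv')
    exact ((hv s hs).mul (hexp s)).congr_deriv (by ring)
  · refine exists_tendsto_of_deriv_exp (k := 3 / 2) (C := c) (s₁ := s₁) (by norm_num)
      (g' := fun s => (η' s + 2 * η s) * Real.exp (2 * s)) (fun s hs => ?_)
      (fun s hs => hbd _ s hs (hη' s hs))
    exact ((hη s hs).mul (hexp s)).congr_deriv (by ring)

namespace Orbit

variable {h s₀ : ℝ} (o : Orbit h s₀) {s : ℝ}

/-! ### Linearisation at the fixed point -/

/-- The algebra behind the linearisation of `E`, where `β = 1 / B - 1 / √3`, `σ = S - √3`,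
`q = q₁`, and `T` and `e` are of second order. -/
theorem n_remainder_aux {n D ζ q T β σ e S E w : ℝ} (hw : w ≤ 1 / 100)
    (hD : |D| ≤ w) (hn : |n| ≤ w) (hζ : |ζ| ≤ w) (hσ : σ = S - √3) (hS : 1.7 ≤ S)
    (hβ : 1 / 2 + √3 / 3 ≤ β + 2 * √3 / 3) (eβ : β ^ 2 + 2 * √3 / 3 * β = n)
    (eσ : σ ^ 2 + 2 * √3 * σ = D - 9 * n + e)
    (hES : E * S = ζ + 2 * √3 / 3 - 4 * β + 2 * q + T)
    (hT0 : 0 ≤ T) (hT : T ≤ q + w ^ 2) (he0 : 0 ≤ e) (he : e ≤ 36 * w ^ 2) :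
    |2 / 3 - n - E - (D / 9 - ζ * √3 / 3)| ≤ 25 * w ^ 2 + 3 * q := by
  obtain ⟨g1, g2, g3⟩ := sqrt_three_bounds
  have hw0 : 0 ≤ w := (abs_nonneg _).trans hD
  set r := √3
  have hr : 0 < r := by linarith
  have bβ : β ^ 2 ≤ w ^ 2 := by
    have h2 : β * (β + 2 * r / 3) = n := by rw [← eβ]; ring
    have h3 : |β| ≤ |n| := by
      rw [← h2, abs_mul]
      refine le_mul_of_one_le_right (abs_nonneg _) ((le_abs_self _).trans' ?_)
      linarith
    rw [← sq_abs]
    have := h3.trans hn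
    gcongr
  have hD' := abs_le.1 hD
  have hn' := abs_le.1 hn
  have hζ' := abs_le.1 hζ
  have bσ : |σ| ≤ 4 * w := by
    have h2 : σ * (S + r) = D - 9 * n + e := by rw [← eσ, hσ]; ring
    have h3 : |σ| * (S + r) ≤ 10 * w + 36 * w ^ 2 := by
      rw [← abs_of_pos (show 0 < S + r by linarith), ← abs_mul, h2, abs_le]
      constructor <;> linarith [sq_nonneg w]
    nlinarith [abs_nonneg σ]
  have bσ2 : σ ^ 2 ≤ 16 * w ^ 2 := by
    rw [← sq_abs]
    calc |σ| ^ 2 ≤ (4 * w) ^ 2 := by gcongr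
      _ = _ := by ring
  have bL : |ζ - r * n - D * r / 9| ≤ 3 * w := by
    have h1 : |r * n| ≤ 1.74 * w := by
      rw [abs_mul, abs_of_pos hr]; gcongr; linarith
    have h2 : |D * r / 9| ≤ w * (1.74 / 9) := by
      rw [mul_div_assoc, abs_mul, abs_of_pos (by linarith : 0 < r / 9)]; gcongr; linarith
    have h3 := abs_le.1 h1
    have h4 := abs_le.1 h2
    rw [abs_le]
    constructor <;> linarith
  have bσL : |σ * (ζ - r * n - D * r / 9) * (r / 3)| ≤ 7 * w ^ 2 := by
    rw [abs_mul, abs_mul, abs_of_pos (by linarith : 0 < r / 3)]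
    calc _ ≤ 4 * w * (3 * w) * (1.74 / 3) := by gcongr; linarith
      _ ≤ _ := by nlinarith [sq_nonneg w]
  have key : S * (2 / 3 - n - E - (D / 9 - ζ * r / 3))
      = -2 * (r * β ^ 2) + r / 9 * (e - σ ^ 2) + σ * (ζ - r * n - D * r / 9) * (r / 3)
        - 2 * q - T := by
    have hSr : S = r + σ := by rw [hσ]; ring
    rw [hSr] at hES ⊢
    linear_combination (-1 : ℝ) * hES + 2 * r * eβ + r / 9 * eσ
      + (n * σ / 3 + D * σ / 27 + ζ / 3 - 4 / 3 * β - 2 / 9 * σ) * g3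
  have hr1 : r * β ^ 2 ≤ 1.74 * w ^ 2 := by gcongr; linarith
  have hr2 : 0 ≤ r * β ^ 2 := by positivity
  have hr3 : r / 9 * (e - σ ^ 2) ≤ 7 * w ^ 2 := by
    calc r / 9 * (e - σ ^ 2) ≤ r / 9 * (36 * w ^ 2) := by
          gcongr; linarith [sq_nonneg σ]
      _ ≤ 1.74 / 9 * (36 * w ^ 2) := by gcongr; linarith
      _ ≤ _ := by linarith [sq_nonneg w]
  have hr4 : r / 9 * (σ ^ 2 - e) ≤ 4 * w ^ 2 := by
    calc r / 9 * (σ ^ 2 - e) ≤ r / 9 * (16 * w ^ 2) := by gcongr; linarith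
      _ ≤ 1.74 / 9 * (16 * w ^ 2) := by gcongr; linarith
      _ ≤ _ := by linarith [sq_nonneg w]
  have h8 := abs_le.1 bσL
  have hfin : |S * (2 / 3 - n - E - (D / 9 - ζ * r / 3))| ≤ 25 * w ^ 2 + 3 * q := by
    rw [key, abs_le]
    constructor <;> linarith [sq_nonneg w]
  rw [abs_mul, abs_of_pos (by linarith)] at hfin
  exact (le_mul_of_one_le_left (abs_nonneg _) (by linarith)).trans hfin

/-- The orbit is in the neighbourhood of the fixed point in which the linearisation is used. -/
structure Settled (s : ℝ) : Prop where
  late : o.Late s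
  D_lt : |o.D s| < δ₀
  n_le : h * |o.n s| ≤ 4 * δ₀

namespace Settled

variable {o}

theorem B_bounds (hl : o.Settled s) (hh : h₁ ≤ h) : 1 ≤ o.B s ∧ o.B s ≤ 2 :=
  ⟨(o.one_lt_B hl.late.lt).le, o.B_le_two hh hl.late.lt hl.late.D_le⟩

theorem S_bounds (hl : o.Settled s) (hh : h₁ ≤ h) : 1.7 ≤ o.S s ∧ o.S s ≤ 2 := by
  have h2 := abs_le.1 (hl.late.abs_B_sq_sub_le hh)
  have h3 := o.S_sq_eq hl.late.lt
  have hS := o.S_pos s hl.late.lt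
  have hD := abs_lt.1 hl.D_lt
  unfold δ₀ at hD
  constructor <;> nlinarith

theorem abs_t₂_le (hl : o.Settled s) (hh : h₁ ≤ h) : |o.t₂ s| ≤ |o.D s| / h := by
  have hs := hl.late.lt
  have hpos := o.h_pos
  have hA := o.A_pos s hs
  have hS := o.S_pos s hs
  have h1 := o.t₂_mul hs
  have h2 : h ≤ o.A s * o.S s + o.B s * h := by nlinarith [(hl.B_bounds hh).1, mul_pos hA hS]
  rw [le_div_iff₀ hpos, ← h1, abs_mul, abs_of_pos (by linarith : 0 < o.A s * o.S s + o.B s * h)]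
  gcongr

theorem q₂_le (hl : o.Settled s) (hh : h₁ ≤ h) : o.q₂ s ≤ 2 := by
  have h1 := (abs_le.1 (hl.late.abs_q_sub_le hh)).2
  have h2 := o.q₁_pos s hl.late.lt
  have h3 := sqrt_three_bounds.2.1
  linarith

theorem flux_le (hl : o.Settled s) (hh : h₁ ≤ h) :
    o.q₁ s * o.t₁ s ^ 2 + o.q₂ s * o.t₂ s ^ 2 ≤ (100 * o.q₁ s + 2 * o.D s ^ 2) / h ^ 2 := by
  have hs := hl.late.lt
  have hpos := o.h_pos
  have h1 := o.t₁_le_div hh hs (hl.late.D_le s le_rfl) (hl.B_bounds hh).2 le_rfl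
    (hl.S_bounds hh).2
  have h2 := hl.abs_t₂_le hh
  have h3 := hl.q₂_le hh
  have hq1 := o.q₁_pos s hs; have hq2 := o.q₂_pos s hs
  have ht1 := o.t₁_pos hs
  have h4 : o.t₂ s ^ 2 ≤ (|o.D s| / h) ^ 2 := by rw [← sq_abs (o.t₂ s)]; gcongr
  rw [div_pow, sq_abs] at h4
  calc _ ≤ o.q₁ s * (5 * 2 / h) ^ 2 + 2 * (o.D s ^ 2 / h ^ 2) := by gcongr
    _ = _ := by ring

theorem P_le (hl : o.Settled s) (hh : h₁ ≤ h) :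
    o.P s ≤ (100 * o.q₁ s + 2 * o.D s ^ 2) / h ^ 2 := by
  have hS := hl.S_bounds hh
  have hq1 := o.q₁_pos s hl.late.lt; have hq2 := o.q₂_pos s hl.late.lt
  refine le_trans ?_ (hl.flux_le hh)
  unfold P
  exact div_le_self (by positivity) (by linarith)

theorem div_h_sq_le (hl : o.Settled s) (hh : h₁ ≤ h) {w : ℝ} (hD : |o.D s| ≤ w) :
    (100 * o.q₁ s + 2 * o.D s ^ 2) / h ^ 2 ≤ o.q₁ s + w ^ 2 := by
  have hge := h_ge hh
  have h1 : o.D s ^ 2 ≤ w ^ 2 := by rw [← sq_abs (o.D s)]; gcongr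
  have h2 : 100 ≤ h ^ 2 := by nlinarith
  have hq1 := o.q₁_pos s hl.late.lt
  rw [div_le_iff₀ (by linarith)]
  nlinarith [sq_nonneg w]

theorem D_remainder (hl : o.Settled s) (hh : h₁ ≤ h) {w : ℝ} (hD : |o.D s| ≤ w)
    (hn : h * |o.n s| ≤ w) :
    |o.A s ^ 2 * (3 * o.n s - o.P s) / o.N s - 9 * h ^ 2 * o.n s| ≤ 60 * w ^ 2 + 440 * o.q₁ s := by
  have hs := hl.late.lt
  have hge := h_ge hh
  have hpos := o.h_pos
  have hN := hl.late.N_ge hh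
  have hNp := o.N_pos hs
  have hq1 := o.q₁_pos s hs
  have hw : 0 ≤ w := (abs_nonneg _).trans hD
  have hA2 : o.A s ^ 2 = h ^ 2 - o.D s := by unfold D; ring
  have e1 : o.A s ^ 2 * (3 * o.n s - o.P s) / o.N s - 9 * h ^ 2 * o.n s
      = (-(3 * (o.D s * o.n s)) - 9 * (h * o.n s) ^ 2 - o.A s ^ 2 * o.P s) / o.N s := by
    have h1 : o.N s = 1 / 3 + o.n s := by unfold n; ring
    rw [eq_div_iff hNp.ne', sub_mul, div_mul_cancel₀ _ hNp.ne', hA2, h1]; ring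
  have h1 : |o.D s * o.n s| ≤ w ^ 2 := by
    rw [abs_mul, sq]
    have : |o.n s| ≤ w := by nlinarith [abs_nonneg (o.n s)]
    gcongr
  have h2 : (h * o.n s) ^ 2 ≤ w ^ 2 := by
    rw [← sq_abs, abs_mul, abs_of_pos hpos]; gcongr
  have h3 : o.A s ^ 2 * o.P s ≤ 110 * o.q₁ s + 22 / 10 * w ^ 2 := by
    have g1 := hl.P_le hh
    have g2 := o.A_sq_le_mul hh hs
    have g3 := o.P_pos hs
    have g4 : o.D s ^ 2 ≤ w ^ 2 := by rw [← sq_abs (o.D s)]; gcongr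
    calc o.A s ^ 2 * o.P s ≤ 11 / 10 * h ^ 2 * ((100 * o.q₁ s + 2 * o.D s ^ 2) / h ^ 2) := by
          gcongr
      _ = 110 * o.q₁ s + 22 / 10 * o.D s ^ 2 := by field_simp; ring
      _ ≤ _ := by gcongr
  have h4 : 0 ≤ o.A s ^ 2 * o.P s := mul_nonneg (sq_nonneg _) (o.P_pos hs).le
  have h5 := abs_le.1 h1
  have h6 := sq_nonneg (h * o.n s)
  have h7 : 3 * w ^ 2 + 9 * w ^ 2 + (110 * o.q₁ s + 22 / 10 * w ^ 2)
      ≤ (60 * w ^ 2 + 440 * o.q₁ s) * o.N s := by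
    calc _ ≤ (60 * w ^ 2 + 440 * o.q₁ s) * (1 / 4) := by nlinarith [sq_nonneg w]
      _ ≤ _ := by gcongr
  rw [e1, abs_div, abs_of_pos hNp, div_le_iff₀ hNp, abs_le]
  constructor <;> linarith

theorem ζ_remainder (hl : o.Settled s) (hh : h₁ ≤ h) {w : ℝ} (hD : |o.D s| ≤ w)
    (hn : |o.n s| ≤ w) :
    |2 * (o.B s - √3) ^ 2 / o.B s
      - 2 * o.B s * (o.E s - (o.q₁ s * o.c₁ s + o.q₂ s * o.c₂ s) / o.S s)|
      ≤ 80 * w ^ 2 + 4 * o.q₁ s := by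
  have hs := hl.late.lt
  have hq1 := o.q₁_pos s hs
  obtain ⟨hB1, hB2⟩ := hl.B_bounds hh
  have h1 := o.sq_div_B_le hs (hl.late.N_ge hh)
  have h2 : 0 ≤ 2 * (o.B s - √3) ^ 2 / o.B s := by positivity
  have h3 : o.n s ^ 2 ≤ w ^ 2 := by rw [← sq_abs (o.n s)]; gcongr
  have h4 := o.φ_error_nonneg hs
  have h5 := ((o.φ_error_le hs).trans (hl.P_le hh)).trans (hl.div_h_sq_le hh hD)
  set e := o.E s - (o.q₁ s * o.c₁ s + o.q₂ s * o.c₂ s) / o.S s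
  have h6 : 2 * o.B s * e ≤ 2 * 2 * (o.q₁ s + w ^ 2) := by gcongr
  have h7 : 0 ≤ 2 * o.B s * e := by positivity
  rw [abs_le]
  constructor <;> nlinarith [sq_nonneg w]

/-- The linearisation of `N' = 1 - N - E` with respect to `D` and `ζ`; the coefficient of `n`
vanishes. -/
theorem n_remainder (hl : o.Settled s) (hh : h₁ ≤ h) {w : ℝ} (hw : w ≤ 1 / 100)
    (hD : |o.D s| ≤ w) (hn : |o.n s| ≤ w) (hζ : |o.ζ s| ≤ w) :
    |2 / 3 - o.n s - o.E s - (o.D s / 9 - o.ζ s * √3 / 3)| ≤ 25 * w ^ 2 + 3 * o.q₁ s := by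
  have hs := hl.late.lt
  have hq1 := o.q₁_pos s hs
  have hq2 := o.q₂_pos s hs
  have hN := hl.late.N_ge hh
  have hNp := o.N_pos hs
  obtain ⟨hB1, hB2⟩ := hl.B_bounds hh
  obtain ⟨hS1, hS2⟩ := hl.S_bounds hh
  obtain ⟨-, -, g3⟩ := sqrt_three_bounds
  have hNn : o.N s = 1 / 3 + o.n s := by rw [n]; ring
  have heN : 9 * o.n s ^ 2 / o.N s * o.N s = 9 * o.n s ^ 2 := by field_simp
  have n2 : o.n s ^ 2 ≤ w ^ 2 := by rw [← sq_abs (o.n s)]; gcongr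
  refine n_remainder_aux (β := 1 / o.B s - √3 / 3) (σ := o.S s - √3)
    (e := 9 * o.n s ^ 2 / o.N s) (T := o.q₁ s * o.t₁ s ^ 2 + o.q₂ s * o.t₂ s ^ 2) (S := o.S s)
    hw hD hn hζ rfl hS1 ?_ ?_ ?_ ?_ (by positivity)
    ((hl.flux_le hh).trans (hl.div_h_sq_le hh hD)) (by positivity) ?_
  · have h1 : 1 / 2 ≤ 1 / o.B s := by gcongr
    linarith
  · have h1 : (1 / o.B s) ^ 2 = 1 / 3 + o.n s := by rw [← hNn, N, div_pow, one_pow, one_div]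
    linear_combination h1 - 1 / 9 * g3
  · have h1 : o.S s ^ 2 = o.D s + 1 / o.N s := by rw [o.S_sq_eq hs, o.B_sq_eq]
    have h2 : 1 / o.N s = 3 - 9 * o.n s + 9 * o.n s ^ 2 / o.N s := by
      rw [div_eq_iff hNp.ne', add_mul, heN, hNn]; ring
    linear_combination h1 + h2 - g3
  · have h1 := o.q_add_eq s
    have h2 : o.E s * o.S s
        = o.q₁ s + o.q₂ s + (o.q₁ s * o.t₁ s ^ 2 + o.q₂ s * o.t₂ s ^ 2) := by
      unfold E; rw [div_mul_cancel₀ _ (by linarith), o.c₁_sq hs, o.c₂_sq hs]; ring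
    rw [h2, h1]; ring
  · rw [div_le_iff₀ hNp]; nlinarith [sq_nonneg w]

theorem b₁_ge (hl : o.Settled s) (hh : h₁ ≤ h) : 95 / 100 ≤ o.b₁ s := by
  have hs := hl.late.lt
  have h1 := abs_le.1 (hl.late.abs_B_sq_sub_le hh)
  have h2 := o.S_sq_eq hs
  have h3 := o.one_le_c₁ hs
  obtain ⟨hB1, hB2⟩ := hl.B_bounds hh
  obtain ⟨hS1, hS2⟩ := hl.S_bounds hh
  have hD := abs_lt.1 hl.D_lt
  unfold δ₀ at hD
  have h4 : 95 / 100 * o.S s ≤ o.B s := by nlinarith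
  unfold b₁
  rw [le_div_iff₀ (by linarith)]
  nlinarith

end Settled

end Orbit

theorem tendsto_zero_of_mul_exp {f : ℝ → ℝ} {b : ℝ}
    (hf : Tendsto (fun s => f s * Real.exp (2 * s)) atTop (𝓝 b)) : Tendsto f atTop (𝓝 0) := by
  have h1 := hf.mul (tendsto_exp_neg_const_mul two_pos 1)
  rw [mul_zero] at h1
  refine h1.congr fun s => ?_
  rw [one_mul, mul_assoc, ← Real.exp_add]
  simp

namespace Orbit

variable {h s₀ : ℝ} (o : Orbit h s₀) {s : ℝ}

/-- The factor that makes `η = k ζ` decouple from the hyperbolic directions. -/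
def kη (h : ℝ) : ℝ := √3 / 2 / (1 - 4 * h⁻¹ ^ 2)

theorem kη_spec (hh : h₁ ≤ h) :
    kη h - 4 * kη h * h⁻¹ ^ 2 = √3 / 2 ∧ 8 / 10 ≤ kη h ∧ kη h ≤ 9 / 10 := by
  obtain ⟨g1, g2, g3⟩ := sqrt_three_bounds
  have hge := h_ge hh
  have h1 : h⁻¹ ≤ 1 / 100 := by
    rw [inv_le_comm₀ (by linarith) (by norm_num)]; linarith
  have h2 : 0 < h⁻¹ := by rw [inv_pos]; linarith
  have h3 : 0 < 1 - 4 * h⁻¹ ^ 2 := by nlinarith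
  have h4 : kη h * (1 - 4 * h⁻¹ ^ 2) = √3 / 2 := by
    unfold kη; exact div_mul_cancel₀ _ h3.ne'
  refine ⟨by linarith, ?_, ?_⟩
  · unfold kη; rw [le_div_iff₀ h3]; nlinarith
  · unfold kη; rw [div_le_iff₀ h3]; nlinarith

/-- The coordinate along the slowly decaying direction of the linearised system. -/
def η (s : ℝ) : ℝ := kη h * o.ζ s

/-- The coordinate along the unstable direction of the linearised system. -/
def u (s : ℝ) : ℝ := o.D s - 6 * o.η s + (9 * h * o.n s + 12 * o.η s * h⁻¹)

/-- The coordinate along the rapidly contracted direction of the linearised system. -/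
def v (s : ℝ) : ℝ := o.D s - 6 * o.η s - (9 * h * o.n s + 12 * o.η s * h⁻¹)

/-- The distance from the fixed point in the coordinates that diagonalise the linearised system. -/
def W (s : ℝ) : ℝ := |o.u s| + |o.v s| + |o.η s|

/-- The time derivative of `D`. -/
def D' (s : ℝ) : ℝ := o.A s ^ 2 * (3 * o.n s - o.P s) / o.N s

/-- The time derivative of `n`. -/
def n' (s : ℝ) : ℝ := 2 / 3 - o.n s - o.E s

/-- The time derivative of `ζ`. -/
def ζ' (s : ℝ) : ℝ := -2 * o.ζ s + (2 * (o.B s - √3) ^ 2 / o.B s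
  - 2 * o.B s * (o.E s - (o.q₁ s * o.c₁ s + o.q₂ s * o.c₂ s) / o.S s))

/-- The time derivative of `u`. -/
def u' (s : ℝ) : ℝ :=
  o.D' s - 6 * (kη h * o.ζ' s) + (9 * h * o.n' s + 12 * (kη h * o.ζ' s) * h⁻¹)

/-- The time derivative of `v`. -/
def v' (s : ℝ) : ℝ :=
  o.D' s - 6 * (kη h * o.ζ' s) - (9 * h * o.n' s + 12 * (kη h * o.ζ' s) * h⁻¹)

theorem hasDerivAt_η (hs : s₀ < s) : HasDerivAt o.η (kη h * o.ζ' s) s :=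
  (o.hasDerivAt_ζ hs).const_mul _

theorem hasDerivAt_u (hs : s₀ < s) : HasDerivAt o.u (o.u' s) s :=
  ((o.hasDerivAt_D' hs).sub ((o.hasDerivAt_η hs).const_mul 6)).add
    (((o.hasDerivAt_n hs).const_mul (9 * h)).add (((o.hasDerivAt_η hs).const_mul 12).mul_const h⁻¹))

theorem hasDerivAt_v (hs : s₀ < s) : HasDerivAt o.v (o.v' s) s :=
  ((o.hasDerivAt_D' hs).sub ((o.hasDerivAt_η hs).const_mul 6)).sub
    (((o.hasDerivAt_n hs).const_mul (9 * h)).add (((o.hasDerivAt_η hs).const_mul 12).mul_const h⁻¹))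

theorem u'_sub (hh : h₁ ≤ h) (s : ℝ) : o.u' s - h * o.u s = (o.D' s - 9 * h ^ 2 * o.n s)
    - 6 * kη h * (o.ζ' s + 2 * o.ζ s) + 9 * h * (o.n' s - (o.D s / 9 - o.ζ s * √3 / 3))
    + 12 * kη h * h⁻¹ * (o.ζ' s + 2 * o.ζ s) := by
  have hi : h * h⁻¹ = 1 := mul_inv_cancel₀ o.h_pos.ne'
  have hk := (kη_spec hh).1
  unfold u' u η
  linear_combination 6 * h * o.ζ s * hk
    + (-12 * kη h * o.ζ s + 24 * kη h * o.ζ s * h⁻¹) * hi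

theorem v'_add (hh : h₁ ≤ h) (s : ℝ) : o.v' s + h * o.v s = (o.D' s - 9 * h ^ 2 * o.n s)
    - 6 * kη h * (o.ζ' s + 2 * o.ζ s) - 9 * h * (o.n' s - (o.D s / 9 - o.ζ s * √3 / 3))
    - 12 * kη h * h⁻¹ * (o.ζ' s + 2 * o.ζ s) := by
  have hi : h * h⁻¹ = 1 := mul_inv_cancel₀ o.h_pos.ne'
  have hk := (kη_spec hh).1
  unfold v' v η
  linear_combination -6 * h * o.ζ s * hk
    + (-12 * kη h * o.ζ s - 24 * kη h * o.ζ s * h⁻¹) * hi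

theorem abs_le_W (hh : h₁ ≤ h) (s : ℝ) :
    |o.D s| ≤ 6 * o.W s ∧ h * |o.n s| ≤ o.W s ∧ |o.ζ s| ≤ 2 * o.W s := by
  obtain ⟨-, k1, k2⟩ := kη_spec hh
  have hge := h_ge hh
  have h1 : h⁻¹ ≤ 1 / 100 := by
    rw [inv_le_comm₀ (by linarith) (by norm_num)]; linarith
  have h2 : 0 < h⁻¹ := by rw [inv_pos]; linarith
  have a1 := abs_nonneg (o.u s)
  have a2 := abs_nonneg (o.v s)
  have a3 := abs_nonneg (o.η s)
  have b1 := abs_le.1 (le_refl |o.u s|)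
  have b2 := abs_le.1 (le_refl |o.v s|)
  have b3 := abs_le.1 (le_refl |o.η s|)
  have b4 : |o.η s * h⁻¹| ≤ |o.η s| * (1 / 100) := by
    rw [abs_mul, abs_of_pos h2]; gcongr
  have b5 := abs_le.1 b4
  refine ⟨?_, ?_, ?_⟩
  · have : o.D s = (o.u s + o.v s) / 2 + 6 * o.η s := by unfold u v; ring
    rw [this, abs_le]
    unfold W
    constructor <;> linarith
  · have : h * o.n s = ((o.u s - o.v s) / 2 - 12 * (o.η s * h⁻¹)) / 9 := by unfold u v; ring
    have habs : h * |o.n s| = |h * o.n s| := by rw [abs_mul, abs_of_pos o.h_pos]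
    rw [habs, this, abs_le]
    unfold W
    constructor <;> linarith
  · have h3 : |o.η s| = kη h * |o.ζ s| := by
      unfold η; rw [abs_mul, abs_of_pos (by linarith)]
    unfold W
    nlinarith [abs_nonneg (o.ζ s)]

namespace Settled

variable {o}

theorem W_le (hl : o.Settled s) (hh : h₁ ≤ h) : o.W s ≤ 1 / 10 ^ 8 := by
  obtain ⟨-, k1, k2⟩ := kη_spec hh
  have hge := h_ge hh
  have h1 : h⁻¹ ≤ 1 / 100 := by
    rw [inv_le_comm₀ (by linarith) (by norm_num)]; linarith
  have h2 : 0 < h⁻¹ := by rw [inv_pos]; linarith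
  have hη : |o.η s| ≤ 1 / 10 ^ 20 := by
    unfold η
    rw [abs_mul, abs_of_pos (by linarith)]
    have h3 := hl.late.abs_ζ_le hh
    calc kη h * |o.ζ s| ≤ 1 * (1 / 10 ^ 50) := by gcongr; linarith
      _ ≤ _ := by norm_num
  have b4 : |o.η s * h⁻¹| ≤ |o.η s| * (1 / 100) := by
    rw [abs_mul, abs_of_pos h2]; gcongr
  have hn : |h * o.n s| ≤ 4 * δ₀ := by rw [abs_mul, abs_of_pos o.h_pos]; exact hl.n_le
  have hD := abs_lt.1 hl.D_lt
  have hn' := abs_le.1 hn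
  have hη' := abs_le.1 hη
  have b5 := abs_le.1 b4
  unfold δ₀ at *
  have hu : |o.u s| ≤ 1 / 10 ^ 9 := by
    have : o.u s = o.D s - 6 * o.η s + (9 * (h * o.n s) + 12 * (o.η s * h⁻¹)) := by
      unfold u; ring
    rw [this, abs_le]
    constructor <;> linarith
  have hv : |o.v s| ≤ 1 / 10 ^ 9 := by
    have : o.v s = o.D s - 6 * o.η s - (9 * (h * o.n s) + 12 * (o.η s * h⁻¹)) := by
      unfold v; ring
    rw [this, abs_le]
    constructor <;> linarith
  unfold W
  linarith

/-- The remainders of the system in the variables `u`, `v`, `η` are of second order. -/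
theorem remainders (hl : o.Settled s) (hh : h₁ ≤ h) :
    |o.u' s - h * o.u s| ≤ h * (10 ^ 4 * (o.W s ^ 2 + o.q₁ s)) ∧
    |o.v' s + h * o.v s| ≤ h * (10 ^ 4 * (o.W s ^ 2 + o.q₁ s)) ∧
    |kη h * o.ζ' s + 2 * o.η s| ≤ 10 ^ 4 * (o.W s ^ 2 + o.q₁ s) := by
  obtain ⟨-, k1, k2⟩ := kη_spec hh
  obtain ⟨w1, w2, w3⟩ := o.abs_le_W hh s
  have hge := h_ge hh
  have hWs := hl.W_le hh
  have hq := o.q₁_pos s hl.late.lt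
  have h1 : h⁻¹ ≤ 1 := by
    rw [inv_le_comm₀ (by linarith) (by norm_num)]; linarith
  have h2 : 0 < h⁻¹ := by rw [inv_pos]; linarith
  have hW0 : 0 ≤ o.W s := by unfold W; positivity
  have w4 : |o.n s| ≤ 6 * o.W s := by nlinarith [abs_nonneg (o.n s)]
  have rD := hl.D_remainder hh w1 (by linarith : h * |o.n s| ≤ 6 * o.W s)
  have rζ := hl.ζ_remainder hh w1 w4
  have rn := hl.n_remainder hh (by linarith) w1 w4 (by linarith)
  have hζ' : o.ζ' s + 2 * o.ζ s = 2 * (o.B s - √3) ^ 2 / o.B s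
      - 2 * o.B s * (o.E s - (o.q₁ s * o.c₁ s + o.q₂ s * o.c₂ s) / o.S s) := by
    unfold ζ'; ring
  rw [← hζ'] at rζ
  have hη : kη h * o.ζ' s + 2 * o.η s = kη h * (o.ζ' s + 2 * o.ζ s) := by unfold η; ring
  rw [o.u'_sub hh, o.v'_add hh, hη]
  set x := o.ζ' s + 2 * o.ζ s
  have e1 : |o.D' s - 9 * h ^ 2 * o.n s| ≤ 60 * (6 * o.W s) ^ 2 + 440 * o.q₁ s := rD
  have e2 : |o.n' s - (o.D s / 9 - o.ζ s * √3 / 3)| ≤ 25 * (6 * o.W s) ^ 2 + 3 * o.q₁ s := rn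
  set y := o.D' s - 9 * h ^ 2 * o.n s
  set z := o.n' s - (o.D s / 9 - o.ζ s * √3 / 3)
  have f1 : |kη h * x| ≤ 9 / 10 * (80 * (6 * o.W s) ^ 2 + 4 * o.q₁ s) := by
    rw [abs_mul, abs_of_pos (by linarith)]; gcongr
  have f2 : |h * z| ≤ h * (25 * (6 * o.W s) ^ 2 + 3 * o.q₁ s) := by
    rw [abs_mul, abs_of_pos o.h_pos]; gcongr
  have f3 : |kη h * x * h⁻¹| ≤ 9 / 10 * (80 * (6 * o.W s) ^ 2 + 4 * o.q₁ s) := by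
    rw [abs_mul, abs_of_pos h2]
    calc _ ≤ 9 / 10 * (80 * (6 * o.W s) ^ 2 + 4 * o.q₁ s) * 1 := by gcongr
      _ = _ := by ring
  have i1 := abs_le.1 e1
  have i2 := abs_le.1 f1
  have i3 := abs_le.1 f2
  have i4 := abs_le.1 f3
  have hW2 : 10 ^ 6 * o.W s ^ 2 ≤ h * o.W s ^ 2 := by gcongr; linarith
  have hq2 : 10 ^ 6 * o.q₁ s ≤ h * o.q₁ s := by gcongr; linarith
  have hWsq := sq_nonneg (o.W s)
  have hu : y - 6 * kη h * x + 9 * h * z + 12 * kη h * h⁻¹ * x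
      = y - 6 * (kη h * x) + 9 * (h * z) + 12 * (kη h * x * h⁻¹) := by ring
  have hv : y - 6 * kη h * x - 9 * h * z - 12 * kη h * h⁻¹ * x
      = y - 6 * (kη h * x) - 9 * (h * z) - 12 * (kη h * x * h⁻¹) := by ring
  refine ⟨?_, ?_, f1.trans ?_⟩
  · rw [hu, abs_le]
    constructor <;> linarith
  · rw [hv, abs_le]
    constructor <;> linarith
  · linarith

end Settled

/-- The asymptotics of an orbit of large energy. -/
theorem asymptotics (hh : h₁ ≤ h) : Tendsto o.n atTop (𝓝 0) ∧
    ∃ b, Tendsto (fun s => o.D s * Real.exp (2 * s)) atTop (𝓝 b) := by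
  obtain ⟨a, ha⟩ := eventually_atTop.1 (o.eventually_h_mul_abs_n_le hh)
  have hl : ∀ s ≥ a, o.Settled s := fun s hs => ⟨(ha s hs).1, (ha s hs).2.1, (ha s hs).2.2⟩
  have hge := h_ge hh
  have hpos := o.h_pos
  obtain ⟨c, hc⟩ := saddle_decay (h := h) (K := 10 ^ 4) (s₁ := a) (by linarith) (by norm_num)
    (fun s hs => o.hasDerivAt_u (hl s hs).late.lt) (fun s hs => o.hasDerivAt_v (hl s hs).late.lt)
    (fun s hs => o.hasDerivAt_η (hl s hs).late.lt) (fun s hs => o.hasDerivAt_q₁ (hl s hs).late.lt)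
    (fun s hs => ((hl s hs).remainders hh).1) (fun s hs => ((hl s hs).remainders hh).2.1)
    (fun s hs => ((hl s hs).remainders hh).2.2)
    (fun s hs => by nlinarith [(hl s hs).b₁_ge hh, o.q₁_pos s (hl s hs).late.lt])
    (fun s hs => o.q₁_pos s (hl s hs).late.lt)
    (fun s hs => by
      have h1 := (hl s hs).W_le hh
      unfold W at h1; linarith)
  have hnn : ∀ s ≥ a, 0 ≤ 10 ^ 4 * (o.W s ^ 2 + o.q₁ s) := fun s hs => by
    have := o.q₁_pos s (hl s hs).late.lt; positivity
  obtain ⟨lu, lv, b, lη⟩ := saddle_limits (h := h) (c := h * (10 ^ 4 * c)) (s₁ := a)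
    (r := fun s => h * (10 ^ 4 * (o.W s ^ 2 + o.q₁ s))) (by linarith)
    (fun s hs => o.hasDerivAt_u (hl s hs).late.lt) (fun s hs => o.hasDerivAt_v (hl s hs).late.lt)
    (fun s hs => o.hasDerivAt_η (hl s hs).late.lt)
    (fun s hs => ((hl s hs).remainders hh).1) (fun s hs => ((hl s hs).remainders hh).2.1)
    (fun s hs => ((hl s hs).remainders hh).2.2.trans
      (le_mul_of_one_le_left (hnn s hs) (by linarith)))
    (fun s hs => by
      have h1 := hc s hs
      have h2 := mul_le_mul_of_nonneg_left h1 (show 0 ≤ h * 10 ^ 4 by positivity)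
      unfold W
      linarith)
    (fun s hs => by
      have h1 := (hl s hs).W_le hh
      unfold W at h1
      linarith [abs_nonneg (o.v s), abs_nonneg (o.η s)])
  refine ⟨?_, 6 * b, ?_⟩
  · have h1 := ((tendsto_zero_of_mul_exp lu).sub (tendsto_zero_of_mul_exp lv)).div_const (18 * h)
    have h2 := ((tendsto_zero_of_mul_exp lη).const_mul (4 / 3 * h⁻¹ ^ 2))
    have h3 := h1.sub h2
    simp only [sub_zero, zero_div, mul_zero] at h3
    refine h3.congr fun s => ?_
    unfold u v
    field_simp
    ring
  · have h1 := ((lu.add lv).div_const 2).add (lη.const_mul 6)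
    simp only [add_zero, zero_div, zero_add] at h1
    refine h1.congr fun s => ?_
    unfold u v
    ring

theorem tendsto_D (hh : h₁ ≤ h) : Tendsto o.D atTop (𝓝 0) := by
  obtain ⟨-, b, hb⟩ := o.asymptotics hh
  exact tendsto_zero_of_mul_exp hb

theorem tendsto_A (hh : h₁ ≤ h) : Tendsto o.A atTop (𝓝 h) := by
  have h1 : Tendsto (fun s => √(h ^ 2 - o.D s)) atTop (𝓝 √(h ^ 2 - 0)) :=
    ((o.tendsto_D hh).const_sub _).sqrt
  rw [sub_zero, Real.sqrt_sq o.h_pos.le] at h1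
  refine h1.congr' ?_
  filter_upwards [eventually_gt_atTop s₀] with s hs
  rw [D, sub_sub_cancel, Real.sqrt_sq (o.A_pos s hs).le]

theorem tendsto_B_sq (hh : h₁ ≤ h) : Tendsto (fun s => o.B s ^ 2) atTop (𝓝 3) := by
  have h1 : Tendsto (fun s => (1 / 3 + o.n s)⁻¹) atTop (𝓝 (1 / 3 + 0)⁻¹) :=
    ((o.asymptotics hh).1.const_add _).inv₀ (by norm_num)
  norm_num at h1
  refine h1.congr fun s => ?_
  simp [n, N]

theorem tendsto_B (hh : h₁ ≤ h) : Tendsto o.B atTop (𝓝 √3) := by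
  refine (o.tendsto_B_sq hh).sqrt.congr' ?_
  filter_upwards [eventually_gt_atTop s₀] with s hs
  rw [Real.sqrt_sq (o.B_pos s hs).le]

theorem tendsto_S (hh : h₁ ≤ h) : Tendsto o.S atTop (𝓝 √3) := by
  have h1 := ((o.tendsto_D hh).add (o.tendsto_B_sq hh)).sqrt
  rw [zero_add] at h1
  refine h1.congr' ?_
  filter_upwards [eventually_gt_atTop s₀] with s hs
  rw [← o.S_sq_eq hs, Real.sqrt_sq (o.S_pos s hs).le]

theorem tendsto_t₁ (hh : h₁ ≤ h) : Tendsto o.t₁ atTop (𝓝 (2 * √3 * h / (h ^ 2 - 3))) := by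
  have hge := h_ge hh
  have h1 := (((o.tendsto_B hh).mul_const h).add ((o.tendsto_A hh).mul (o.tendsto_S hh))).div
    (((o.tendsto_A hh).pow 2).sub (o.tendsto_B_sq hh)) (by nlinarith)
  have h2 : √3 * h + h * √3 = 2 * √3 * h := by ring
  rw [h2] at h1
  refine h1.congr' ?_
  filter_upwards [eventually_gt_atTop s₀] with s hs
  rw [o.t₁_eq s hs]; rfl

theorem exists_tendsto_t₂ (hh : h₁ ≤ h) :
    ∃ b, Tendsto (fun s => o.t₂ s * Real.exp (2 * s)) atTop (𝓝 b) := by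
  obtain ⟨-, b, hb⟩ := o.asymptotics hh
  have hpos := o.h_pos
  have h1 := hb.div (((o.tendsto_A hh).mul (o.tendsto_S hh)).add ((o.tendsto_B hh).mul_const h))
    (by positivity)
  refine ⟨_, h1.congr' ?_⟩
  filter_upwards [eventually_gt_atTop s₀] with s hs
  have := o.A_pos s hs; have := o.B_pos s hs; have := o.S_pos s hs
  simp only [Pi.div_apply]
  rw [← o.t₂_mul hs, div_eq_iff (by positivity)]
  ring

end Orbit

/-! ### From the field equations to the autonomous system -/

theorem root_sq_add_one {a b k S : ℝ} (hS : S ^ 2 = k ^ 2 + b ^ 2 - a ^ 2) (hR : a ^ 2 - b ^ 2 ≠ 0) :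
    ((b * k + a * S) / (a ^ 2 - b ^ 2)) ^ 2 + 1 = ((a * k + b * S) / (a ^ 2 - b ^ 2)) ^ 2 := by
  field_simp
  linear_combination (a ^ 2 - b ^ 2) * hS

namespace IsSolution

variable {y₀ β₀ : ℝ} {V₁ V₂ U Λ σ₁ σ₂ : ℝ → ℝ}

theorem energy_pos (h0 : 0 < y₀) (h1 : y₀ < 1) : 0 < energy y₀ := by
  have : 0 < √(1 - y₀ ^ 2) := Real.sqrt_pos.2 (by nlinarith)
  unfold energy; positivity

theorem energy_sq (h0 : 0 < y₀) (h1 : y₀ < 1) : energy y₀ ^ 2 = 1 / y₀ ^ 2 - 1 := by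
  unfold energy
  rw [div_pow, Real.sq_sqrt (by nlinarith)]
  field_simp

/-- The metric coefficient `e^U / y` at `y = e^s`. -/
def A (U : ℝ → ℝ) (s : ℝ) : ℝ := Real.exp (U (Real.exp s)) / Real.exp s

/-- The metric coefficient `e^Λ` at `y = e^s`. -/
def B (Λ : ℝ → ℝ) (s : ℝ) : ℝ := Real.exp (Λ (Real.exp s))

/-- The root of the discriminant of `H(y,V) = h`, up to a factor `e^U`. -/
def S (y₀ : ℝ) (U Λ : ℝ → ℝ) (s : ℝ) : ℝ := √(energy y₀ ^ 2 + B Λ s ^ 2 - A U s ^ 2)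

/-- The rescaled number density of particles at `y = e^s`. -/
def q (β₀ : ℝ) (σ : ℝ → ℝ) (s : ℝ) : ℝ :=
  8 * Real.pi ^ 2 * β₀ * Real.exp (2 * σ (Real.exp s)) / Real.exp s ^ 2

/-- The value of `√(V₁² y² + 1)` at `y = e^s`, see `sqrt_V₁`. -/
def c₁ (y₀ : ℝ) (U Λ : ℝ → ℝ) (s : ℝ) : ℝ :=
  (A U s * energy y₀ + B Λ s * S y₀ U Λ s) / (A U s ^ 2 - B Λ s ^ 2)

/-- The value of `√(V₂² y² + 1)` at `y = e^s`, see `sqrt_V₂`. -/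
def c₂ (y₀ : ℝ) (U Λ : ℝ → ℝ) (s : ℝ) : ℝ :=
  (A U s * energy y₀ - B Λ s * S y₀ U Λ s) / (A U s ^ 2 - B Λ s ^ 2)

/-- The value of `-V₁ y` at `y = e^s`, see `V₁_mul`. -/
def t₁ (y₀ : ℝ) (U Λ : ℝ → ℝ) (s : ℝ) : ℝ :=
  (B Λ s * energy y₀ + A U s * S y₀ U Λ s) / (A U s ^ 2 - B Λ s ^ 2)

/-- The value of `V₂ y` at `y = e^s`, see `V₂_mul`. -/
def t₂ (y₀ : ℝ) (U Λ : ℝ → ℝ) (s : ℝ) : ℝ :=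
  (A U s * S y₀ U Λ s - B Λ s * energy y₀) / (A U s ^ 2 - B Λ s ^ 2)

theorem A_pos (U : ℝ → ℝ) (s : ℝ) : 0 < A U s := by unfold A; positivity

theorem B_pos (Λ : ℝ → ℝ) (s : ℝ) : 0 < B Λ s := by unfold B; positivity

theorem exp_two_mul_eq (x : ℝ) : Real.exp (2 * x) = Real.exp x ^ 2 := by
  rw [two_mul, Real.exp_add, sq]

theorem exp_U_eq (U : ℝ → ℝ) (s : ℝ) : Real.exp (U (Real.exp s)) = A U s * Real.exp s := by
  unfold A; field_simp

theorem coeff_eq (U Λ : ℝ → ℝ) (s : ℝ) :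
    Real.exp (2 * U (Real.exp s)) - Real.exp s ^ 2 * Real.exp (2 * Λ (Real.exp s))
      = Real.exp s ^ 2 * (A U s ^ 2 - B Λ s ^ 2) := by
  rw [exp_two_mul_eq, exp_two_mul_eq, exp_U_eq]
  unfold B; ring

theorem discr_eq (y₀ : ℝ) (U Λ : ℝ → ℝ) (s : ℝ) : discr y₀ U Λ (Real.exp s)
    = (Real.exp s * A U s) ^ 2 * (energy y₀ ^ 2 + B Λ s ^ 2 - A U s ^ 2) := by
  have h1 : Real.exp (2 * U (Real.exp s)) / Real.exp s ^ 2 = A U s ^ 2 := by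
    rw [A, div_pow, exp_two_mul_eq]
  unfold discr
  rw [coeff_eq, h1]
  unfold B
  ring

theorem sqrt_discr_eq (y₀ : ℝ) (U Λ : ℝ → ℝ) (s : ℝ) :
    √(discr y₀ U Λ (Real.exp s)) = Real.exp s * A U s * S y₀ U Λ s := by
  have := A_pos U s
  rw [discr_eq, Real.sqrt_mul (sq_nonneg _), Real.sqrt_sq (by positivity), S]

variable (sol : IsSolution y₀ β₀ V₁ V₂ U Λ σ₁ σ₂)
variable {s : ℝ}

section pointwise

variable (h0 : 0 < y₀) (hs : Real.log y₀ < s)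

theorem lt_exp (h0 : 0 < y₀) (hs : Real.log y₀ < s) : y₀ < Real.exp s :=
  (Real.log_lt_iff_lt_exp h0).1 hs

include sol h0 hs

/-- Since `V₁ < V₂`, the quadratic equation for the roots is not degenerate, and its leading
coefficient and its discriminant are positive. -/
theorem R_pos_and_S_pos : 0 < A U s ^ 2 - B Λ s ^ 2 ∧ 0 < S y₀ U Λ s := by
  have hy := lt_exp h0 hs
  have h1 := sol.V₁_lt_V₂ _ hy
  rw [sol.V₁_eq _ hy, sol.V₂_eq _ hy, root₁, root₂, coeff_eq, sqrt_discr_eq] at h1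
  have hA := A_pos U s
  have hS : 0 ≤ S y₀ U Λ s := Real.sqrt_nonneg _
  have h2 : 0 < 1 / (Real.exp s ^ 2 * (A U s ^ 2 - B Λ s ^ 2))
      * (2 * (Real.exp s * A U s * S y₀ U Λ s)) := by linarith
  have h3 : 0 ≤ 2 * (Real.exp s * A U s * S y₀ U Λ s) := by positivity
  have h4 := pos_of_mul_pos_left h2 h3
  have h5 : 0 < Real.exp s ^ 2 * (A U s ^ 2 - B Λ s ^ 2) := one_div_pos.1 h4
  refine ⟨pos_of_mul_pos_right h5 (sq_nonneg (Real.exp s)), ?_⟩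
  rcases hS.eq_or_lt with h6 | h6
  · rw [← h6] at h2; simp at h2
  · exact h6

theorem S_sq : S y₀ U Λ s ^ 2 = energy y₀ ^ 2 + B Λ s ^ 2 - A U s ^ 2 := by
  have h1 := (sol.R_pos_and_S_pos h0 hs).2
  unfold S at h1 ⊢
  exact Real.sq_sqrt (Real.sqrt_pos.1 h1).le

theorem B_lt_A : B Λ s < A U s := by
  have h1 := (sol.R_pos_and_S_pos h0 hs).1
  have := A_pos U s; have := B_pos Λ s
  nlinarith

theorem V₁_mul : V₁ (Real.exp s) * Real.exp s = -t₁ y₀ U Λ s := by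
  have hR := (sol.R_pos_and_S_pos h0 hs).1
  rw [sol.V₁_eq _ (lt_exp h0 hs), root₁, coeff_eq, sqrt_discr_eq, t₁, ← B]
  field_simp
  ring

theorem V₂_mul : V₂ (Real.exp s) * Real.exp s = t₂ y₀ U Λ s := by
  have hR := (sol.R_pos_and_S_pos h0 hs).1
  rw [sol.V₂_eq _ (lt_exp h0 hs), root₂, coeff_eq, sqrt_discr_eq, t₂, ← B]
  field_simp
  ring

variable (h1 : y₀ < 1)
include h1

theorem c₁_pos : 0 < c₁ y₀ U Λ s := by
  obtain ⟨hR, hS⟩ := sol.R_pos_and_S_pos h0 hs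
  have := energy_pos h0 h1
  have := A_pos U s; have := B_pos Λ s
  unfold c₁; positivity

theorem c₂_pos : 0 < c₂ y₀ U Λ s := by
  obtain ⟨hR, hS⟩ := sol.R_pos_and_S_pos h0 hs
  have hk := energy_pos h0 h1
  have hA := A_pos U s
  have hB := B_pos Λ s
  have h2 := sol.S_sq h0 hs
  have h3 := sol.B_lt_A h0 hs
  have h4 : S y₀ U Λ s < energy y₀ := by nlinarith
  unfold c₂
  refine div_pos ?_ hR
  nlinarith

theorem sqrt_V₁ : √(V₁ (Real.exp s) ^ 2 * Real.exp s ^ 2 + 1) = c₁ y₀ U Λ s := by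
  rw [← mul_pow, sol.V₁_mul h0 hs, neg_sq, t₁, root_sq_add_one (sol.S_sq h0 hs)
    (sol.R_pos_and_S_pos h0 hs).1.ne']
  exact Real.sqrt_sq (sol.c₁_pos h0 hs h1).le

theorem sqrt_V₂ : √(V₂ (Real.exp s) ^ 2 * Real.exp s ^ 2 + 1) = c₂ y₀ U Λ s := by
  have h2 := root_sq_add_one (S := -S y₀ U Λ s) ((neg_sq _).trans (sol.S_sq h0 hs))
    (sol.R_pos_and_S_pos h0 hs).1.ne'
  have h3 : t₂ y₀ U Λ s = -((B Λ s * energy y₀ + A U s * -S y₀ U Λ s)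
      / (A U s ^ 2 - B Λ s ^ 2)) := by unfold t₂; ring
  have h4 : c₂ y₀ U Λ s = (A U s * energy y₀ + B Λ s * -S y₀ U Λ s)
      / (A U s ^ 2 - B Λ s ^ 2) := by unfold c₂; ring
  rw [← mul_pow, sol.V₂_mul h0 hs, h3, neg_sq, h2, ← h4]
  exact Real.sqrt_sq (sol.c₂_pos h0 hs h1).le

omit h1 in
theorem A_mul_t₁ : A U s * t₁ y₀ U Λ s = S y₀ U Λ s + B Λ s * c₁ y₀ U Λ s := by
  have hR := (sol.R_pos_and_S_pos h0 hs).1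
  unfold t₁ c₁; field_simp; ring

omit h1 in
theorem A_mul_t₂ : A U s * t₂ y₀ U Λ s = S y₀ U Λ s - B Λ s * c₂ y₀ U Λ s := by
  have hR := (sol.R_pos_and_S_pos h0 hs).1
  unfold t₂ c₂; field_simp; ring

theorem dHdV_V₁ : dHdV U Λ (Real.exp s) (V₁ (Real.exp s))
    = -(Real.exp s * S y₀ U Λ s / c₁ y₀ U Λ s) := by
  have hc := sol.c₁_pos h0 hs h1
  unfold dHdV
  rw [sol.sqrt_V₁ h0 hs h1, sol.V₁_mul h0 hs, exp_U_eq, ← B]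
  field_simp
  linear_combination (-1 : ℝ) * sol.A_mul_t₁ h0 hs

theorem dHdV_V₂ : dHdV U Λ (Real.exp s) (V₂ (Real.exp s))
    = Real.exp s * S y₀ U Λ s / c₂ y₀ U Λ s := by
  have hc := sol.c₂_pos h0 hs h1
  unfold dHdV
  rw [sol.sqrt_V₂ h0 hs h1, sol.V₂_mul h0 hs, exp_U_eq, ← B]
  field_simp
  linear_combination sol.A_mul_t₂ h0 hs

theorem speed_V₁ : speed U Λ (Real.exp s) (V₁ (Real.exp s))
    = -(Real.exp s * S y₀ U Λ s / (B Λ s * c₁ y₀ U Λ s)) := by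
  have hc := sol.c₁_pos h0 hs h1
  have hB := B_pos Λ s
  unfold speed
  rw [sol.sqrt_V₁ h0 hs h1, sol.V₁_mul h0 hs, Real.exp_sub, exp_U_eq, ← B]
  field_simp
  linear_combination (-1 : ℝ) * sol.A_mul_t₁ h0 hs

theorem speed_V₂ : speed U Λ (Real.exp s) (V₂ (Real.exp s))
    = Real.exp s * S y₀ U Λ s / (B Λ s * c₂ y₀ U Λ s) := by
  have hc := sol.c₂_pos h0 hs h1
  have hB := B_pos Λ s
  unfold speed
  rw [sol.sqrt_V₂ h0 hs h1, sol.V₂_mul h0 hs, Real.exp_sub, exp_U_eq, ← B]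
  field_simp
  linear_combination sol.A_mul_t₂ h0 hs

theorem hasDerivAt_q₁ : HasDerivAt (q β₀ σ₁)
    (-2 * q β₀ σ₁ s * (1 + B Λ s * c₁ y₀ U Λ s / S y₀ U Λ s)) s := by
  have hS := (sol.R_pos_and_S_pos h0 hs).2
  have hc := sol.c₁_pos h0 hs h1
  have h2 := ((sol.deriv_σ₁ _ (lt_exp h0 hs)).comp s (Real.hasDerivAt_exp s)).const_mul 2
  have h3 := (h2.exp.const_mul (8 * Real.pi ^ 2 * β₀)).div ((Real.hasDerivAt_exp s).pow 2)
    (pow_pos (Real.exp_pos s) 2).ne'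
  refine h3.congr_deriv ?_
  rw [sol.speed_V₁ h0 hs h1]
  have hB := B_pos Λ s
  simp only [q, Pi.pow_apply, Function.comp_apply]
  norm_num
  field_simp
  ring

theorem hasDerivAt_q₂ : HasDerivAt (q β₀ σ₂)
    (-2 * q β₀ σ₂ s * (1 - B Λ s * c₂ y₀ U Λ s / S y₀ U Λ s)) s := by
  have hS := (sol.R_pos_and_S_pos h0 hs).2
  have hc := sol.c₂_pos h0 hs h1
  have h2 := ((sol.deriv_σ₂ _ (lt_exp h0 hs)).comp s (Real.hasDerivAt_exp s)).const_mul 2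
  have h3 := (h2.exp.const_mul (8 * Real.pi ^ 2 * β₀)).div ((Real.hasDerivAt_exp s).pow 2)
    (pow_pos (Real.exp_pos s) 2).ne'
  refine h3.congr_deriv ?_
  rw [sol.speed_V₂ h0 hs h1]
  have hB := B_pos Λ s
  simp only [q, Pi.pow_apply, Function.comp_apply]
  norm_num
  field_simp
  ring

theorem density_eq : 8 * Real.pi * Real.exp s ^ 2 * density y₀ β₀ V₁ V₂ U Λ σ₁ σ₂ (Real.exp s)
    = (q β₀ σ₁ s * c₁ y₀ U Λ s ^ 2 + q β₀ σ₂ s * c₂ y₀ U Λ s ^ 2) / S y₀ U Λ s := by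
  have hS := (sol.R_pos_and_S_pos h0 hs).2
  have hc1 := sol.c₁_pos h0 hs h1
  have hc2 := sol.c₂_pos h0 hs h1
  unfold density
  rw [if_pos (lt_exp h0 hs), sol.sqrt_V₁ h0 hs h1, sol.sqrt_V₂ h0 hs h1, sol.dHdV_V₁ h0 hs h1,
    sol.dHdV_V₂ h0 hs h1, abs_neg, abs_of_pos (by positivity), abs_of_pos (by positivity)]
  unfold q
  field_simp

theorem pressure_eq : 8 * Real.pi * Real.exp s ^ 2 * pressure y₀ β₀ V₁ V₂ U Λ σ₁ σ₂ (Real.exp s)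
    = (q β₀ σ₁ s * t₁ y₀ U Λ s ^ 2 + q β₀ σ₂ s * t₂ y₀ U Λ s ^ 2) / S y₀ U Λ s := by
  have hS := (sol.R_pos_and_S_pos h0 hs).2
  have hc1 := sol.c₁_pos h0 hs h1
  have hc2 := sol.c₂_pos h0 hs h1
  have e1 : t₁ y₀ U Λ s ^ 2 = V₁ (Real.exp s) ^ 2 * Real.exp s ^ 2 := by
    rw [← mul_pow, sol.V₁_mul h0 hs, neg_sq]
  have e2 : t₂ y₀ U Λ s ^ 2 = V₂ (Real.exp s) ^ 2 * Real.exp s ^ 2 := by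
    rw [← mul_pow, sol.V₂_mul h0 hs]
  unfold pressure
  rw [if_pos (lt_exp h0 hs), sol.sqrt_V₁ h0 hs h1, sol.sqrt_V₂ h0 hs h1, sol.dHdV_V₁ h0 hs h1,
    sol.dHdV_V₂ h0 hs h1, abs_neg, abs_of_pos (by positivity), abs_of_pos (by positivity), e1, e2]
  unfold q
  field_simp

theorem hasDerivAt_A : HasDerivAt (A U) (A U s * ((B Λ s ^ 2 * (1 + (q β₀ σ₁ s * t₁ y₀ U Λ s ^ 2
    + q β₀ σ₂ s * t₂ y₀ U Λ s ^ 2) / S y₀ U Λ s) - 3) / 2)) s := by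
  have hy := lt_exp h0 hs
  have h2 := sol.field_U _ hy
  rw [sol.pressure_eq h0 hs h1] at h2
  have h3 := ((sol.diff_U _ hy).hasDerivAt.comp s (Real.hasDerivAt_exp s)).exp.div
    (Real.hasDerivAt_exp s) (Real.exp_pos s).ne'
  refine h3.congr_deriv ?_
  rw [sub_eq_iff_eq_add] at h2
  have h4 : Real.exp (-2 * Λ (Real.exp s)) * B Λ s ^ 2 = 1 := by
    unfold B; rw [← Real.exp_nat_mul, ← Real.exp_add]; norm_num
  have h5 : 2 * (Real.exp s * deriv U (Real.exp s)) = B Λ s ^ 2 * (1 + (q β₀ σ₁ s * t₁ y₀ U Λ s ^ 2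
      + q β₀ σ₂ s * t₂ y₀ U Λ s ^ 2) / S y₀ U Λ s) - 1 := by
    linear_combination B Λ s ^ 2 * h2
      - (2 * Real.exp s * deriv U (Real.exp s) + 1) * h4
  have h6 : Real.exp s * deriv U (Real.exp s) = (B Λ s ^ 2 * (1 + (q β₀ σ₁ s * t₁ y₀ U Λ s ^ 2
      + q β₀ σ₂ s * t₂ y₀ U Λ s ^ 2) / S y₀ U Λ s) - 1) / 2 := by linarith
  have h7 : (B Λ s ^ 2 * (1 + (q β₀ σ₁ s * t₁ y₀ U Λ s ^ 2 + q β₀ σ₂ s * t₂ y₀ U Λ s ^ 2)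
      / S y₀ U Λ s) - 3) / 2 = Real.exp s * deriv U (Real.exp s) - 1 := by rw [h6]; ring
  rw [h7]
  simp only [A, Function.comp_apply]
  field_simp

theorem hasDerivAt_B : HasDerivAt (B Λ) (B Λ s * ((1 - B Λ s ^ 2 + B Λ s ^ 2 *
    ((q β₀ σ₁ s * c₁ y₀ U Λ s ^ 2 + q β₀ σ₂ s * c₂ y₀ U Λ s ^ 2) / S y₀ U Λ s)) / 2)) s := by
  have hy := lt_exp h0 hs
  have h2 := sol.field_Λ _ hy
  rw [sol.density_eq h0 hs h1] at h2
  have h3 := ((sol.diff_Λ _ hy).hasDerivAt.comp s (Real.hasDerivAt_exp s)).exp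
  refine h3.congr_deriv ?_
  have h4 : Real.exp (-2 * Λ (Real.exp s)) * B Λ s ^ 2 = 1 := by
    unfold B; rw [← Real.exp_nat_mul, ← Real.exp_add]; norm_num
  have h7 : (1 - B Λ s ^ 2 + B Λ s ^ 2 * ((q β₀ σ₁ s * c₁ y₀ U Λ s ^ 2
      + q β₀ σ₂ s * c₂ y₀ U Λ s ^ 2) / S y₀ U Λ s)) / 2 = deriv Λ (Real.exp s) * Real.exp s := by
    rw [← h2]
    linear_combination (2 * Real.exp s * deriv Λ (Real.exp s) - 1) / 2 * h4
  rw [h7]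
  rfl

end pointwise

theorem tendsto_zero_of_div_sqrt {f : ℝ → ℝ} {y₀ θ : ℝ}
    (hf : Tendsto (fun y => f y / √(y - y₀)) (𝓝[>] y₀) (𝓝 θ)) : Tendsto f (𝓝[>] y₀) (𝓝 0) := by
  have h1 : Tendsto (fun y => √(y - y₀)) (𝓝[>] y₀) (𝓝 0) := by
    have : Tendsto (fun y => √(y - y₀)) (𝓝 y₀) (𝓝 √(y₀ - y₀)) :=
      (tendsto_id.sub_const y₀).sqrt
    rw [sub_self, Real.sqrt_zero] at this
    exact this.mono_left nhdsWithin_le_nhds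
  have h2 := hf.mul h1
  rw [mul_zero] at h2
  refine h2.congr' ?_
  filter_upwards [self_mem_nhdsWithin] with y hy
  have : 0 < √(y - y₀) := Real.sqrt_pos.2 (sub_pos.2 hy)
  field_simp

theorem tendsto_exp_nhdsGT (h0 : 0 < y₀) :
    Tendsto Real.exp (𝓝[>] (Real.log y₀)) (𝓝[>] y₀) := by
  refine tendsto_nhdsWithin_iff.2 ⟨?_, ?_⟩
  · have h1 := (Real.continuous_exp.tendsto (Real.log y₀)).mono_left
      (nhdsWithin_le_nhds (s := Ioi (Real.log y₀)))
    rwa [Real.exp_log h0] at h1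
  · filter_upwards [self_mem_nhdsWithin] with s hs using lt_exp h0 hs

include sol in
theorem tendsto_B (h0 : 0 < y₀) : Tendsto (B Λ) (𝓝[>] (Real.log y₀)) (𝓝 1) := by
  obtain ⟨θ, hθ⟩ := sol.sqrt_Λ
  have h1 := ((tendsto_zero_of_div_sqrt hθ).comp (tendsto_exp_nhdsGT h0)).rexp
  rwa [Real.exp_zero] at h1

include sol in
theorem tendsto_sub_A_sq (h0 : 0 < y₀) (h1 : y₀ < 1) :
    Tendsto (fun s => energy y₀ ^ 2 - A U s ^ 2) (𝓝[>] (Real.log y₀)) (𝓝 (-1)) := by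
  obtain ⟨θ, hθ⟩ := sol.sqrt_U
  have h2 := ((tendsto_zero_of_div_sqrt hθ).comp (tendsto_exp_nhdsGT h0)).rexp
  have h3 := h2.div ((tendsto_exp_nhdsGT h0).mono_right nhdsWithin_le_nhds) h0.ne'
  have h4 := (h3.pow 2).const_sub (energy y₀ ^ 2)
  rw [energy_sq h0 h1, Real.exp_zero, one_div_pow, sub_sub_cancel_left] at h4
  rw [energy_sq h0 h1]
  exact h4

/-- The orbit of the autonomous system that belongs to a self-similar dust-like solution. -/
def orbit (h0 : 0 < y₀) (h1 : y₀ < 1) (hβ : 0 < β₀) : Orbit (energy y₀) (Real.log y₀) where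
  A := A U
  B := B Λ
  S := S y₀ U Λ
  c₁ := c₁ y₀ U Λ
  c₂ := c₂ y₀ U Λ
  t₁ := t₁ y₀ U Λ
  t₂ := t₂ y₀ U Λ
  q₁ := q β₀ σ₁
  q₂ := q β₀ σ₂
  h_pos := energy_pos h0 h1
  A_pos s _ := A_pos U s
  B_pos s _ := B_pos Λ s
  S_pos s hs := (sol.R_pos_and_S_pos h0 hs).2
  q₁_pos s _ := by unfold q; positivity
  q₂_pos s _ := by unfold q; positivity
  B_lt_A s hs := sol.B_lt_A h0 hs
  S_sq s hs := sol.S_sq h0 hs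
  c₁_eq s _ := rfl
  c₂_eq s _ := rfl
  t₁_eq s _ := rfl
  t₂_eq s _ := rfl
  dA s hs := sol.hasDerivAt_A h0 hs h1
  dB s hs := sol.hasDerivAt_B h0 hs h1
  dq₁ s hs := sol.hasDerivAt_q₁ h0 hs h1
  dq₂ s hs := sol.hasDerivAt_q₂ h0 hs h1
  A_lim := sol.tendsto_sub_A_sq h0 h1
  B_lim := sol.tendsto_B h0

/-! ### Asymptotics in the original variables -/

include sol

section asymptotics

variable (h0 : 0 < y₀) (h1 : y₀ < 1) (hβ : 0 < β₀) (hh : Orbit.h₁ ≤ energy y₀)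
include h0 h1 hβ hh

theorem tendsto_U_sub :
    Tendsto (fun y => U y - (Real.log (y / y₀) + Real.log (√(1 - y₀ ^ 2)))) atTop (𝓝 0) := by
  rw [← Real.tendsto_comp_exp_atTop]
  have hk := energy_pos h0 h1
  have h2 : Tendsto (A U) atTop (𝓝 (energy y₀)) := (sol.orbit h0 h1 hβ).tendsto_A hh
  have h3 := (h2.log hk.ne').sub_const (Real.log (energy y₀))
  rw [sub_self] at h3
  refine h3.congr fun s => ?_
  have h4 : (√(1 - y₀ ^ 2)) ≠ 0 := (Real.sqrt_pos.2 (by nlinarith)).ne'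
  rw [A, energy, Real.log_div (Real.exp_pos _).ne' (Real.exp_pos _).ne', Real.log_div h4 h0.ne',
    Real.log_div (Real.exp_pos _).ne' h0.ne', Real.log_exp, Real.log_exp]
  ring

theorem tendsto_Λ : Tendsto Λ atTop (𝓝 (Real.log (√3))) := by
  rw [← Real.tendsto_comp_exp_atTop]
  have h2 : Tendsto (B Λ) atTop (𝓝 √3) := (sol.orbit h0 h1 hβ).tendsto_B hh
  refine (h2.log (by positivity)).congr fun s => ?_
  rw [B, Real.log_exp]

theorem tendsto_V₁_mul : Tendsto (fun y => V₁ y * y) atTop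
    (𝓝 (-(2 * y₀ * √(3 * (1 - y₀ ^ 2)) / (1 - 4 * y₀ ^ 2)))) := by
  rw [← Real.tendsto_comp_exp_atTop]
  have h2 : Tendsto (t₁ y₀ U Λ) atTop (𝓝 _) := (sol.orbit h0 h1 hβ).tendsto_t₁ hh
  have h3 : 2 * √3 * energy y₀ / (energy y₀ ^ 2 - 3)
      = 2 * y₀ * √(3 * (1 - y₀ ^ 2)) / (1 - 4 * y₀ ^ 2) := by
    have h4 : energy y₀ ^ 2 - 3 = (1 - 4 * y₀ ^ 2) / y₀ ^ 2 := by
      rw [energy_sq h0 h1]; field_simp; ring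
    rw [h4, energy, Real.sqrt_mul (by norm_num)]
    field_simp
  rw [h3] at h2
  refine h2.neg.congr' ?_
  filter_upwards [eventually_gt_atTop (Real.log y₀)] with s hs
  rw [sol.V₁_mul h0 hs]

theorem exists_tendsto_V₂_mul : ∃ b, Tendsto (fun y => V₂ y * y * y ^ 2) atTop (𝓝 b) := by
  obtain ⟨b, hb⟩ := (sol.orbit h0 h1 hβ).exists_tendsto_t₂ hh
  refine ⟨b, ?_⟩
  rw [← Real.tendsto_comp_exp_atTop]
  have h2 : Tendsto (fun s => t₂ y₀ U Λ s * Real.exp (2 * s)) atTop (𝓝 b) := hb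
  refine h2.congr' ?_
  filter_upwards [eventually_gt_atTop (Real.log y₀)] with s hs
  rw [sol.V₂_mul h0 hs, ← Real.exp_nat_mul]
  norm_num

omit sol hβ in
theorem four_mul_sq_lt : 0 < 1 - 4 * y₀ ^ 2 := by
  have h2 := Orbit.h_ge hh
  have h3 := energy_sq h0 h1
  have h4 : 3 < 1 / y₀ ^ 2 - 1 := by rw [← h3]; nlinarith
  have h5 : 4 < 1 / y₀ ^ 2 := by linarith
  rw [lt_div_iff₀ (by positivity)] at h5
  linarith

theorem V₁_isEquivalent :
    V₁ ~[atTop] (fun y => -(2 * y₀ * √(3 * (1 - y₀ ^ 2)) / ((1 - 4 * y₀ ^ 2) * y))) := by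
  have h2 := sol.tendsto_V₁_mul h0 h1 hβ hh
  have h3 := four_mul_sq_lt h0 h1 hh
  have h4 : 0 < √(3 * (1 - y₀ ^ 2)) := Real.sqrt_pos.2 (by nlinarith)
  set K := 2 * y₀ * √(3 * (1 - y₀ ^ 2)) / (1 - 4 * y₀ ^ 2) with hK
  have hK0 : 0 < K := by positivity
  have h5 : ∀ y, -(2 * y₀ * √(3 * (1 - y₀ ^ 2)) / ((1 - 4 * y₀ ^ 2) * y)) = -K / y := fun y => by
    rw [hK, ← div_div, neg_div]
  simp only [h5]
  refine (isEquivalent_iff_tendsto_one ?_).2 ?_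
  · filter_upwards [eventually_gt_atTop 0] with y hy
    exact div_ne_zero (neg_ne_zero.2 hK0.ne') hy.ne'
  · have h6 := h2.div_const (-K)
    rw [div_self (neg_ne_zero.2 hK0.ne')] at h6
    refine h6.congr' ?_
    filter_upwards [eventually_gt_atTop 0] with y hy
    simp only [Pi.div_apply]
    field_simp

theorem exists_V₂_isLittleO : ∃ C₁ : ℝ, (fun y => V₂ y
      - -(√(1 - y₀ ^ 2) / (√3 * y₀)) * (C₁ / y) * (y₀ / y) ^ 2)
    =o[atTop] (fun y => 1 / y * (y₀ / y) ^ 2) := by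
  obtain ⟨b, hb⟩ := sol.exists_tendsto_V₂_mul h0 h1 hβ hh
  have h4 : 0 < √(1 - y₀ ^ 2) := Real.sqrt_pos.2 (by nlinarith)
  set k := √(1 - y₀ ^ 2) / (√3 * y₀) with hk
  have hk0 : 0 < k := by positivity
  refine ⟨-(b / (k * y₀ ^ 2)), ?_⟩
  refine (isLittleO_iff_tendsto' ?_).2 ?_
  · filter_upwards [eventually_gt_atTop 0] with y hy h5
    exact absurd h5 (by positivity)
  · have h6 := (hb.sub_const b).div_const (y₀ ^ 2)
    rw [sub_self, zero_div] at h6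
    refine h6.congr' ?_
    filter_upwards [eventually_gt_atTop 0] with y hy
    field_simp

theorem tendsto_V₁ : Tendsto V₁ atTop (𝓝 0) := by
  have h2 := (sol.tendsto_V₁_mul h0 h1 hβ hh).mul tendsto_inv_atTop_zero
  rw [mul_zero] at h2
  refine h2.congr' ?_
  filter_upwards [eventually_gt_atTop 0] with y hy
  field_simp

theorem tendsto_V₂ : Tendsto V₂ atTop (𝓝 0) := by
  obtain ⟨b, hb⟩ := sol.exists_tendsto_V₂_mul h0 h1 hβ hh
  have h2 := hb.mul (tendsto_inv_atTop_zero.pow 3)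
  rw [zero_pow (by norm_num), mul_zero] at h2
  refine h2.congr' ?_
  filter_upwards [eventually_gt_atTop 0] with y hy
  field_simp

end asymptotics

end IsSolution

theorem h₁_le_energy {y₀ : ℝ} (h0 : 0 < y₀) (hy : y₀ < 1 / (2 + 2 * Orbit.h₁))
    (hh : 0 < Orbit.h₁) : y₀ < 1 ∧ Orbit.h₁ ≤ energy y₀ := by
  rw [lt_div_iff₀ (by positivity)] at hy
  have h1 : y₀ < 1 / 2 := by nlinarith
  refine ⟨by linarith, ?_⟩
  have h2 : 1 / 2 ≤ √(1 - y₀ ^ 2) := Real.le_sqrt_of_sq_le (by nlinarith)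
  unfold energy
  rw [le_div_iff₀ h0]
  nlinarith

end SelfSimilarDust

end

theorem theorem3 :
    ∃ ε₀ : ℝ, 0 < ε₀ ∧ ∀ y₀ : ℝ, 0 < y₀ → y₀ < ε₀ →
      ∀ β₀ : ℝ, 0 < β₀ → ∀ V₁ V₂ U Λ σ₁ σ₂ : ℝ → ℝ,
        SelfSimilarDust.IsSolution y₀ β₀ V₁ V₂ U Λ σ₁ σ₂ →
        Tendsto (fun y => U y - (Real.log (y / y₀) + Real.log (√(1 - y₀ ^ 2)))) atTop (𝓝 0) ∧
        Tendsto Λ atTop (𝓝 (Real.log (√3))) ∧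
        V₁ ~[atTop] (fun y => -(2 * y₀ * √(3 * (1 - y₀ ^ 2)) / ((1 - 4 * y₀ ^ 2) * y))) ∧
        (∃ C₁ : ℝ,
          (fun y => V₂ y
              - -(√(1 - y₀ ^ 2) / (√3 * y₀)) * (C₁ / y) * (y₀ / y) ^ 2)
            =o[atTop] (fun y => 1 / y * (y₀ / y) ^ 2)) ∧
        Tendsto V₁ atTop (𝓝 0) ∧ Tendsto V₂ atTop (𝓝 0) := by
  have hh : 0 < SelfSimilarDust.Orbit.h₁ := by
    have := SelfSimilarDust.Orbit.h₀_pos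
    unfold SelfSimilarDust.Orbit.h₁
    positivity
  refine ⟨1 / (2 + 2 * SelfSimilarDust.Orbit.h₁), by positivity, ?_⟩
  intro y₀ h0 hy β₀ hβ V₁ V₂ U Λ σ₁ σ₂ sol
  obtain ⟨h1, h2⟩ := SelfSimilarDust.h₁_le_energy h0 hy hh
  exact ⟨sol.tendsto_U_sub h0 h1 hβ h2, sol.tendsto_Λ h0 h1 hβ h2, sol.V₁_isEquivalent h0 h1 hβ h2,
    sol.exists_V₂_isLittleO h0 h1 hβ h2, sol.tendsto_V₁ h0 h1 hβ h2, sol.tendsto_V₂ h0 h1 hβ h2⟩
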